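/- An arithmetical semigroup is a commutative monoid $\mathcal G$ that is freely generated by a countable set $\mathcal P$ of primes (every element is a product of primes, uniquely up to order), together with a multiplicative norm $|\cdot|:\mathcal G\to(0,\infty)$ such that $\mathcal N(x):=\#\{g\in\mathcal G: |g|\le x\}$ is finite for every real $x$. It satisfies Axiom A with exponent $\theta\in(0,1)$ if there are constants $\kappa>0$ and $A$ with $|\mathcal N(x)-\kappa(x-1)|\le A x^{\theta}$ for all $x\ge1$. In that case its Beurling zeta function $\zeta(s)=\sum_{g\in\mathcal G}|g|^{-s}$ $(\Re s>1)$ continues analytically to $\{\Re s>\theta\}\setminus\{1\}$, and "zero of $\zeta$" refers to this continuation. Let $\Lambda(g):=\log|p|$ if $g=p^k$ with $p\in\mathcal P$ and an integer $k\ge1$, let $\Lambda(g):=0$ for all other $g$, and put $\psi(x):=\sum_{|g|\le x}\Lambda(g)$ and $\Delta(x):=\psi(x)-x$. **Theorem.** Let $\varepsilon>0$, $\beta_0\in(1/2,1)$ and $1/2<r<\beta_0$. Then there exists an arithmetical semigroup $\mathcal G$ which satisfies Axiom A with $\theta=r$, but with no $\theta<r$ (for any choice of $\kappa$ and $A$),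 and whose Beurling zeta function has a zero $\rho_0=\beta_0+i\gamma_0$ with $\gamma_0\neq0$ such that $$|\Delta(x)|\le\left(\frac{\pi}{2}+\varepsilon\right)\frac{x^{\beta_0}}{|\rho_0|}\qquad\text{for all sufficiently large } x.$$ -/

import Mathlib

/-- An arithmetical semigroup (Beurling number system) on the commutative monoid `G`: a countable
set of primes freely generating `G`, and a positive multiplicative norm such that only finitely
many elements have norm below any given bound. -/
structure ArithmeticalSemigroup (G : Type*) [CommMonoid G] where
  /-- The set of primes. -/
  primes : Set G
  countable_primes : primes.Countable
  /-- Every element is the product of exactly one finite multiset of primes. -/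
  freely_generates :
    Function.Bijective fun m : Multiset primes => (m.map (fun p => (p : G))).prod
  /-- The norm. -/
  norm : G →* ℝ
  norm_pos : ∀ g, 0 < norm g
  finite_norm_le : ∀ x : ℝ, {g : G | norm g ≤ x}.Finite

namespace ArithmeticalSemigroup

variable {G : Type*} [CommMonoid G] (S : ArithmeticalSemigroup G)

/-- The counting function `N(x) = #{g : |g| ≤ x}`. -/
noncomputable def count (x : ℝ) : ℕ := {g : G | S.norm g ≤ x}.ncard

/-- Axiom `A(κ, θ)`: `κ > 0`, `0 < θ < 1` and `|N(x) - κ (x - 1)| ≤ A x ^ θ` for all `x ≥ 1`,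
with some constant `A`. -/
def AxiomA (κ θ : ℝ) : Prop :=
  0 < κ ∧ 0 < θ ∧ θ < 1 ∧
    ∃ A : ℝ, ∀ x : ℝ, 1 ≤ x → |(S.count x : ℝ) - κ * (x - 1)| ≤ A * x ^ θ

/-- `Z` is the Beurling zeta function of `S` on `{Re s > θ} \ {1}`: it is holomorphic there, and
for `Re s > 1` it is the sum of the absolutely convergent series `∑ |g| ^ (-s)` over all `g`.
For `θ < 1` the domain is connected, so these conditions determine `Z` on it. -/
def IsZeta (θ : ℝ) (Z : ℂ → ℂ) : Prop :=
  DifferentiableOn ℂ Z {s : ℂ | θ < s.re ∧ s ≠ 1} ∧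
    ∀ s : ℂ, 1 < s.re → HasSum (fun g : G => (S.norm g : ℂ) ^ (-s)) (Z s)

/-- `ρ` is a zero, in the half-plane `Re s > θ`, of the analytically continued zeta function. -/
def IsZetaZero (θ : ℝ) (ρ : ℂ) : Prop :=
  θ < ρ.re ∧ ρ ≠ 1 ∧ ∃ Z : ℂ → ℂ, S.IsZeta θ Z ∧ Z ρ = 0

open Classical in
/-- The von Mangoldt function: `log |p|` if `g = p ^ k` with a prime `p` and `k ≥ 1` (then `p` is
unique, by free generation), and `0` otherwise. -/
noncomputable def vonMangoldt (g : G) : ℝ :=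
  if h : ∃ p : G, p ∈ S.primes ∧ ∃ k : ℕ, 1 ≤ k ∧ g = p ^ k then
    Real.log (S.norm h.choose)
  else 0

/-- The summatory function `ψ(x) = ∑_{|g| ≤ x} Λ(g)`. -/
noncomputable def psi (x : ℝ) : ℝ := ∑ g ∈ (S.finite_norm_le x).toFinset, S.vonMangoldt g

/-- The error term `Δ(x) = ψ(x) - x` in the prime number formula. -/
noncomputable def Delta (x : ℝ) : ℝ := S.psi x - x

end ArithmeticalSemigroup

/-!
A zeta function is prescribed first: simple poles at `1` and at `r`, and simple zeros at
`β₀ ± (2 n + 1) γ i` for `n` in a finite set `A`. It belongs to a continuous density of primes.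
Cut this density into intervals of mass one and choose one prime in each. The logarithm of the zeta
function of the chosen primes differs from the prescribed one by a series converging for
`Re s > 1 / 2`, so the poles and zeros to the right of this line are unchanged, and `ψ` changes by
`O(√x log x)`. Averaging over the choices gives one for which exponential moments of the real part
of this series are bounded on the line `Re s = σ`, with `1 / 2 < σ < r`. That is enough to move the
contour of a smoothed Perron integral to this line, and `N(x) = κ x + c x ^ r + O(x ^ θ)` with
`c ≠ 0` and `θ < r`, so that `r` is the exact exponent in Axiom A.

By construction `-Δ(x) = ∑ 2 Re (x ^ ρ / ρ) + O(x ^ r)` over the zeros `ρ` above the real axis, and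
for large `γ` the sum is close to `2 γ⁻¹ x ^ β₀ ∑ sin ((2 n + 1) u) / (2 n + 1)` over `n ∈ A`, with
`u = γ log x`. The full sine series is a square wave of height `π / 4`, but its partial sums
overshoot this height (the Gibbs phenomenon). Its Poisson means, with weights `Q ^ (2 n + 1)`, do
not. Rounding the small weights at random to `0` or `1` makes the sum run over a set `A`, at the
cost of a small error. Since `|ρ₀| ~ γ` for the lowest zero `ρ₀`, the constant is `π / 2 + ε`.
-/

namespace Beurling

open MeasureTheory Filter Topology Asymptotics Complex
open scoped ComplexConjugate ENNReal

/-! ### Beurling integers modelled on the positive integers -/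

/-- The additive function on `ℕ+` with the value `w p` at the prime `p`. It is the logarithm of the
norm of the arithmetical semigroup constructed from the weights `w`. -/
noncomputable def logSize (w : Nat.Primes → ℝ) (n : ℕ+) : ℝ :=
  (Multiset.map w (PNat.factorMultiset n)).sum

section logSize

variable (w : Nat.Primes → ℝ)

lemma logSize_one : logSize w 1 = 0 := by
  rw [logSize, PNat.factorMultiset_one]
  exact Multiset.sum_zero

lemma logSize_mul (m n : ℕ+) : logSize w (m * n) = logSize w m + logSize w n := by
  rw [logSize, PNat.factorMultiset_mul]
  exact (congrArg Multiset.sum (Multiset.map_add w _ _)).trans (Multiset.sum_add _ _)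

lemma logSize_prime (p : Nat.Primes) : logSize w p = w p := by
  rw [logSize, PNat.factorMultiset_ofPrime]
  exact Multiset.sum_singleton _

lemma logSize_pow (n : ℕ+) (k : ℕ) : logSize w (n ^ k) = k * logSize w n := by
  induction k with
  | zero => simp [logSize_one]
  | succ k ih => rw [pow_succ, logSize_mul, ih]; push_cast; ring

variable {w}

lemma count_factorMultiset_mul_le (hw : ∀ p, 0 < w p) (n : ℕ+) (p : Nat.Primes) :
    (Multiset.count p (PNat.factorMultiset n) : ℝ) * w p ≤ logSize w n := by
  set m : Multiset Nat.Primes := PNat.factorMultiset n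
  have hle : Multiset.replicate (m.count p) p ≤ m := Multiset.le_count_iff_replicate_le.1 le_rfl
  obtain ⟨m', hm'⟩ := Multiset.le_iff_exists_add.1 hle
  have hnonneg : 0 ≤ (m'.map w).sum := Multiset.sum_nonneg fun x hx => by
    obtain ⟨q, -, rfl⟩ := Multiset.mem_map.1 hx
    exact (hw q).le
  calc (m.count p : ℝ) * w p = ((Multiset.replicate (m.count p) p).map w).sum := by
        rw [Multiset.map_replicate, Multiset.sum_replicate, nsmul_eq_mul]
    _ ≤ ((Multiset.replicate (m.count p) p).map w).sum + (m'.map w).sum :=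
        le_add_of_nonneg_right hnonneg
    _ = (m.map w).sum := by rw [← Multiset.sum_add, ← Multiset.map_add, ← hm']

lemma finite_logSize_le (hw : ∀ p, 0 < w p) (hfin : ∀ y, {p | w p ≤ y}.Finite) (y : ℝ) :
    {n : ℕ+ | logSize w n ≤ y}.Finite := by
  let M : Multiset Nat.Primes :=
    ∑ p ∈ (hfin y).toFinset, Multiset.replicate ⌊y / w p⌋₊ p
  refine ((Set.finite_Iic M).preimage
    (f := fun n : ℕ+ => (PNat.factorMultiset n : Multiset Nat.Primes))
    PNat.factorMultisetEquiv.injective.injOn).subset fun n (hn : logSize w n ≤ y) => ?_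
  change (PNat.factorMultiset n : Multiset Nat.Primes) ≤ M
  refine Multiset.le_iff_count.2 fun p => ?_
  rcases Nat.eq_zero_or_pos (Multiset.count p (PNat.factorMultiset n)) with hzero | hpos
  · rw [hzero]
    exact Nat.zero_le _
  have hcount := (count_factorMultiset_mul_le hw n p).trans hn
  have hp : p ∈ (hfin y).toFinset := by
    have hone : (1 : ℝ) ≤ Multiset.count p (PNat.factorMultiset n) := by exact_mod_cast hpos
    rw [Set.Finite.mem_toFinset]
    exact (le_mul_of_one_le_left (hw p).le hone).trans hcount
  calc Multiset.count p (PNat.factorMultiset n)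
      ≤ ⌊y / w p⌋₊ := Nat.le_floor ((le_div_iff₀ (hw p)).2 hcount)
    _ = Multiset.count p (Multiset.replicate ⌊y / w p⌋₊ p) :=
        (Multiset.count_replicate_self _ _).symm
    _ ≤ Multiset.count p M :=
        Multiset.count_le_of_le p (Finset.single_le_sum
          (f := fun p => Multiset.replicate ⌊y / w p⌋₊ p) (fun _ _ => Multiset.zero_le _) hp)

end logSize

lemma bijective_prod_range_coe_primes :
    Function.Bijective fun m : Multiset (Set.range fun p : Nat.Primes => (p : ℕ+)) =>
      (m.map (fun p => (p : ℕ+))).prod := by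
  let e := Equiv.ofInjective _ Nat.Primes.coe_pnat_injective
  have h : (fun m : Multiset (Set.range fun p : Nat.Primes => (p : ℕ+)) =>
      (m.map (fun p => (p : ℕ+))).prod) =
        PNat.factorMultisetEquiv.symm ∘ (Multiset.map e.symm) := by
    funext m
    change (Multiset.map (fun p : ℕ+ => p) (Multiset.bind m fun a => {(a : ℕ+)})).prod =
      (Multiset.map (fun p : Nat.Primes => (p : ℕ+)) (Multiset.map e.symm m)).prod
    rw [Multiset.map_map, Multiset.bind_singleton, Multiset.map_map]
    congr 1
    refine Multiset.map_congr rfl fun p _ => ?_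
    exact (congrArg Subtype.val (e.apply_symm_apply p)).symm
  rw [h]
  exact (Equiv.bijective _).comp ⟨Multiset.map_injective e.symm.injective,
    Multiset.map_surjective_of_surjective e.symm.surjective⟩

/-- The arithmetical semigroup with underlying monoid `ℕ+` in which the prime `p` has norm
`exp (w p)`: since `ℕ+` is freely generated by its primes, only the norm has to be changed. -/
noncomputable def weightedSemigroup (w : Nat.Primes → ℝ) (hw : ∀ p, 0 < w p)
    (hfin : ∀ y, {p | w p ≤ y}.Finite) : ArithmeticalSemigroup ℕ+ where
  primes := Set.range fun p : Nat.Primes => (p : ℕ+)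
  countable_primes := Set.countable_range _
  freely_generates := bijective_prod_range_coe_primes
  norm :=
    { toFun := fun n => Real.exp (logSize w n)
      map_one' := by rw [logSize_one, Real.exp_zero]
      map_mul' := fun m n => by rw [logSize_mul, Real.exp_add] }
  norm_pos := fun _ => Real.exp_pos _
  finite_norm_le := fun x => by
    refine (finite_logSize_le hw hfin (Real.log x)).subset fun n hn => ?_
    have hn : Real.exp (logSize w n) ≤ x := hn
    exact (Real.le_log_iff_exp_le ((Real.exp_pos _).trans_le hn)).2 hn

lemma prime_pow_inj {p q : Nat.Primes} {k l : ℕ} (hk : k ≠ 0)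
    (h : (p : ℕ+) ^ k = (q : ℕ+) ^ l) : p = q ∧ k = l := by
  have h' : (p : ℕ) ^ k = (q : ℕ) ^ l := by
    simpa only [PNat.pow_coe] using! congrArg PNat.val h
  obtain rfl : p = q := by
    have hdvd : (p : ℕ) ∣ (q : ℕ) ^ l := h' ▸ dvd_pow_self _ hk
    exact Subtype.ext ((Nat.prime_dvd_prime_iff_eq p.2 q.2).1 (p.2.dvd_of_dvd_pow hdvd))
  exact ⟨rfl, Nat.pow_right_injective p.2.two_le h'⟩

section weightedSemigroup

variable {w : Nat.Primes → ℝ} (hw : ∀ p, 0 < w p) (hfin : ∀ y, {p | w p ≤ y}.Finite)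

lemma weightedSemigroup_norm (n : ℕ+) :
    (weightedSemigroup w hw hfin).norm n = Real.exp (logSize w n) := rfl

lemma weightedSemigroup_norm_le_iff {x : ℝ} (hx : 0 < x) (n : ℕ+) :
    (weightedSemigroup w hw hfin).norm n ≤ x ↔ logSize w n ≤ Real.log x :=
  (Real.le_log_iff_exp_le hx).symm

lemma weightedSemigroup_norm_prime_pow_le_iff {x : ℝ} (hx : 0 < x) (p : Nat.Primes) {k : ℕ}
    (hk : k ≠ 0) :
    (weightedSemigroup w hw hfin).norm ((p : ℕ+) ^ k) ≤ x ↔ k ≤ ⌊Real.log x / w p⌋₊ := by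
  rw [weightedSemigroup_norm_le_iff hw hfin hx, logSize_pow, logSize_prime, ← le_div_iff₀ (hw p),
    Nat.le_floor_iff' hk]

lemma vonMangoldt_prime_pow (p : Nat.Primes) {k : ℕ} (hk : k ≠ 0) :
    (weightedSemigroup w hw hfin).vonMangoldt ((p : ℕ+) ^ k) = w p := by
  have h : ∃ q : ℕ+, q ∈ (weightedSemigroup w hw hfin).primes ∧
      ∃ l : ℕ, 1 ≤ l ∧ (p : ℕ+) ^ k = q ^ l := ⟨p, ⟨p, rfl⟩, k, Nat.one_le_iff_ne_zero.2 hk, rfl⟩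
  rw [ArithmeticalSemigroup.vonMangoldt, dif_pos h]
  obtain ⟨⟨q, hq⟩, l, -, hpq⟩ := h.choose_spec
  rw [← hq] at hpq ⊢
  obtain ⟨rfl, -⟩ := prime_pow_inj hk hpq
  rw [weightedSemigroup_norm, Real.log_exp, logSize_prime]

lemma psi_eq_sum_floor {x : ℝ} (hx : 0 < x) :
    (weightedSemigroup w hw hfin).psi x =
      ∑ p ∈ (hfin (Real.log x)).toFinset, ⌊Real.log x / w p⌋₊ * w p := by
  classical
  let primePow : (Σ _ : Nat.Primes, ℕ) → ℕ+ := fun a => (a.1 : ℕ+) ^ a.2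
  let D : Finset (Σ _ : Nat.Primes, ℕ) :=
    (hfin (Real.log x)).toFinset.sigma fun p => Finset.Icc 1 ⌊Real.log x / w p⌋₊
  have hD : ∀ {p k}, (⟨p, k⟩ : Σ _ : Nat.Primes, ℕ) ∈ D →
      k ≠ 0 ∧ k ≤ ⌊Real.log x / w p⌋₊ := fun h => by
    obtain ⟨hk, hle⟩ := Finset.mem_Icc.1 (Finset.mem_sigma.1 h).2
    exact ⟨Nat.one_le_iff_ne_zero.1 hk, hle⟩
  have hinj : Set.InjOn primePow D := by
    rintro ⟨p, k⟩ hpk ⟨q, l⟩ - h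
    obtain ⟨rfl, rfl⟩ := prime_pow_inj (hD hpk).1 h
    rfl
  have hpsi : ∑ g ∈ D.image primePow, (weightedSemigroup w hw hfin).vonMangoldt g =
      (weightedSemigroup w hw hfin).psi x := by
    refine Finset.sum_subset (fun g hg => ?_) fun g hg hgD => ?_
    · obtain ⟨⟨p, k⟩, hpk, rfl⟩ := Finset.mem_image.1 hg
      rw [Set.Finite.mem_toFinset]
      exact (weightedSemigroup_norm_prime_pow_le_iff hw hfin hx p (hD hpk).1).2 (hD hpk).2
    · rw [Set.Finite.mem_toFinset] at hg
      rw [ArithmeticalSemigroup.vonMangoldt, dif_neg]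
      rintro ⟨_, ⟨p, rfl⟩, k, hk, rfl⟩
      have hk0 := Nat.one_le_iff_ne_zero.1 hk
      have hkp := (weightedSemigroup_norm_prime_pow_le_iff hw hfin hx p hk0).1 hg
      have hwp : w p ≤ Real.log x := by
        have := (Nat.le_floor_iff' one_ne_zero).1 (hk.trans hkp)
        rwa [Nat.cast_one, one_le_div (hw p)] at this
      exact hgD (Finset.mem_image.2 ⟨⟨p, k⟩, Finset.mem_sigma.2
        ⟨(Set.Finite.mem_toFinset _).2 hwp, Finset.mem_Icc.2 ⟨hk, hkp⟩⟩, rfl⟩)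
  rw [← hpsi, Finset.sum_image hinj, Finset.sum_sigma]
  refine Finset.sum_congr rfl fun p hp => ?_
  rw [Finset.sum_congr rfl fun k hk => vonMangoldt_prime_pow hw hfin p
    (hD (Finset.mem_sigma.2 ⟨hp, hk⟩)).1, Finset.sum_const, Nat.card_Icc, Nat.add_sub_cancel,
    nsmul_eq_mul]

lemma abs_psi_sub_sum_prime_le {x : ℝ} (hx : 1 ≤ x) :
    |(weightedSemigroup w hw hfin).psi x - ∑ p ∈ (hfin (Real.log x)).toFinset, w p| ≤
      (hfin (Real.log x / 2)).toFinset.card * Real.log x := by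
  have hlog : 0 ≤ Real.log x := Real.log_nonneg hx
  rw [psi_eq_sum_floor hw hfin (by linarith), ← Finset.sum_sub_distrib]
  set y := Real.log x
  have hsub : (hfin (y / 2)).toFinset ⊆ (hfin y).toFinset := fun p hp => by
    simp only [Set.Finite.mem_toFinset, Set.mem_ofPred_eq] at hp ⊢
    linarith
  have hratio : ∀ p, 0 ≤ y / w p := fun p => div_nonneg hlog (hw p).le
  rw [← Finset.sum_subset hsub fun p hp hp' => ?large]
  case large =>
    simp only [Set.Finite.mem_toFinset, Set.mem_ofPred_eq, not_le] at hp hp'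
    have hfloor : ⌊y / w p⌋₊ = 1 := by
      rw [Nat.floor_eq_iff (hratio p), Nat.cast_one, one_le_div (hw p), div_lt_iff₀ (hw p)]
      constructor <;> linarith
    rw [hfloor, Nat.cast_one, one_mul, sub_self]
  refine (Finset.abs_sum_le_sum_abs _ _).trans ?_
  rw [← nsmul_eq_mul]
  refine Finset.sum_le_card_nsmul _ _ _ fun p hp => ?_
  have hp' : w p ≤ y := by simpa only [Set.Finite.mem_toFinset, Set.mem_ofPred_eq] using hsub hp
  have hfloor_ge : (1 : ℝ) ≤ ⌊y / w p⌋₊ := by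
    exact_mod_cast Nat.le_floor (by rwa [Nat.cast_one, one_le_div (hw p)])
  have hfloor_le : (⌊y / w p⌋₊ : ℝ) * w p ≤ y :=
    (le_div_iff₀ (hw p)).1 (Nat.floor_le (hratio p))
  rw [abs_of_nonneg (by nlinarith [hw p])]
  linarith [hw p]

end weightedSemigroup

/-! ### The Euler product -/

lemma summable_norm_of_summable_norm_primes {F : Type*} [NormedField F] {f : ℕ →*₀ F}
    (hlt : ∀ p : Nat.Primes, ‖f p‖ < 1) (hsum : Summable fun p : Nat.Primes => ‖f p‖) :
    Summable fun n => ‖f n‖ := by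
  classical
  let g : ℕ →*₀ ℝ := (normHom : F →*₀ ℝ).comp f
  have hg : ∀ n, g n = ‖f n‖ := fun _ => rfl
  have hlog : Summable fun p : Nat.Primes => -Real.log (1 - g p) := by
    have := (Real.summable_log_one_add_of_summable hsum.neg).neg
    simpa only [sub_eq_add_neg, hg] using this
  have hlog_nonneg : ∀ p : Nat.Primes, 0 ≤ -Real.log (1 - g p) := fun p =>
    neg_nonneg.2 (Real.log_nonpos (by rw [hg]; linarith [hlt p])
      (by rw [hg]; linarith [norm_nonneg (f p)]))
  refine summable_of_sum_range_le (c := Real.exp (∑' p : Nat.Primes, -Real.log (1 - g p)))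
    (fun _ => norm_nonneg _) fun N => ?_
  have hsmooth := (EulerProduct.summable_and_hasSum_smoothNumbers_prod_primesBelow_geometric
    (f := (g : ℕ →* ℝ)) (fun {p} hp => by
      simpa only [MonoidHom.coe_coe, hg, norm_norm] using hlt ⟨p, hp⟩) N).2
  calc ∑ n ∈ Finset.range N, g n
      = ∑ n ∈ (Finset.range N).filter (· ∈ N.smoothNumbers), g n := by
        refine (Finset.sum_filter_of_ne (p := (· ∈ N.smoothNumbers)) fun n hn hne => ?_).symm
        have hn0 : n ≠ 0 := by rintro rfl; exact hne (map_zero g)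
        exact Nat.mem_smoothNumbers_of_lt (Nat.pos_of_ne_zero hn0) (Finset.mem_range.1 hn)
    _ = ∑ n ∈ (Finset.range N).subtype (· ∈ N.smoothNumbers), g n :=
        (Finset.sum_subtype_eq_sum_filter g).symm
    _ ≤ ∏ p ∈ N.primesBelow, (1 - g p)⁻¹ :=
        sum_le_hasSum _ (fun n _ => norm_nonneg (f n)) hsmooth
    _ = ∏ p ∈ N.primesBelow.subtype Nat.Prime, (1 - g p)⁻¹ :=
        (Finset.prod_subtype_of_mem (fun p => (1 - g p)⁻¹)
          fun _ => Nat.prime_of_mem_primesBelow).symm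
    _ = Real.exp (∑ p ∈ N.primesBelow.subtype Nat.Prime, -Real.log (1 - g p)) := by
        rw [Real.exp_sum]
        refine Finset.prod_congr rfl fun p _ => ?_
        rw [Real.exp_neg, Real.exp_log (by rw [hg]; exact sub_pos.2 (hlt p))]
    _ ≤ Real.exp (∑' p : Nat.Primes, -Real.log (1 - g p)) :=
        Real.exp_le_exp.2 (Summable.sum_le_tsum (L := .unconditional Nat.Primes) _
          (fun p _ => hlog_nonneg p) hlog)

/-- The completely multiplicative function `n ↦ exp (-s * logSize w n)`, extended by `0` at `0`. -/
noncomputable def expLogSize (w : Nat.Primes → ℝ) (s : ℂ) : ℕ →*₀ ℂ where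
  toFun n := if h : 0 < n then Complex.exp (-s * logSize w ⟨n, h⟩) else 0
  map_zero' := dif_neg (lt_irrefl 0)
  map_one' := by
    have : logSize w ⟨1, one_pos⟩ = 0 := logSize_one w
    simp only [one_pos, dif_pos, this, Complex.ofReal_zero, mul_zero, Complex.exp_zero]
  map_mul' m n := by
    rcases Nat.eq_zero_or_pos m with rfl | hm
    · simp
    rcases Nat.eq_zero_or_pos n with rfl | hn
    · simp
    have : logSize w ⟨m * n, Nat.mul_pos hm hn⟩ = logSize w ⟨m, hm⟩ + logSize w ⟨n, hn⟩ :=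
      logSize_mul w ⟨m, hm⟩ ⟨n, hn⟩
    simp only [hm, hn, Nat.mul_pos hm hn, dif_pos, this, ← Complex.exp_add, Complex.ofReal_add,
      mul_add]

lemma expLogSize_pnat (w : Nat.Primes → ℝ) (s : ℂ) (n : ℕ+) :
    expLogSize w s n = Complex.exp (-s * logSize w n) :=
  dif_pos n.pos

lemma expLogSize_prime (w : Nat.Primes → ℝ) (s : ℂ) (p : Nat.Primes) :
    expLogSize w s p = Complex.exp (-s * w p) := by
  simpa only [logSize_prime] using! expLogSize_pnat w s p

lemma norm_exp_neg_mul (s : ℂ) (l : ℝ) : ‖Complex.exp (-s * l)‖ = Real.exp (-s.re * l) := by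
  rw [Complex.norm_exp, Complex.re_mul_ofReal, Complex.neg_re]

lemma hasSum_exp_logSize {w : Nat.Primes → ℝ} (hw : ∀ p, 0 < w p) {s : ℂ} (hs : 0 < s.re)
    (hsum : Summable fun p => Real.exp (-s.re * w p)) :
    HasSum (fun n : ℕ+ => Complex.exp (-s * logSize w n))
      (Complex.exp (∑' p, -Complex.log (1 - Complex.exp (-s * w p)))) := by
  have hnorm : ∀ p : Nat.Primes, ‖expLogSize w s p‖ = Real.exp (-s.re * w p) := fun p => by
    rw [expLogSize_prime, norm_exp_neg_mul]
  have hS : Summable fun n => ‖expLogSize w s n‖ := by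
    refine summable_norm_of_summable_norm_primes (fun p => ?_) (hsum.congr fun p => (hnorm p).symm)
    rw [hnorm, Real.exp_lt_one_iff]
    nlinarith [hw p]
  have hvanish : ∀ n ∉ Set.range ((↑) : ℕ+ → ℕ), expLogSize w s n = 0 := fun n hn => by
    have hn0 : n = 0 := by_contra fun h => hn ⟨⟨n, Nat.pos_of_ne_zero h⟩, rfl⟩
    rw [hn0, map_zero]
  have hpnat := (PNat.coe_injective.hasSum_iff hvanish).2 hS.of_norm.hasSum
  simpa only [Function.comp_def, expLogSize_pnat, ← EulerProduct.exp_tsum_primes_log_eq_tsum hS,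
    expLogSize_prime] using hpnat

/-! ### Contour shifts and the inverse Laplace transform of `1 / s ^ 2` -/

section VerticalLines

variable {H : ℂ → ℂ} {a b B σ : ℝ}

lemma verticalIntegrable_of_norm_le (hcont : Continuous fun t : ℝ => H (σ + t * I))
    (hB : ∀ t : ℝ, ‖H (σ + t * I)‖ ≤ B * (1 + t ^ 2)⁻¹) : VerticalIntegrable H σ :=
  (integrable_inv_one_add_sq.const_mul B).mono' hcont.aestronglyMeasurable
    (Eventually.of_forall hB)

lemma tendsto_integral_horizontal_edge (hab : a ≤ b)
    (hB : ∀ s : ℂ, a ≤ s.re → s.re ≤ b → ‖H s‖ ≤ B * (1 + s.im ^ 2)⁻¹) {τ : ℝ → ℝ}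
    (hτ : Tendsto (fun T => τ T ^ 2) atTop atTop) :
    Tendsto (fun T => ∫ x in a..b, H (x + τ T * I)) atTop (𝓝 0) := by
  have hlim : Tendsto (fun T => B * (1 + τ T ^ 2)⁻¹ * |b - a|) atTop (𝓝 0) := by
    have := ((tendsto_inv_atTop_zero.comp
      (tendsto_atTop_add_const_left _ 1 hτ)).const_mul B).mul_const |b - a|
    simpa only [mul_zero, zero_mul, Function.comp_def] using this
  refine squeeze_zero_norm (fun T => ?_) hlim
  refine intervalIntegral.norm_integral_le_of_norm_le_const fun x hx => ?_
  rw [Set.uIoc_of_le hab] at hx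
  simpa using hB (x + τ T * I) (by simpa using hx.1.le) (by simpa using hx.2)

lemma integral_vertical_eq (hab : a ≤ b)
    (hH : DifferentiableOn ℂ H {s | a ≤ s.re ∧ s.re ≤ b})
    (hB : ∀ s : ℂ, a ≤ s.re → s.re ≤ b → ‖H s‖ ≤ B * (1 + s.im ^ 2)⁻¹) :
    VerticalIntegrable H a ∧ VerticalIntegrable H b ∧
      ∫ t : ℝ, H (a + t * I) = ∫ t : ℝ, H (b + t * I) := by
  have hinteg : ∀ c : ℝ, a ≤ c → c ≤ b → VerticalIntegrable H c := fun c hac hcb => by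
    refine verticalIntegrable_of_norm_le (B := B) ?_ fun t => ?_
    · exact hH.continuousOn.comp_continuous (by fun_prop) fun t => by simp [hac, hcb]
    · simpa using hB (c + t * I) (by simpa using hac) (by simpa using hcb)
  have ha := hinteg a le_rfl hab
  have hb := hinteg b hab le_rfl
  have hrect : ∀ T : ℝ,
      (∫ x in a..b, H (x + T * I)) - ∫ x in a..b, H (x + (-T : ℝ) * I) =
        I • (∫ y in (-T)..T, H (b + y * I)) - I • ∫ y in (-T)..T, H (a + y * I) := fun T => by
    have := integral_boundary_rect_eq_zero_of_differentiableOn H (a + (-T : ℝ) * I) (b + T * I)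
      (hH.mono fun s hs => by simpa [Set.uIcc_of_le hab] using hs.1)
    simp only [add_re, ofReal_re, mul_re, I_re, mul_zero, ofReal_im, I_im, mul_one, sub_self,
      add_zero, add_im, mul_im, zero_add] at this
    linear_combination -this
  have hvert := ((intervalIntegral_tendsto_integral hb tendsto_neg_atTop_atBot
    tendsto_id).const_smul I).sub ((intervalIntegral_tendsto_integral ha tendsto_neg_atTop_atBot
    tendsto_id).const_smul I)
  have hhor := (tendsto_integral_horizontal_edge hab hB (τ := id)
    (tendsto_pow_atTop two_ne_zero)).sub (tendsto_integral_horizontal_edge hab hB (τ := Neg.neg)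
    (by simpa only [neg_sq] using tendsto_pow_atTop (α := ℝ) two_ne_zero))
  have hsub_eq_zero := tendsto_nhds_unique hvert (hhor.congr hrect)
  rw [sub_zero, ← smul_sub, smul_eq_zero_iff_right I_ne_zero, sub_eq_zero] at hsub_eq_zero
  exact ⟨ha, hb, hsub_eq_zero.symm⟩

end VerticalLines

section ReferenceKernel

lemma inv_sq_add_sq_le {d : ℝ} (hd : 0 < d) (t : ℝ) :
    (d ^ 2 + t ^ 2)⁻¹ ≤ (1 + (d ^ 2)⁻¹) * (1 + t ^ 2)⁻¹ := by
  rw [← div_eq_mul_inv, inv_eq_one_div, div_le_div_iff₀ (by positivity) (by positivity)]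
  have hd1 : (d ^ 2)⁻¹ * d ^ 2 = 1 := inv_mul_cancel₀ (by positivity)
  have hdt : 0 ≤ (d ^ 2)⁻¹ * t ^ 2 := by positivity
  nlinarith [sq_nonneg d]

lemma norm_inv_sq_sub_sq_le {a d : ℝ} (ha : 0 ≤ a) (hd : 0 < d) {s : ℂ} (hs : 0 ≤ s.re)
    (hsd : d ≤ |s.re - a|) : ‖(s ^ 2 - a ^ 2 : ℂ)⁻¹‖ ≤ (d ^ 2 + s.im ^ 2)⁻¹ := by
  have hminus : ‖s - a‖ ^ 2 = (s.re - a) ^ 2 + s.im ^ 2 := by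
    rw [← normSq_eq_norm_sq, normSq_apply]; simp [sq]
  have hplus : ‖s + a‖ ^ 2 = (s.re + a) ^ 2 + s.im ^ 2 := by
    rw [← normSq_eq_norm_sq, normSq_apply]; simp [sq]
  have hle : ‖s - a‖ ≤ ‖s + a‖ :=
    le_of_sq_le_sq (by rw [hminus, hplus]; nlinarith) (norm_nonneg _)
  have hdist : d ^ 2 ≤ (s.re - a) ^ 2 := by rw [← sq_abs (s.re - a)]; gcongr
  rw [norm_inv]
  refine inv_anti₀ (by positivity) ?_
  calc d ^ 2 + s.im ^ 2 ≤ ‖s - a‖ * ‖s - a‖ := by rw [← sq, hminus]; gcongr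
    _ ≤ ‖s - a‖ * ‖s + a‖ := by gcongr
    _ = ‖s ^ 2 - a ^ 2‖ := by rw [← norm_mul]; ring_nf

lemma integral_inv_sq_add_sq {d : ℝ} (hd : 0 < d) :
    Integrable (fun t : ℝ => (d ^ 2 + t ^ 2)⁻¹) ∧ ∫ t : ℝ, (d ^ 2 + t ^ 2)⁻¹ = Real.pi / d := by
  have heq : (fun t : ℝ => (d ^ 2 + t ^ 2)⁻¹) =
      fun t => (d ^ 2)⁻¹ * (1 + (d⁻¹ * t) ^ 2)⁻¹ := funext fun t => by field_simp
  rw [heq]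
  refine ⟨(integrable_inv_one_add_sq.comp_mul_left' (inv_ne_zero hd.ne')).const_mul _, ?_⟩
  rw [integral_const_mul, Measure.integral_comp_mul_left (fun x => (1 + x ^ 2)⁻¹),
    integral_univ_inv_one_add_sq, inv_inv, abs_of_pos hd, smul_eq_mul]
  field_simp

variable {a σ τ : ℝ}

lemma verticalIntegrable_inv_sq_sub_sq (ha : 0 ≤ a) (hσ : 0 ≤ σ) (hne : σ ≠ a) :
    VerticalIntegrable (fun s => (s ^ 2 - a ^ 2)⁻¹) σ := by
  have hd : 0 < |σ - a| := abs_pos.2 (sub_ne_zero.2 hne)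
  refine (integral_inv_sq_add_sq hd).1.mono'
    (Measurable.inv (by fun_prop)).aestronglyMeasurable (Eventually.of_forall fun t => ?_)
  simpa using norm_inv_sq_sub_sq_le ha hd (s := σ + t * I) (by simpa using hσ) (by simp)

lemma integral_inv_sq_sub_sq_congr (ha : 0 ≤ a) (hσ : 0 ≤ σ) (hστ : σ ≤ τ)
    (hout : τ < a ∨ a < σ) :
    ∫ t : ℝ, ((σ + t * I : ℂ) ^ 2 - a ^ 2)⁻¹ = ∫ t : ℝ, ((τ + t * I : ℂ) ^ 2 - a ^ 2)⁻¹ := by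
  obtain ⟨d, hd, hdist⟩ : ∃ d > 0, ∀ x, σ ≤ x → x ≤ τ → d ≤ |x - a| := by
    rcases hout with h | h
    · refine ⟨a - τ, sub_pos.2 h, fun x _ hx => ?_⟩
      rw [abs_of_nonpos (by linarith)]
      linarith
    · refine ⟨σ - a, sub_pos.2 h, fun x hx _ => ?_⟩
      rw [abs_of_nonneg (by linarith)]
      linarith
  refine (integral_vertical_eq (H := fun s => (s ^ 2 - a ^ 2)⁻¹) hστ
    (DifferentiableOn.inv (by fun_prop) fun s hs h => ?_) fun s hsσ hsb =>
      (norm_inv_sq_sub_sq_le ha hd (hσ.trans hsσ) (hdist _ hsσ hsb)).trans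
        (inv_sq_add_sq_le hd s.im)).2.2
  have hsa : d ≤ |s.re - a| := hdist _ hs.1 hs.2
  rcases sq_eq_sq_iff_eq_or_eq_neg.1 (sub_eq_zero.1 h) with rfl | rfl
  · simp only [ofReal_re, sub_self, abs_zero] at hsa
    linarith
  · have hre : σ ≤ -a := by simpa using hs.1
    have ha_zero : a = 0 := by linarith
    simp only [ha_zero, ofReal_zero, neg_zero, zero_re, sub_self, abs_zero] at hsa
    linarith

lemma integral_inv_sq_sub_sq_of_lt (hσ : 0 ≤ σ) (hσa : σ < a) :
    ∫ t : ℝ, ((σ + t * I : ℂ) ^ 2 - a ^ 2)⁻¹ = -(Real.pi / a : ℝ) := by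
  have ha : 0 < a := hσ.trans_lt hσa
  have haxis : ∀ t : ℝ, (((0 : ℝ) + t * I : ℂ) ^ 2 - a ^ 2)⁻¹ =
      ((-(a ^ 2 + t ^ 2)⁻¹ : ℝ) : ℂ) := fun t => by
    rw [← inv_neg, ofReal_inv]
    congr 1
    push_cast
    rw [zero_add, mul_pow, I_sq]
    ring
  rw [← integral_inv_sq_sub_sq_congr ha.le le_rfl hσ (Or.inl hσa)]
  simp_rw [haxis]
  rw [integral_complex_ofReal, integral_neg, (integral_inv_sq_add_sq ha).2, ofReal_neg]

lemma integral_inv_sq_sub_sq_of_gt (ha : 0 ≤ a) (hσa : a < σ) :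
    ∫ t : ℝ, ((σ + t * I : ℂ) ^ 2 - a ^ 2)⁻¹ = 0 := by
  have hbound : ∀ R : ℝ, σ ≤ R →
      ‖∫ t : ℝ, ((σ + t * I : ℂ) ^ 2 - a ^ 2)⁻¹‖ ≤ Real.pi / (R - a) := fun R hR => by
    have hd : 0 < R - a := by linarith
    rw [integral_inv_sq_sub_sq_congr ha (ha.trans hσa.le) hR (Or.inr hσa),
      ← (integral_inv_sq_add_sq hd).2]
    refine norm_integral_le_of_norm_le (integral_inv_sq_add_sq hd).1
      (Eventually.of_forall fun t => ?_)
    simpa using norm_inv_sq_sub_sq_le ha hd (s := R + t * I) (by simp; linarith)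
      (by simpa using le_abs_self (R - a))
  have hlim : Tendsto (fun R : ℝ => Real.pi / (R - a)) atTop (𝓝 0) :=
    (tendsto_atTop_add_const_right atTop (-a) tendsto_id).const_div_atTop _
  exact norm_le_zero_iff.1 (ge_of_tendsto hlim ((eventually_ge_atTop σ).mono hbound))

end ReferenceKernel

section Residues

variable {f : ℂ → ℂ} {a b c σ B : ℝ}

lemma exists_norm_dslope_le (hσb : σ ≤ b) (hf : ContinuousOn (dslope f a) {s | σ ≤ s.re})
    (hfa : f a = 0) (hB : ∀ s : ℂ, σ ≤ s.re → s.re ≤ b → ‖f s‖ * |s.im| ≤ B) :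
    ∃ C, ∀ s : ℂ, σ ≤ s.re → s.re ≤ b → ‖dslope f a s‖ ≤ C * (1 + s.im ^ 2)⁻¹ := by
  have hcomp : IsCompact (Set.Icc σ b ×ℂ Set.Icc (-1) 1) := isCompact_Icc.reProdIm isCompact_Icc
  obtain ⟨M, hM⟩ := hcomp.exists_bound_of_continuousOn (hf.mono fun s hs => hs.1.1)
  have hB0 : 0 ≤ B := by simpa using hB σ (by simp) (by simpa using hσb)
  have hM0 : 0 ≤ M := (norm_nonneg _).trans (hM σ (by simpa [mem_reProdIm] using hσb))
  refine ⟨2 * M + 2 * B, fun s hsσ hsb => ?_⟩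
  rw [← div_eq_mul_inv, le_div_iff₀ (by positivity)]
  rcases le_or_gt |s.im| 1 with him | him
  · have hsq : s.im ^ 2 ≤ 1 := (sq_le_one_iff_abs_le_one _).2 him
    calc ‖dslope f a s‖ * (1 + s.im ^ 2) ≤ M * 2 := by
          gcongr
          · exact hM s ⟨⟨hsσ, hsb⟩, abs_le.1 him⟩
          · linarith
      _ ≤ 2 * M + 2 * B := by linarith
  · have hne : s ≠ a := by
      rintro rfl
      rw [ofReal_im, abs_zero] at him
      linarith
    have hsq : 1 < s.im ^ 2 := (one_lt_sq_iff_one_lt_abs _).2 him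
    have hdist : |s.im| ≤ ‖s - a‖ := by simpa using abs_im_le_norm (s - a)
    rw [dslope_of_ne _ hne, slope_def_field, hfa, sub_zero, norm_div, div_mul_eq_mul_div,
      div_le_iff₀ (by linarith)]
    calc ‖f s‖ * (1 + s.im ^ 2) ≤ ‖f s‖ * (2 * (|s.im| * |s.im|)) := by
          gcongr
          rw [abs_mul_abs_self, ← sq]
          linarith
      _ = 2 * (‖f s‖ * |s.im|) * |s.im| := by ring
      _ ≤ 2 * B * ‖s - a‖ := by gcongr; exact hB s hsσ hsb
      _ ≤ (2 * M + 2 * B) * ‖s - a‖ := by gcongr; linarith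

lemma add_ofReal_ne_zero {s : ℂ} {x : ℝ} (h : 0 < s.re + x) : s + x ≠ 0 := fun h0 =>
  h.ne' (by simpa using congrArg re h0)

/-- The residue is carried by the reference kernel `2 * a / (s ^ 2 - a ^ 2)`, which has residue `1`
at `a` and, unlike `1 / (s - a)`, is integrable along vertical lines. -/
lemma exists_div_sub_eq_add_kernel (hcσ : c < σ) (hσ : 0 ≤ σ) (hσa : σ < a) (hab : a < b)
    (hf : DifferentiableOn ℂ f {s | c < s.re})
    (hB : ∀ s : ℂ, σ ≤ s.re → s.re ≤ b → ‖f s‖ * |s.im| ≤ B) :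
    ∃ (H : ℂ → ℂ) (C : ℝ), DifferentiableOn ℂ H {s | σ ≤ s.re} ∧
      (∀ s : ℂ, σ ≤ s.re → s.re ≤ b → ‖H s‖ ≤ C * (1 + s.im ^ 2)⁻¹) ∧
      ∀ s : ℂ, σ ≤ s.re → s ≠ a → f s / (s - a) = H s + 2 * a * f a * (s ^ 2 - a ^ 2)⁻¹ := by
  have ha : 0 < a := hσ.trans_lt hσa
  let g : ℂ → ℂ := fun s => f s - f a * (2 * a / (s + a))
  have hU : {s : ℂ | max c (-a) < s.re} ∈ 𝓝 (a : ℂ) :=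
    (isOpen_lt continuous_const continuous_re).mem_nhds
      (by simp only [Set.mem_ofPred_eq, ofReal_re, max_lt_iff]; constructor <;> linarith)
  have hg : DifferentiableOn ℂ g {s | max c (-a) < s.re} := by
    refine (hf.mono fun s (hs : _ < s.re) => show c < s.re from (le_max_left _ _).trans_lt hs).sub
      ((DifferentiableOn.div (by fun_prop) (by fun_prop) fun s hs => ?_).const_mul _)
    have : -a < s.re := (le_max_right c _).trans_lt hs
    exact add_ofReal_ne_zero (by linarith)
  have hga : g a = 0 := by
    have : (a + a : ℂ) ≠ 0 := add_ofReal_ne_zero (by simp [ha])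
    simp only [g, two_mul, div_self this, mul_one, sub_self]
  have hH : DifferentiableOn ℂ (dslope g a) {s | σ ≤ s.re} :=
    ((differentiableOn_dslope hU).2 hg).mono fun s (hs : σ ≤ s.re) =>
      show max c (-a) < s.re from (max_lt hcσ (by linarith)).trans_le hs
  have hgB : ∀ s : ℂ, σ ≤ s.re → s.re ≤ b → ‖g s‖ * |s.im| ≤ B + ‖f a‖ * (2 * a) := by
    intro s hsσ hsb
    have hne : s + a ≠ 0 := add_ofReal_ne_zero (by linarith)
    have him : |s.im| ≤ ‖s + a‖ := by simpa using abs_im_le_norm (s + a)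
    calc ‖g s‖ * |s.im| ≤ (‖f s‖ + ‖f a‖ * (2 * a / ‖s + a‖)) * |s.im| := by
          gcongr
          refine (norm_sub_le _ _).trans_eq ?_
          simp [abs_of_pos ha]
      _ = ‖f s‖ * |s.im| + ‖f a‖ * (2 * a) * (|s.im| / ‖s + a‖) := by ring
      _ ≤ B + ‖f a‖ * (2 * a) := by
          exact add_le_add (hB s hsσ hsb) (mul_le_of_le_one_right (by positivity)
            ((div_le_one (norm_pos_iff.2 hne)).2 him))
  obtain ⟨C, hC⟩ := exists_norm_dslope_le (by linarith : σ ≤ b) hH.continuousOn hga hgB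
  refine ⟨dslope g a, C, hH, hC, fun s hs hsa => ?_⟩
  rw [dslope_of_ne _ hsa, slope_def_field, hga, sub_zero, sq_sub_sq]
  have hsub_ne : s - a ≠ 0 := sub_ne_zero.2 hsa
  have hadd_ne : s + a ≠ 0 := add_ofReal_ne_zero (by linarith)
  simp only [g]
  field_simp
  ring

lemma integral_div_sub_eq_add_residue (hcσ : c < σ) (hσ : 0 ≤ σ) (hσa : σ < a) (hab : a < b)
    (hf : DifferentiableOn ℂ f {s | c < s.re})
    (hB : ∀ s : ℂ, σ ≤ s.re → s.re ≤ b → ‖f s‖ * |s.im| ≤ B) :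
    VerticalIntegrable (fun s => f s / (s - a)) σ ∧
      VerticalIntegrable (fun s => f s / (s - a)) b ∧
      ∫ t : ℝ, f (b + t * I) / (b + t * I - a) =
        (∫ t : ℝ, f (σ + t * I) / (σ + t * I - a)) + 2 * Real.pi * f a := by
  have ha : 0 < a := hσ.trans_lt hσa
  obtain ⟨H, C, hH, hC, hdecomp⟩ := exists_div_sub_eq_add_kernel hcσ hσ hσa hab hf hB
  obtain ⟨hHσ, hHb, hHeq⟩ := integral_vertical_eq (by linarith : σ ≤ b)
    (hH.mono fun s hs => hs.1) hC
  have hline : ∀ ρ : ℝ, σ ≤ ρ → ρ ≠ a → VerticalIntegrable H ρ →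
      VerticalIntegrable (fun s => f s / (s - a)) ρ ∧
        ∫ t : ℝ, f (ρ + t * I) / (ρ + t * I - a) = (∫ t : ℝ, H (ρ + t * I)) +
          2 * a * f a * ∫ t : ℝ, ((ρ + t * I : ℂ) ^ 2 - a ^ 2)⁻¹ := fun ρ hρ hρa hHρ => by
    have hkernel := (verticalIntegrable_inv_sq_sub_sq ha.le (hσ.trans hρ) hρa).const_mul
      (2 * a * f a)
    have heq : (fun t : ℝ => f (ρ + t * I) / (ρ + t * I - a)) = fun t : ℝ =>
        H (ρ + t * I) + 2 * a * f a * ((ρ + t * I : ℂ) ^ 2 - a ^ 2)⁻¹ := funext fun t =>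
      hdecomp _ (by simpa using hρ) fun h => hρa (by simpa using congrArg re h)
    rw [VerticalIntegrable, heq]
    exact ⟨hHρ.add hkernel, by rw [integral_add hHρ hkernel, integral_const_mul]⟩
  obtain ⟨hσi, hσeq⟩ := hline σ le_rfl hσa.ne hHσ
  obtain ⟨hbi, hbeq⟩ := hline b (by linarith) hab.ne' hHb
  refine ⟨hσi, hbi, ?_⟩
  rw [hσeq, hbeq, integral_inv_sq_sub_sq_of_lt hσ hσa, integral_inv_sq_sub_sq_of_gt ha.le hab,
    hHeq]
  generalize ∫ t : ℝ, H (b + t * I) = J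
  have ha0 : (a : ℂ) ≠ 0 := ofReal_ne_zero.2 ha.ne'
  push_cast
  field_simp
  ring

-- The factor `s + 1` makes the partial fractions of `(s + 1) / ((s - a') * (s - a))` integrable.
lemma integral_div_mul_sub_eq_sub {P : ℂ → ℂ} {a' ρ : ℝ} (hρ : -1 < ρ) (haa' : a ≠ a')
    (hρa : ρ ≠ a) (hρa' : ρ ≠ a') (i : VerticalIntegrable (fun s => P s / (s + 1) / (s - a)) ρ)
    (i' : VerticalIntegrable (fun s => P s / (s + 1) / (s - a')) ρ) :
    ∫ t : ℝ, P (ρ + t * I) / ((ρ + t * I - a') * (ρ + t * I - a)) =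
      ((a' + 1) / (a' - a)) * (∫ t : ℝ, P (ρ + t * I) / (ρ + t * I + 1) / (ρ + t * I - a')) -
        ((a + 1) / (a' - a)) * ∫ t : ℝ, P (ρ + t * I) / (ρ + t * I + 1) / (ρ + t * I - a) := by
  rw [← integral_const_mul, ← integral_const_mul,
    ← integral_sub (i'.const_mul _) (i.const_mul _)]
  congr 1 with t
  have hne : (a' - a : ℂ) ≠ 0 := by exact_mod_cast sub_ne_zero.2 haa'.symm
  have hadd_one : (ρ + t * I : ℂ) + 1 ≠ 0 := by
    exact_mod_cast add_ofReal_ne_zero (s := ρ + t * I) (x := 1) (by simpa using by linarith)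
  have hsub_a : (ρ + t * I : ℂ) - a ≠ 0 := fun h0 => hρa (by
    simpa [sub_eq_zero] using congrArg re h0)
  have hsub_a' : (ρ + t * I : ℂ) - a' ≠ 0 := fun h0 => hρa' (by
    simpa [sub_eq_zero] using congrArg re h0)
  field_simp
  ring

lemma integral_div_mul_sub_eq_add_residues {P : ℂ → ℂ} {a' : ℝ} (hcσ : c < σ) (hσ : 0 ≤ σ)
    (hσa : σ < a) (haa' : a < a') (ha'b : a' < b) (hP : DifferentiableOn ℂ P {s | c < s.re})
    (hB : ∀ s : ℂ, σ ≤ s.re → s.re ≤ b → ‖P s‖ ≤ B) :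
    ∫ t : ℝ, P (b + t * I) / ((b + t * I - a') * (b + t * I - a)) =
      (∫ t : ℝ, P (σ + t * I) / ((σ + t * I - a') * (σ + t * I - a))) +
        2 * Real.pi * ((P a' - P a) / (a' - a)) := by
  let f : ℂ → ℂ := fun s => P s / (s + 1)
  have hne : ∀ s : ℂ, -1 < s.re → s + 1 ≠ 0 := fun s hs => by
    exact_mod_cast add_ofReal_ne_zero (x := 1) (by linarith : 0 < s.re + 1)
  have hf : DifferentiableOn ℂ f {s | max c (-1) < s.re} :=
    (hP.mono fun s (hs : _ < s.re) => show c < s.re from (le_max_left _ _).trans_lt hs).div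
      (by fun_prop) fun s (hs : _ < s.re) => hne s ((le_max_right c _).trans_lt hs)
  have hfB : ∀ s : ℂ, σ ≤ s.re → s.re ≤ b → ‖f s‖ * |s.im| ≤ B := fun s hsσ hsb => by
    have him : |s.im| ≤ ‖s + 1‖ := by simpa using abs_im_le_norm (s + 1)
    rw [norm_div, div_mul_eq_mul_div]
    refine (div_le_of_le_mul₀ (norm_nonneg _) ((norm_nonneg _).trans (hB s hsσ hsb)) ?_)
    exact mul_le_mul (hB s hsσ hsb) him (abs_nonneg _) ((norm_nonneg _).trans (hB s hsσ hsb))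
  have hcσ' : max c (-1) < σ := max_lt hcσ (by linarith)
  obtain ⟨iσ, ib, h⟩ := integral_div_sub_eq_add_residue hcσ' hσ hσa (haa'.trans ha'b) hf hfB
  obtain ⟨iσ', ib', h'⟩ := integral_div_sub_eq_add_residue hcσ' hσ (hσa.trans haa') ha'b hf hfB
  have hsub : (a' - a : ℂ) ≠ 0 := by exact_mod_cast sub_ne_zero.2 haa'.ne'
  rw [integral_div_mul_sub_eq_sub (by linarith) haa'.ne (haa'.trans ha'b).ne' ha'b.ne' ib ib',
    integral_div_mul_sub_eq_sub (by linarith) haa'.ne hσa.ne (hσa.trans haa').ne iσ iσ', h, h']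
  simp only [f]
  generalize ∫ t : ℝ, P (σ + t * I) / (σ + t * I + 1) / (σ + t * I - a) = J
  generalize ∫ t : ℝ, P (σ + t * I) / (σ + t * I + 1) / (σ + t * I - a') = J'
  have na := hne a (by rw [ofReal_re]; linarith)
  have na' := hne a' (by rw [ofReal_re]; linarith)
  field_simp
  ring

end Residues

section InverseLaplace

lemma verticalIntegrable_inv_sq {c : ℝ} (hc : 0 < c) :
    VerticalIntegrable (fun s => (s ^ 2)⁻¹) c := by
  simpa only [ofReal_zero, zero_pow two_ne_zero, sub_zero] using
    verticalIntegrable_inv_sq_sub_sq le_rfl hc.le hc.ne'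

lemma hasMellin_max_neg_log {s : ℂ} (hs : 0 < s.re) :
    HasMellin (fun t => ((max (-Real.log t) 0 : ℝ) : ℂ)) s (s ^ 2)⁻¹ := by
  let χ : ℝ → ℂ := Set.indicator (Set.Ioc 0 1) fun _ => 1
  have hlog : Set.EqOn (fun t : ℝ => -(Real.log t • χ t))
      (fun t => ((max (-Real.log t) 0 : ℝ) : ℂ)) (Set.Ioi 0) := fun t (ht : 0 < t) => by
    rcases le_or_gt t 1 with h | h
    · simp [χ, ht, h, Real.log_nonpos ht.le h]
    · simp [χ, not_le.2 h, (Real.log_pos h).le]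
  have htop : χ =O[atTop] (· ^ (-(s.re + 1))) :=
    (isBigO_zero _ _).congr' ((eventually_gt_atTop 1).mono fun t ht => by
      simp [χ, not_le.2 ht]) EventuallyEq.rfl
  have hbot : χ =O[𝓝[>] 0] (· ^ (-0 : ℝ)) := by
    refine IsBigO.of_bound 1 (Eventually.of_forall fun t => ?_)
    simp only [neg_zero, Real.rpow_zero, norm_one, mul_one, χ]
    exact (norm_indicator_le_norm_self _ _).trans_eq norm_one
  obtain ⟨hconv, hderiv⟩ := mellin_hasDerivAt_of_isBigO_rpow (f := χ) (s := s)
    ((locallyIntegrable_const (1 : ℂ)).indicator measurableSet_Ioc |>.locallyIntegrableOn _)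
    htop (lt_add_one _) hbot hs
  have hχ : mellin χ =ᶠ[𝓝 s] fun z => z⁻¹ := by
    filter_upwards [(isOpen_lt continuous_const continuous_re).mem_nhds hs] with z hz
    rw [(hasMellin_one_Ioc hz).2, one_div]
  have hs0 : s ≠ 0 := fun h => hs.ne' (congrArg re h)
  have hderiv' := hderiv.unique ((hasDerivAt_inv hs0).congr_of_eventuallyEq hχ)
  refine ⟨hconv.neg.congr_fun (fun t ht => ?_) measurableSet_Ioi, ?_⟩
  · simp only [Pi.neg_apply, ← hlog ht, smul_neg]
  · rw [mellin, ← setIntegral_congr_fun (f := fun t : ℝ => -((t : ℂ) ^ (s - 1) • Real.log t • χ t))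
      measurableSet_Ioi fun t ht => by simp only [← hlog ht, smul_neg], integral_neg]
    exact neg_eq_iff_eq_neg.2 hderiv'

lemma integral_exp_div_sq {c : ℝ} (hc : 0 < c) (y : ℝ) :
    VerticalIntegrable (fun s => exp (s * y) / s ^ 2) c ∧
      ∫ t : ℝ, exp ((c + t * I) * y) / (c + t * I) ^ 2 = ((2 * Real.pi * max y 0 : ℝ) : ℂ) := by
  have hmellin : ∀ t : ℝ, HasMellin (fun t => ((max (-Real.log t) 0 : ℝ) : ℂ)) (c + t * I)
      ((c + t * I) ^ 2)⁻¹ := fun t => hasMellin_max_neg_log (by simpa using hc)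
  have hcont : ContinuousAt (fun t => ((max (-Real.log t) 0 : ℝ) : ℂ)) (Real.exp (-y)) :=
    continuous_ofReal.continuousAt.comp
      ((Real.continuousAt_log (Real.exp_pos _).ne').neg.max continuousAt_const)
  have hinv := mellinInv_mellin_eq c (fun t => ((max (-Real.log t) 0 : ℝ) : ℂ))
    (Real.exp_pos (-y)) (by simpa using (hmellin 0).1)
    ((verticalIntegrable_inv_sq hc).congr (Eventually.of_forall fun t => (hmellin t).2.symm)) hcont
  have hcpow : ∀ s : ℂ, (Real.exp (-y) : ℂ) ^ (-s) = exp (s * y) := fun s => by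
    rw [cpow_def_of_ne_zero (ofReal_ne_zero.2 (Real.exp_pos _).ne'), ← ofReal_log
      (Real.exp_pos _).le, Real.log_exp]
    push_cast
    ring_nf
  constructor
  · refine (verticalIntegrable_inv_sq hc).bdd_mul (c := Real.exp (c * y)) (by fun_prop)
      (Eventually.of_forall fun t => ?_)
    rw [norm_exp]
    simp
  · simp only [mellinInv, hcpow, (hmellin _).2, smul_eq_mul, ← div_eq_mul_inv, Real.log_exp,
      neg_neg] at hinv
    rw [real_smul, ← eq_inv_mul_iff_mul_eq₀ (by simp [Real.pi_ne_zero])] at hinv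
    rw [hinv]
    push_cast
    field_simp

end InverseLaplace

/-! ### Logarithms of local factors -/

lemma norm_exp_neg_mul_le_of_abs_le {s s₀ : ℂ} {τ M : ℝ} (hs : s ∈ Metric.ball s₀ 1)
    (hτ : |τ| ≤ M) : ‖exp (-s * τ)‖ ≤ Real.exp ((‖s₀‖ + 1) * M) := by
  have hs' : ‖s‖ ≤ ‖s₀‖ + 1 :=
    (norm_le_norm_add_norm_sub' s s₀).trans (by gcongr; exact (mem_ball_iff_norm.1 hs).le)
  calc ‖exp (-s * τ)‖ ≤ Real.exp ‖-s * τ‖ := norm_exp_le_exp_norm _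
    _ ≤ Real.exp ((‖s₀‖ + 1) * M) := by
        rw [norm_mul, norm_neg, Complex.norm_real, Real.norm_eq_abs]
        gcongr

lemma differentiable_integral_exp_mul {g : ℝ → ℂ} {a b : ℝ} (hg : IntervalIntegrable g volume a b) :
    Differentiable ℂ fun s : ℂ => ∫ τ in a..b, exp (-s * τ) * g τ := by
  intro s₀
  have hexp (s : ℂ) : Continuous fun τ : ℝ => exp (-s * τ) := by fun_prop
  have hmeas (s : ℂ) : AEStronglyMeasurable (fun τ : ℝ => exp (-s * τ) * g τ)
      (volume.restrict (Set.uIoc a b)) :=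
    (hexp s).aestronglyMeasurable.mul hg.def'.aestronglyMeasurable
  set M := max |a| |b|
  have hM : ∀ τ ∈ Set.uIoc a b, |τ| ≤ M := fun τ hτ => by
    rcases Set.mem_uIoc.1 hτ with h | h
    · exact abs_le_max_abs_abs h.1.le h.2
    · exact (abs_le_max_abs_abs h.1.le h.2).trans_eq (max_comm _ _)
  refine (intervalIntegral.hasDerivAt_integral_of_dominated_loc_of_deriv_le
    (F' := fun s τ => (-τ : ℂ) * (exp (-s * τ) * g τ))
    (bound := fun τ => M * Real.exp ((‖s₀‖ + 1) * M) * ‖g τ‖) (Metric.ball_mem_nhds s₀ one_pos)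
    (Eventually.of_forall hmeas) (hg.continuousOn_mul (hexp s₀).continuousOn)
    ((by fun_prop : Continuous fun τ : ℝ => (-τ : ℂ)).aestronglyMeasurable.mul (hmeas s₀))
    (Eventually.of_forall fun τ hτ s hs => ?_) (hg.norm.const_mul _)
    (Eventually.of_forall fun τ _ s _ => ?_)).2.differentiableAt
  · rw [norm_mul, norm_mul, norm_neg, Complex.norm_real, Real.norm_eq_abs, ← mul_assoc]
    gcongr
    · exact hM τ hτ
    · exact norm_exp_neg_mul_le_of_abs_le hs (hM τ hτ)
  · have hlin : HasDerivAt (fun s : ℂ => -s * τ) (-τ : ℂ) s := by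
      simpa only [neg_one_mul] using (hasDerivAt_neg s).mul_const (τ : ℂ)
    exact (hlin.cexp.mul_const (g τ)).congr_deriv (by ring)

/-- A density `q` on `[y 0, ∞)` of growth at most `C exp τ`, cut by `y` into intervals of mass
one. -/
structure UnitPartition (q : ℝ → ℝ) (y : ℕ → ℝ) (C : ℝ) : Prop where
  two_le : 2 ≤ y 0
  strictMono : StrictMono y
  measurable : Measurable q
  continuousOn : ContinuousOn q (Set.Ici (y 0))
  nonneg : ∀ τ, y 0 ≤ τ → 0 ≤ q τ
  le_exp : ∀ τ, y 0 ≤ τ → q τ ≤ C * Real.exp τ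
  integral_eq_one : ∀ j, ∫ τ in (y j)..(y (j + 1)), q τ = 1

/-- The Laplace transform of `q` on the `j`-th interval. -/
noncomputable def block (q : ℝ → ℝ) (y : ℕ → ℝ) (j : ℕ) (s : ℂ) : ℂ :=
  ∫ τ in (y j)..(y (j + 1)), exp (-s * τ) * q τ

/-- The logarithm of the local factor comparing a prime of logarithmic size `l` with the `j`-th
interval of the density `q`. -/
noncomputable def localLog (q : ℝ → ℝ) (y : ℕ → ℝ) (j : ℕ) (l : ℝ) (s : ℂ) : ℂ :=
  -log (1 - exp (-s * l)) - block q y j s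

lemma norm_exp_sub_exp_le (s : ℂ) {a b l τ : ℝ} (hl : l ∈ Set.Icc a b)
    (hτ : τ ∈ Set.Icc a b) :
    ‖exp (-s * l) - exp (-s * τ)‖ ≤ ‖s‖ * ∫ u in a..b, Real.exp (-s.re * u) := by
  wlog h : l ≤ τ generalizing l τ
  · rw [norm_sub_rev]
    exact this hτ hl (le_of_not_ge h)
  rcases eq_or_ne s 0 with rfl | hs
  · simp
  have hintegral : exp (-s * l) - exp (-s * τ) = s * ∫ u in l..τ, exp (-s * u) := by
    rw [integral_exp_mul_complex (neg_ne_zero.2 hs)]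
    field_simp
    ring
  rw [hintegral, norm_mul]
  gcongr
  have hc : Continuous fun u : ℝ => Real.exp (-s.re * u) := by fun_prop
  calc ‖∫ u in l..τ, exp (-s * u)‖ ≤ ∫ u in l..τ, Real.exp (-s.re * u) := by
        refine intervalIntegral.norm_integral_le_of_norm_le h ?_ (hc.intervalIntegrable _ _)
        exact Eventually.of_forall fun u _ => (norm_exp_neg_mul s u).le
    _ ≤ ∫ u in a..b, Real.exp (-s.re * u) := by
        refine intervalIntegral.integral_mono_interval hl.1 h hτ.2 ?_ (hc.intervalIntegrable _ _)
        exact Eventually.of_forall fun u => (Real.exp_pos _).le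

lemma one_sub_exp_neg_mul_mem_slitPlane {s : ℂ} {l : ℝ} (hs : 0 < s.re) (hl : 0 < l) :
    1 - exp (-s * l) ∈ slitPlane := by
  rw [sub_eq_add_neg]
  refine mem_slitPlane_of_norm_lt_one ?_
  rw [norm_neg, norm_exp_neg_mul, Real.exp_lt_one_iff]
  nlinarith

namespace UnitPartition

variable {q : ℝ → ℝ} {y : ℕ → ℝ} {C : ℝ} (hq : UnitPartition q y C)

include hq

lemma y_zero_le (j : ℕ) : y 0 ≤ y j := hq.strictMono.monotone (Nat.zero_le j)

lemma y_pos (j : ℕ) : 0 < y j := two_pos.trans_le (hq.two_le.trans (hq.y_zero_le j))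

lemma y_le_succ (j : ℕ) : y j ≤ y (j + 1) := hq.strictMono.monotone (Nat.le_succ j)

lemma intervalIntegrable {a b : ℝ} (ha : y 0 ≤ a) (hb : y 0 ≤ b) :
    IntervalIntegrable q volume a b := by
  refine (hq.continuousOn.mono fun τ hτ => ?_).intervalIntegrable
  exact (le_min ha hb).trans hτ.1

lemma intervalIntegrable_block (j : ℕ) : IntervalIntegrable q volume (y j) (y (j + 1)) :=
  hq.intervalIntegrable (hq.y_zero_le j) (hq.y_zero_le _)

lemma intervalIntegrable_block_complex (j : ℕ) :
    IntervalIntegrable (fun τ => (q τ : ℂ)) volume (y j) (y (j + 1)) :=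
  ⟨(hq.intervalIntegrable_block j).1.ofReal, (hq.intervalIntegrable_block j).2.ofReal⟩

lemma differentiable_block (j : ℕ) : Differentiable ℂ (block q y j) :=
  differentiable_integral_exp_mul (hq.intervalIntegrable_block_complex j)

lemma natCast_le_mul_exp (j : ℕ) : (j : ℝ) ≤ C * Real.exp (y j) := by
  have hC : 0 ≤ C := by
    have := (hq.nonneg _ le_rfl).trans (hq.le_exp _ le_rfl)
    exact nonneg_of_mul_nonneg_left this (Real.exp_pos _)
  have hmass : ∀ j, 1 ≤ C * Real.exp (y (j + 1)) - C * Real.exp (y j) := by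
    intro j
    have := intervalIntegral.integral_mono_on (hq.y_le_succ j) (hq.intervalIntegrable_block j)
      ((by fun_prop : Continuous fun τ => C * Real.exp τ).intervalIntegrable _ _)
      (fun τ hτ => hq.le_exp τ ((hq.y_zero_le j).trans hτ.1))
    rw [hq.integral_eq_one, intervalIntegral.integral_const_mul, integral_exp, mul_sub] at this
    exact this
  induction j with
  | zero => simpa using mul_nonneg hC (Real.exp_pos (y 0)).le
  | succ j ih =>
    have := hmass j
    push_cast
    linarith

lemma C_pos : 0 < C := by
  have h : 0 < C * Real.exp (y 1) := lt_of_lt_of_le (by norm_num) (hq.natCast_le_mul_exp 1)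
  exact pos_of_mul_pos_left h (Real.exp_pos _).le

lemma summable_exp {a : ℝ} (ha : 1 < a) : Summable fun j => Real.exp (-a * y j) := by
  have hC := hq.C_pos
  have hsummable := (Real.summable_nat_rpow_inv.2 ha).mul_left (C ^ a)
  refine (summable_nat_add_iff 1).1 ?_
  refine Summable.of_nonneg_of_le (fun _ => (Real.exp_pos _).le) (fun j => ?_)
    ((summable_nat_add_iff 1).2 hsummable)
  have hj_le := hq.natCast_le_mul_exp (j + 1)
  have hj : (0 : ℝ) < ((j + 1 : ℕ) : ℝ) := by positivity
  have hpow : ((j + 1 : ℕ) : ℝ) ^ a ≤ C ^ a * Real.exp (a * y (j + 1)) := by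
    calc ((j + 1 : ℕ) : ℝ) ^ a ≤ (C * Real.exp (y (j + 1))) ^ a :=
          Real.rpow_le_rpow hj.le hj_le (by linarith)
      _ = C ^ a * Real.exp (a * y (j + 1)) := by
          rw [Real.mul_rpow hC.le (Real.exp_pos _).le, ← Real.exp_mul, mul_comm a]
  rw [neg_mul, Real.exp_neg, ← div_eq_mul_inv, le_div_iff₀ (Real.rpow_pos_of_pos hj a),
    inv_mul_le_iff₀ (Real.exp_pos _), mul_comm]
  exact hpow

lemma norm_exp_sub_block_le (j : ℕ) {l : ℝ} (hl : l ∈ Set.Icc (y j) (y (j + 1))) (s : ℂ) :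
    ‖exp (-s * l) - block q y j s‖ ≤ ‖s‖ * ∫ u in (y j)..(y (j + 1)), Real.exp (-s.re * u) := by
  set K := ‖s‖ * ∫ u in (y j)..(y (j + 1)), Real.exp (-s.re * u)
  have hqc := hq.intervalIntegrable_block_complex j
  have hdiff : exp (-s * l) - block q y j s =
      ∫ τ in (y j)..(y (j + 1)), (exp (-s * l) - exp (-s * τ)) * q τ := by
    simp_rw [sub_mul]
    rw [intervalIntegral.integral_sub (hqc.const_mul _)
      (hqc.continuousOn_mul (by fun_prop : Continuous fun τ : ℝ => exp (-s * τ)).continuousOn),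
      intervalIntegral.integral_const_mul, intervalIntegral.integral_ofReal, hq.integral_eq_one]
    simp [block]
  rw [hdiff]
  have hK : K = ∫ τ in (y j)..(y (j + 1)), K * q τ := by
    rw [intervalIntegral.integral_const_mul, hq.integral_eq_one, mul_one]
  rw [hK]
  refine intervalIntegral.norm_integral_le_of_norm_le (hq.y_le_succ j) ?_
    ((hq.intervalIntegrable_block j).const_mul K)
  refine Eventually.of_forall fun τ hτ => ?_
  have hτ0 := hq.nonneg τ ((hq.y_zero_le j).trans hτ.1.le)
  rw [norm_mul, Complex.norm_real, Real.norm_of_nonneg hτ0]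
  gcongr
  exact norm_exp_sub_exp_le s hl ⟨hτ.1.le, hτ.2⟩

lemma exp_neg_mul_le_half (j : ℕ) {l : ℝ} (hl : y j ≤ l) {σ : ℝ} (hσ : 1 / 2 ≤ σ) :
    Real.exp (-σ * l) ≤ 1 / 2 := by
  have htwo : 2 ≤ l := hq.two_le.trans ((hq.y_zero_le j).trans hl)
  have hexp : Real.exp (-σ * l) ≤ Real.exp (-1) := Real.exp_le_exp.2 (by nlinarith)
  have hhalf : Real.exp (-1) ≤ 1 / 2 := by
    rw [Real.exp_neg, one_div]
    exact inv_anti₀ (by norm_num) (by linarith [Real.add_one_le_exp 1])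
  linarith

lemma norm_log_sub_le (j : ℕ) {l : ℝ} (hl : y j ≤ l) {s : ℂ} (hs : 1 / 2 ≤ s.re) :
    ‖-log (1 - exp (-s * l)) - exp (-s * l)‖ ≤ Real.exp (-2 * s.re * y j) := by
  set z := exp (-s * l)
  have hz : ‖z‖ ≤ 1 / 2 := by
    rw [norm_exp_neg_mul]; exact hq.exp_neg_mul_le_half j hl hs
  have hlog := Complex.norm_log_one_add_sub_self_le (z := -z) (by rw [norm_neg]; linarith)
  rw [norm_neg, ← sub_eq_add_neg] at hlog
  have hneg : -log (1 - z) - z = -(log (1 - z) - -z) := by ring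
  rw [hneg, norm_neg]
  refine hlog.trans ?_
  have hinv : (1 - ‖z‖)⁻¹ ≤ 2 := by
    rw [inv_le_comm₀ (by linarith) (by norm_num)]; linarith
  have hsq : ‖z‖ ^ 2 ≤ Real.exp (-2 * s.re * y j) := by
    rw [norm_exp_neg_mul, ← Real.exp_nat_mul]
    refine Real.exp_le_exp.2 ?_
    push_cast
    nlinarith
  calc ‖z‖ ^ 2 * (1 - ‖z‖)⁻¹ / 2 ≤ ‖z‖ ^ 2 * 2 / 2 := by gcongr
    _ = ‖z‖ ^ 2 := by ring
    _ ≤ _ := hsq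

lemma norm_localLog_le (j : ℕ) {l : ℝ} (hl : l ∈ Set.Icc (y j) (y (j + 1))) {s : ℂ}
    (hs : 1 / 2 ≤ s.re) :
    ‖localLog q y j l s‖ ≤ ‖s‖ * (∫ u in (y j)..(y (j + 1)), Real.exp (-s.re * u)) +
      Real.exp (-2 * s.re * y j) := by
  have h : localLog q y j l s = (exp (-s * l) - block q y j s) +
      (-log (1 - exp (-s * l)) - exp (-s * l)) := by
    rw [localLog]; ring
  rw [h]
  exact (norm_add_le _ _).trans
    (add_le_add (hq.norm_exp_sub_block_le j hl s) (hq.norm_log_sub_le j hl.1 hs))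

lemma summable_integral_exp {σ : ℝ} (hσ : 0 < σ) :
    Summable fun j => ∫ u in (y j)..(y (j + 1)), Real.exp (-σ * u) := by
  have hc : Continuous fun u : ℝ => Real.exp (-σ * u) := by fun_prop
  refine summable_of_sum_range_le (c := Real.exp (-σ * y 0) / σ) (fun j => ?_) fun n => ?_
  · exact intervalIntegral.integral_nonneg (hq.y_le_succ j) fun u _ => (Real.exp_pos _).le
  · rw [intervalIntegral.sum_integral_adjacent_intervals fun k _ => hc.intervalIntegrable _ _]
    have hintegral : ∫ u in (y 0)..(y n), Real.exp (-σ * u) =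
        (Real.exp (-σ * y 0) - Real.exp (-σ * y n)) / σ := by
      rw [intervalIntegral.integral_comp_mul_left (fun u => Real.exp u) (neg_ne_zero.2 hσ.ne'),
        integral_exp, smul_eq_mul]
      field_simp
      ring
    rw [hintegral]
    gcongr
    linarith [Real.exp_pos (-σ * y n)]

lemma exists_summable_norm_localLog_le {c R : ℝ} (hc : 1 / 2 < c) :
    ∃ u : ℕ → ℝ, Summable u ∧ ∀ lam : ℕ → ℝ, (∀ j, lam j ∈ Set.Icc (y j) (y (j + 1))) →
      ∀ j (s : ℂ), c ≤ s.re → ‖s‖ ≤ R → ‖localLog q y j (lam j) s‖ ≤ u j := by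
  refine ⟨fun j => R * (∫ u in (y j)..(y (j + 1)), Real.exp (-c * u)) + Real.exp (-(2 * c) * y j),
    ((hq.summable_integral_exp (by linarith)).mul_left R).add (hq.summable_exp (by linarith)), ?_⟩
  intro lam hlam j s hs hR
  have hR0 : 0 ≤ R := (norm_nonneg _).trans hR
  have hy := hq.y_pos j
  refine (hq.norm_localLog_le j (hlam j) (by linarith)).trans ?_
  have hc' : ∀ σ : ℝ, Continuous fun u : ℝ => Real.exp (-σ * u) := fun σ => by fun_prop
  have hmono : ∫ u in (y j)..(y (j + 1)), Real.exp (-s.re * u) ≤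
      ∫ u in (y j)..(y (j + 1)), Real.exp (-c * u) := by
    refine intervalIntegral.integral_mono_on (hq.y_le_succ j) ((hc' _).intervalIntegrable _ _)
      ((hc' _).intervalIntegrable _ _) fun u hu => Real.exp_le_exp.2 ?_
    have : 0 < u := hy.trans_le hu.1
    nlinarith
  have hnonneg : 0 ≤ ∫ u in (y j)..(y (j + 1)), Real.exp (-s.re * u) :=
    intervalIntegral.integral_nonneg (hq.y_le_succ j) fun u _ => (Real.exp_pos _).le
  have hexp : Real.exp (-2 * s.re * y j) ≤ Real.exp (-(2 * c) * y j) :=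
    Real.exp_le_exp.2 (by nlinarith)
  exact add_le_add (mul_le_mul hR hmono hnonneg hR0) hexp

lemma summable_localLog {lam : ℕ → ℝ} (hlam : ∀ j, lam j ∈ Set.Icc (y j) (y (j + 1))) {s : ℂ}
    (hs : 1 / 2 < s.re) : Summable fun j => localLog q y j (lam j) s := by
  obtain ⟨u, hu, hb⟩ := hq.exists_summable_norm_localLog_le (R := ‖s‖) hs
  exact Summable.of_norm_bounded hu fun j => hb lam hlam j s le_rfl le_rfl

lemma differentiableOn_localLog (j : ℕ) {l : ℝ} (hl : y j ≤ l) :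
    DifferentiableOn ℂ (localLog q y j l) {s | 1 / 2 < s.re} := by
  refine DifferentiableOn.sub (DifferentiableOn.neg ?_) (hq.differentiable_block j).differentiableOn
  refine DifferentiableOn.clog (by fun_prop) fun s hs => ?_
  have hs : 1 / 2 < s.re := hs
  exact one_sub_exp_neg_mul_mem_slitPlane (by linarith) ((hq.y_pos j).trans_le hl)

lemma differentiableOn_tsum_localLog {lam : ℕ → ℝ}
    (hlam : ∀ j, lam j ∈ Set.Icc (y j) (y (j + 1))) :
    DifferentiableOn ℂ (fun s => ∑' j, localLog q y j (lam j) s) {s | 1 / 2 < s.re} := by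
  intro s₀ hs₀
  have hs₀ : 1 / 2 < s₀.re := hs₀
  obtain ⟨c, hc1, hc2⟩ := exists_between hs₀
  obtain ⟨u, hu, hb⟩ := hq.exists_summable_norm_localLog_le (R := ‖s₀‖ + 1) hc1
  set U : Set ℂ := {s | c < s.re} ∩ Metric.ball s₀ 1
  have hU : IsOpen U := (isOpen_lt continuous_const Complex.continuous_re).inter Metric.isOpen_ball
  have hmem : s₀ ∈ U := ⟨hc2, Metric.mem_ball_self one_pos⟩
  have := Complex.differentiableOn_tsum_of_summable_norm hu (fun j =>
    (hq.differentiableOn_localLog j (hlam j).1).mono fun s hs => hc1.trans hs.1) hU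
    (fun j s hs => hb lam hlam j s (le_of_lt hs.1) (by
      have hdist : ‖s - s₀‖ < 1 := by simpa [dist_eq_norm] using hs.2
      have := norm_le_norm_add_norm_sub' s s₀
      linarith))
  exact (this.differentiableAt (hU.mem_nhds hmem)).differentiableWithinAt

end UnitPartition

/-! ### Choosing the primes by averaging -/

lemma exp_le_one_add_add_sq (x : ℝ) : Real.exp x ≤ 1 + x + x ^ 2 * Real.exp |x| := by
  have h := Complex.norm_exp_sub_sum_le_norm_mul_exp x 2
  simp only [Finset.sum_range_succ, Finset.range_zero, Finset.sum_empty, pow_zero,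
    Nat.factorial_zero, Nat.cast_one, div_one, zero_add, pow_one, Nat.factorial_one] at h
  rw [← ofReal_exp, ← ofReal_one, ← ofReal_add, ← ofReal_sub, Complex.norm_real, Complex.norm_real,
    Real.norm_eq_abs, Real.norm_eq_abs, sq_abs] at h
  linarith [le_abs_self (Real.exp x - (1 + x))]

section Averaging

variable {α β : Type*} [MeasurableSpace α] [MeasurableSpace β]

lemma exists_mem_lintegral_mul_le {μ : Measure α} [SFinite μ] {ν : Measure β}
    [IsProbabilityMeasure ν] {S : Set β} (hS : ν Sᶜ = 0) {φ : β → α → ℝ≥0∞}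
    (hφ : Measurable (Function.uncurry φ)) {A : ℝ≥0∞} (hA : ∀ x, ∫⁻ l, φ l x ∂ν ≤ A)
    {g : α → ℝ≥0∞} (hg : Measurable g) :
    ∃ l ∈ S, ∫⁻ x, g x * φ l x ∂μ ≤ A * ∫⁻ x, g x ∂μ := by
  have hgφ : Measurable fun p : β × α => g p.2 * φ p.1 p.2 := (hg.comp measurable_snd).mul hφ
  obtain ⟨l, hl, hle⟩ := exists_notMem_null_le_lintegral
    (hgφ.lintegral_prod_right' (ν := μ)).aemeasurable hS
  refine ⟨l, not_not.1 hl, hle.trans ?_⟩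
  rw [lintegral_lintegral_swap hgφ.aemeasurable, ← lintegral_const_mul _ hg]
  refine lintegral_mono fun x => ?_
  dsimp only
  rw [lintegral_const_mul _ hφ.of_uncurry_right, mul_comm]
  exact mul_le_mul_left (hA x) _

omit [MeasurableSpace β] in
lemma exists_seq_lintegral_mul_prod_le {μ : Measure α} {S : ℕ → Set β} {φ : ℕ → β → α → ℝ≥0∞}
    (hφ : ∀ j l, Measurable (φ j l)) {a : ℕ → ℝ≥0∞}
    (h : ∀ (j : ℕ) (g : α → ℝ≥0∞), Measurable g →
      ∃ l ∈ S j, ∫⁻ x, g x * φ j l x ∂μ ≤ a j * ∫⁻ x, g x ∂μ)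
    {g : α → ℝ≥0∞} (hg : Measurable g) :
    ∃ lam : ℕ → β, (∀ j, lam j ∈ S j) ∧ ∀ J,
      ∫⁻ x, g x * ∏ j ∈ Finset.range J, φ j (lam j) x ∂μ ≤
        (∏ j ∈ Finset.range J, a j) * ∫⁻ x, g x ∂μ := by
  choose pick hpick hpick_le using fun j (g : {g : α → ℝ≥0∞ // Measurable g}) => h j g.1 g.2
  let G : ℕ → {g : α → ℝ≥0∞ // Measurable g} := fun n =>
    Nat.rec ⟨g, hg⟩ (fun j f => ⟨fun x => f.1 x * φ j (pick j f) x, f.2.mul (hφ j _)⟩) n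
  have hG : ∀ J x, (G J).1 x = g x * ∏ j ∈ Finset.range J, φ j (pick j (G j)) x := by
    intro J x
    induction J with
    | zero => simp [G]
    | succ J ih =>
      rw [Finset.prod_range_succ, ← mul_assoc, ← ih]
  refine ⟨fun j => pick j (G j), fun j => hpick j (G j), fun J => ?_⟩
  simp only [← hG]
  induction J with
  | zero => simp [G]
  | succ J ih =>
    calc ∫⁻ x, (G (J + 1)).1 x ∂μ ≤ a J * ∫⁻ x, (G J).1 x ∂μ := hpick_le J (G J)
      _ ≤ a J * ((∏ j ∈ Finset.range J, a j) * ∫⁻ x, g x ∂μ) := mul_le_mul_right ih _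
      _ = _ := by rw [Finset.prod_range_succ, ← mul_assoc, mul_comm (a J)]

end Averaging

namespace UnitPartition

variable {q : ℝ → ℝ} {y : ℕ → ℝ} {C : ℝ} (hq : UnitPartition q y C)

include hq

lemma norm_block_le (j : ℕ) {s : ℂ} (hs : 0 ≤ s.re) : ‖block q y j s‖ ≤ Real.exp (-s.re * y j) := by
  have hmass : Real.exp (-s.re * y j) =
      ∫ τ in (y j)..(y (j + 1)), Real.exp (-s.re * y j) * q τ := by
    rw [intervalIntegral.integral_const_mul, hq.integral_eq_one, mul_one]
  rw [hmass]
  refine intervalIntegral.norm_integral_le_of_norm_le (hq.y_le_succ j) ?_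
    ((hq.intervalIntegrable_block j).const_mul _)
  refine Eventually.of_forall fun τ hτ => ?_
  have hτ0 := hq.nonneg τ ((hq.y_zero_le j).trans hτ.1.le)
  rw [norm_mul, Complex.norm_real, Real.norm_of_nonneg hτ0, norm_exp_neg_mul]
  refine mul_le_mul_of_nonneg_right (Real.exp_le_exp.2 ?_) hτ0
  nlinarith [hτ.1]

lemma norm_exp_sub_block_le_two_mul (j : ℕ) {l : ℝ} (hl : y j ≤ l) {s : ℂ} (hs : 0 ≤ s.re) :
    ‖exp (-s * l) - block q y j s‖ ≤ 2 * Real.exp (-s.re * y j) := by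
  have hexp : ‖exp (-s * l)‖ ≤ Real.exp (-s.re * y j) := by
    rw [norm_exp_neg_mul]
    exact Real.exp_le_exp.2 (by nlinarith)
  linarith [norm_sub_le (exp (-s * l)) (block q y j s), hq.norm_block_le j hs]

lemma integral_mul_re_exp_sub_block (j : ℕ) (s : ℂ) :
    ∫ l in (y j)..(y (j + 1)), q l * (exp (-s * l) - block q y j s).re = 0 := by
  have hqc := hq.intervalIntegrable_block_complex j
  have hexp : IntervalIntegrable (fun l : ℝ => exp (-s * l) * (q l : ℂ)) volume (y j) (y (j + 1)) :=
    hqc.continuousOn_mul (by fun_prop : Continuous fun l : ℝ => exp (-s * l)).continuousOn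
  have hzero : ∫ l in (y j)..(y (j + 1)), (exp (-s * l) - block q y j s) * (q l : ℂ) = 0 := by
    simp_rw [sub_mul]
    rw [intervalIntegral.integral_sub hexp (hqc.const_mul _), intervalIntegral.integral_const_mul,
      intervalIntegral.integral_ofReal, hq.integral_eq_one, ofReal_one, mul_one, block, sub_self]
  have hre := Complex.reCLM.intervalIntegral_comp_comm (μ := volume) (a := y j) (b := y (j + 1))
    (f := fun l : ℝ => (exp (-s * l) - block q y j s) * (q l : ℂ))
    (by simpa only [sub_mul] using hexp.sub (hqc.const_mul _))
  rw [hzero] at hre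
  simpa only [reCLM_apply, re_mul_ofReal, zero_re, mul_comm (q _)] using hre

lemma continuousOn_localLog (j : ℕ) {s : ℂ} (hs : 0 < s.re) :
    ContinuousOn (fun l : ℝ => localLog q y j l s) (Set.Icc (y j) (y (j + 1))) :=
  (ContinuousOn.clog (by fun_prop) fun _ hl =>
    one_sub_exp_neg_mul_mem_slitPlane hs ((hq.y_pos j).trans_le hl.1)).neg.sub continuousOn_const

lemma intervalIntegrable_mul_exp_localLog (j : ℕ) (Λ : ℝ) {s : ℂ} (hs : 0 < s.re) :
    IntervalIntegrable (fun l => q l * Real.exp (Λ * (localLog q y j l s).re)) volume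
      (y j) (y (j + 1)) := by
  refine (hq.intervalIntegrable_block j).mul_continuousOn ?_
  rw [Set.uIcc_of_le (hq.y_le_succ j)]
  exact Real.continuous_exp.comp_continuousOn (continuousOn_const.mul
    (Complex.continuous_re.comp_continuousOn (hq.continuousOn_localLog j hs)))

lemma exp_localLog_re_le (j : ℕ) {Λ l : ℝ} (hΛ : 0 ≤ Λ) (hl : y j ≤ l) {s : ℂ}
    (hs : 1 / 2 ≤ s.re) :
    Real.exp (Λ * (localLog q y j l s).re) ≤ Real.exp (Λ * Real.exp (-2 * s.re * y j)) *
      (1 + 4 * Λ ^ 2 * Real.exp (2 * Λ) * Real.exp (-2 * s.re * y j) +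
        Λ * (exp (-s * l) - block q y j s).re) := by
  set v := (exp (-s * l) - block q y j s).re with hv
  set e := Real.exp (-s.re * y j) with he
  have hδ : Real.exp (-2 * s.re * y j) = e ^ 2 := by
    rw [he, ← Real.exp_nat_mul]
    congr 1
    push_cast
    ring
  have : 0 < e := Real.exp_pos _
  have he1 : e ≤ 1 := (hq.exp_neg_mul_le_half j le_rfl hs).trans (by norm_num)
  have hve : |v| ≤ 2 * e := (Complex.abs_re_le_norm _).trans
    (hq.norm_exp_sub_block_le_two_mul j hl (by linarith))
  have hlog : (localLog q y j l s).re ≤ v + e ^ 2 := by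
    have h := (Complex.re_le_norm _).trans (hq.norm_log_sub_le j hl hs)
    rw [hδ] at h
    simp only [localLog, hv, sub_re] at h ⊢
    linarith
  have hΛv : |Λ * v| ≤ 2 * Λ := by
    rw [abs_mul, abs_of_nonneg hΛ]
    nlinarith
  have hΛv2 : (Λ * v) ^ 2 ≤ 4 * Λ ^ 2 * e ^ 2 := by
    rw [mul_pow, ← sq_abs v]
    have : |v| ^ 2 ≤ (2 * e) ^ 2 := by gcongr
    nlinarith [sq_nonneg Λ]
  rw [hδ]
  calc Real.exp (Λ * (localLog q y j l s).re) ≤ Real.exp (Λ * e ^ 2) * Real.exp (Λ * v) := by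
        rw [← Real.exp_add]
        exact Real.exp_le_exp.2 (by nlinarith)
    _ ≤ Real.exp (Λ * e ^ 2) * (1 + Λ * v + 4 * Λ ^ 2 * e ^ 2 * Real.exp (2 * Λ)) := by
        gcongr
        exact (exp_le_one_add_add_sq _).trans (by gcongr)
    _ = _ := by ring

lemma integral_exp_localLog_le (j : ℕ) {Λ : ℝ} (hΛ : 0 ≤ Λ) {s : ℂ} (hs : 1 / 2 ≤ s.re) :
    ∫ l in (y j)..(y (j + 1)), q l * Real.exp (Λ * (localLog q y j l s).re) ≤
      Real.exp ((Λ + 4 * Λ ^ 2 * Real.exp (2 * Λ)) * Real.exp (-2 * s.re * y j)) := by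
  set δ := Real.exp (-2 * s.re * y j)
  set A := 4 * Λ ^ 2 * Real.exp (2 * Λ)
  have hqi := hq.intervalIntegrable_block j
  have hvi : IntervalIntegrable (fun l => q l * (exp (-s * l) - block q y j s).re) volume
      (y j) (y (j + 1)) :=
    hqi.mul_continuousOn (by fun_prop :
      Continuous fun l : ℝ => (exp (-s * l) - block q y j s).re).continuousOn
  calc ∫ l in (y j)..(y (j + 1)), q l * Real.exp (Λ * (localLog q y j l s).re)
      ≤ ∫ l in (y j)..(y (j + 1)), Real.exp (Λ * δ) *
          ((1 + A * δ) * q l + Λ * (q l * (exp (-s * l) - block q y j s).re)) := by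
        refine intervalIntegral.integral_mono_on (hq.y_le_succ j)
          (hq.intervalIntegrable_mul_exp_localLog j Λ (by linarith))
          (((hqi.const_mul _).add (hvi.const_mul _)).const_mul _) fun l hl => ?_
        refine (mul_le_mul_of_nonneg_left (hq.exp_localLog_re_le j hΛ hl.1 hs)
          (hq.nonneg l ((hq.y_zero_le j).trans hl.1))).trans_eq ?_
        ring
    _ = Real.exp (Λ * δ) * (A * δ + 1) := by
        rw [intervalIntegral.integral_const_mul, intervalIntegral.integral_add (hqi.const_mul _)
          (hvi.const_mul _), intervalIntegral.integral_const_mul,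
          intervalIntegral.integral_const_mul, hq.integral_mul_re_exp_sub_block,
          hq.integral_eq_one, mul_zero, add_zero, mul_one, add_comm 1]
    _ ≤ Real.exp (Λ * δ) * Real.exp (A * δ) := by
        gcongr
        exact Real.add_one_le_exp _
    _ = Real.exp ((Λ + A) * δ) := by rw [← Real.exp_add, add_mul]

lemma isProbabilityMeasure_withDensity_block (j : ℕ) : IsProbabilityMeasure
    ((volume.restrict (Set.Ioc (y j) (y (j + 1)))).withDensity fun l => ENNReal.ofReal (q l)) := by
  constructor
  rw [withDensity_apply _ MeasurableSet.univ, Measure.restrict_univ,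
    ← ofReal_integral_eq_lintegral_ofReal, ← intervalIntegral.integral_of_le (hq.y_le_succ j),
    hq.integral_eq_one, ENNReal.ofReal_one]
  · exact (hq.intervalIntegrable_block j).1
  · refine (ae_restrict_mem measurableSet_Ioc).mono fun l hl => ?_
    exact hq.nonneg l ((hq.y_zero_le j).trans hl.1.le)

lemma measurable_exp_localLog (j : ℕ) (Λ σ : ℝ) : Measurable (Function.uncurry fun l t : ℝ =>
    ENNReal.ofReal (Real.exp (Λ * (localLog q y j l (σ + t * I)).re))) := by
  have hblock : Measurable (block q y j) := (hq.differentiable_block j).continuous.measurable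
  unfold localLog Function.uncurry
  fun_prop

lemma lintegral_withDensity_exp_localLog_le (j : ℕ) {Λ σ : ℝ} (hΛ : 0 ≤ Λ) (hσ : 1 / 2 ≤ σ)
    (t : ℝ) :
    ∫⁻ l, ENNReal.ofReal (Real.exp (Λ * (localLog q y j l (σ + t * I)).re))
        ∂((volume.restrict (Set.Ioc (y j) (y (j + 1)))).withDensity
          fun l => ENNReal.ofReal (q l)) ≤
      ENNReal.ofReal
        (Real.exp ((Λ + 4 * Λ ^ 2 * Real.exp (2 * Λ)) * Real.exp (-2 * σ * y j))) := by
  have hre : (σ + t * I : ℂ).re = σ := by simp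
  have hs : 1 / 2 ≤ (σ + t * I : ℂ).re := hre.symm ▸ hσ
  have hnonneg : ∀ l ∈ Set.Ioc (y j) (y (j + 1)), 0 ≤ q l := fun l hl =>
    hq.nonneg l ((hq.y_zero_le j).trans hl.1.le)
  have hinteg := hq.integral_exp_localLog_le j hΛ hs
  rw [hre] at hinteg
  refine le_trans (le_of_eq ?_) (ENNReal.ofReal_le_ofReal hinteg)
  rw [lintegral_withDensity_eq_lintegral_mul _ hq.measurable.ennreal_ofReal
    (hq.measurable_exp_localLog j Λ σ).of_uncurry_right,
    intervalIntegral.integral_of_le (hq.y_le_succ j), ofReal_integral_eq_lintegral_ofReal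
      (hq.intervalIntegrable_mul_exp_localLog j Λ (by linarith)).1
      ((ae_restrict_mem measurableSet_Ioc).mono fun l hl =>
        mul_nonneg (hnonneg l hl) (Real.exp_pos _).le)]
  refine setLIntegral_congr_fun measurableSet_Ioc fun l hl => ?_
  rw [Pi.mul_apply, ENNReal.ofReal_mul (hnonneg l hl)]

lemma exists_lintegral_mul_exp_localLog_le (j : ℕ) {Λ σ : ℝ} (hΛ : 0 ≤ Λ) (hσ : 1 / 2 ≤ σ)
    {g : ℝ → ℝ≥0∞} (hg : Measurable g) :
    ∃ l ∈ Set.Icc (y j) (y (j + 1)),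
      ∫⁻ t : ℝ, g t * ENNReal.ofReal (Real.exp (Λ * (localLog q y j l (σ + t * I)).re)) ≤
        ENNReal.ofReal (Real.exp ((Λ + 4 * Λ ^ 2 * Real.exp (2 * Λ)) * Real.exp (-2 * σ * y j))) *
          ∫⁻ t, g t := by
  have := hq.isProbabilityMeasure_withDensity_block j
  refine exists_mem_lintegral_mul_le (withDensity_absolutelyContinuous _ _ ?_)
    (hq.measurable_exp_localLog j Λ σ) (hq.lintegral_withDensity_exp_localLog_le j hΛ hσ) hg
  rw [Measure.restrict_apply measurableSet_Icc.compl,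
    (disjoint_compl_left.mono_right Set.Ioc_subset_Icc_self).inter_eq, measure_empty]

lemma exists_forall_lintegral_exp_sum_localLog_le {Λ σ : ℝ} (hΛ : 0 ≤ Λ) (hσ : 1 / 2 < σ) :
    ∃ lam : ℕ → ℝ, (∀ j, lam j ∈ Set.Icc (y j) (y (j + 1))) ∧ ∃ B : ℝ, 0 ≤ B ∧ ∀ J : ℕ,
      ∫⁻ t : ℝ, ENNReal.ofReal ((1 + t ^ 2)⁻¹ *
        Real.exp (Λ * (∑ j ∈ Finset.range J, localLog q y j (lam j) (σ + t * I)).re)) ≤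
          ENNReal.ofReal B := by
  set K := Λ + 4 * Λ ^ 2 * Real.exp (2 * Λ)
  obtain ⟨lam, hlam, hle⟩ := exists_seq_lintegral_mul_prod_le (μ := volume)
    (g := fun t : ℝ => ENNReal.ofReal (1 + t ^ 2)⁻¹)
    (fun j _ => (hq.measurable_exp_localLog j Λ σ).of_uncurry_left)
    (fun j _ hg => hq.exists_lintegral_mul_exp_localLog_le j hΛ hσ.le hg) (by fun_prop)
  refine ⟨lam, hlam, Real.exp (K * ∑' j, Real.exp (-(2 * σ) * y j)) * Real.pi, by positivity,
    fun J => ?_⟩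
  have hπ : ∫⁻ t : ℝ, ENNReal.ofReal (1 + t ^ 2)⁻¹ = ENNReal.ofReal Real.pi := by
    rw [← ofReal_integral_eq_lintegral_ofReal integrable_inv_one_add_sq
      (Eventually.of_forall fun t => by positivity), integral_univ_inv_one_add_sq]
  calc ∫⁻ t : ℝ, ENNReal.ofReal ((1 + t ^ 2)⁻¹ *
        Real.exp (Λ * (∑ j ∈ Finset.range J, localLog q y j (lam j) (σ + t * I)).re))
      = ∫⁻ t : ℝ, ENNReal.ofReal (1 + t ^ 2)⁻¹ * ∏ j ∈ Finset.range J,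
          ENNReal.ofReal (Real.exp (Λ * (localLog q y j (lam j) (σ + t * I)).re)) := by
        refine lintegral_congr fun t => ?_
        rw [re_sum, Finset.mul_sum, Real.exp_sum, ENNReal.ofReal_mul (by positivity),
          ENNReal.ofReal_prod_of_nonneg fun _ _ => (Real.exp_pos _).le]
    _ ≤ (∏ j ∈ Finset.range J, ENNReal.ofReal (Real.exp (K * Real.exp (-2 * σ * y j)))) *
          ENNReal.ofReal Real.pi := (hle J).trans_eq (by rw [hπ])
    _ = ENNReal.ofReal (Real.exp (K * ∑ j ∈ Finset.range J, Real.exp (-(2 * σ) * y j)) *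
          Real.pi) := by
        rw [← ENNReal.ofReal_prod_of_nonneg fun _ _ => (Real.exp_pos _).le,
          ← ENNReal.ofReal_mul (Finset.prod_nonneg fun _ _ => (Real.exp_pos _).le),
          ← Real.exp_sum, ← Finset.mul_sum]
        simp only [neg_mul]
    _ ≤ _ := by
        gcongr
        exact (hq.summable_exp (by linarith)).sum_le_tsum _ fun _ _ => (Real.exp_pos _).le

end UnitPartition

/-! ### A smoothed Perron formula -/

/-- The continuous piecewise linear function that is `0` up to `-h` and `1` from `0` on; it
smooths the indicator function of `[0, ∞)`. -/
noncomputable def ramp (h v : ℝ) : ℝ := (max (v + h) 0 - max v 0) / h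

/-- The numerator of the Perron kernel of `ramp`: the inverse Laplace transform of
`rampKernel h Y s / s ^ 2` at `ℓ` is `ramp h (Y - ℓ)`. -/
noncomputable def rampKernel (h Y : ℝ) (s : ℂ) : ℂ := exp (s * Y) * ((exp (s * h) - 1) / h)

section Ramp

variable {h : ℝ}

lemma ramp_nonneg (hh : 0 < h) (v : ℝ) : 0 ≤ ramp h v :=
  div_nonneg (sub_nonneg.2 (max_le_max (by linarith) le_rfl)) hh.le

lemma ramp_le_one (hh : 0 < h) (v : ℝ) : ramp h v ≤ 1 := by
  rw [ramp, div_le_one hh, sub_le_iff_le_add]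
  exact max_le (by linarith [le_max_left v 0]) (by linarith [le_max_right v 0])

lemma ramp_of_nonneg {v : ℝ} (hh : 0 < h) (hv : 0 ≤ v) : ramp h v = 1 := by
  rw [ramp, max_eq_left (by linarith), max_eq_left hv, add_sub_cancel_left, div_self hh.ne']

lemma ramp_of_le {v : ℝ} (hh : 0 < h) (hv : v ≤ -h) : ramp h v = 0 := by
  rw [ramp, max_eq_right (by linarith), max_eq_right (hv.trans (neg_nonpos.2 hh.le)), sub_zero,
    zero_div]

lemma exp_neg_mul_mul_rampKernel (h Y ℓ : ℝ) (s : ℂ) :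
    exp (-s * ℓ) * rampKernel h Y s = rampKernel h (Y - ℓ) s := by
  have : exp (s * (Y - ℓ : ℝ)) = exp (-s * ℓ) * exp (s * Y) := by
    rw [← exp_add]
    push_cast
    ring_nf
  rw [rampKernel, rampKernel, this, mul_assoc]

@[fun_prop]
lemma differentiable_rampKernel (h Y : ℝ) : Differentiable ℂ (rampKernel h Y) := by
  unfold rampKernel
  fun_prop

lemma integral_rampKernel_div_sq (hh : 0 < h) {c : ℝ} (hc : 0 < c) (Y : ℝ) :
    VerticalIntegrable (fun s => rampKernel h Y s / s ^ 2) c ∧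
      ∫ t : ℝ, rampKernel h Y (c + t * I) / (c + t * I) ^ 2 = ((2 * Real.pi * ramp h Y : ℝ) : ℂ)
    := by
  have hsplit (s : ℂ) : rampKernel h Y s / s ^ 2 =
      (h : ℂ)⁻¹ * (exp (s * (Y + h : ℝ)) / s ^ 2 - exp (s * Y) / s ^ 2) := by
    have : exp (s * (Y + h : ℝ)) = exp (s * Y) * exp (s * h) := by
      rw [← exp_add, ofReal_add, mul_add]
    rw [this, rampKernel]
    ring
  obtain ⟨hint₁, heq₁⟩ := integral_exp_div_sq hc (Y + h)
  obtain ⟨hint₂, heq₂⟩ := integral_exp_div_sq hc Y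
  simp only [VerticalIntegrable] at hint₁ hint₂ ⊢
  simp_rw [hsplit]
  refine ⟨(hint₁.sub hint₂).const_mul _, ?_⟩
  rw [integral_const_mul, integral_sub hint₁ hint₂, heq₁, heq₂, ramp]
  have : (h : ℂ) ≠ 0 := ofReal_ne_zero.2 hh.ne'
  push_cast
  field_simp

lemma hasSum_ramp {ι : Type*} [Countable ι] {ℓ : ι → ℝ} {c : ℝ} (hc : 0 < c)
    (hℓ : Summable fun i => Real.exp (-c * ℓ i)) {Z : ℂ → ℂ}
    (hZ : ∀ s : ℂ, s.re = c → HasSum (fun i => exp (-s * ℓ i)) (Z s)) (hh : 0 < h) (Y : ℝ) :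
    HasSum (fun i => ((2 * Real.pi * ramp h (Y - ℓ i) : ℝ) : ℂ))
      (∫ t : ℝ, Z (c + t * I) * (rampKernel h Y (c + t * I) / (c + t * I) ^ 2)) := by
  set k : ℝ → ℂ := fun t => rampKernel h Y (c + t * I) / (c + t * I) ^ 2
  have hk (i : ι) (t : ℝ) : exp (-(c + t * I) * ℓ i) * k t =
      rampKernel h (Y - ℓ i) (c + t * I) / (c + t * I) ^ 2 := by
    rw [← exp_neg_mul_mul_rampKernel, mul_div_assoc]
  have hnorm (i : ι) : ∫ t : ℝ, ‖exp (-(c + t * I) * ℓ i) * k t‖ =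
      Real.exp (-c * ℓ i) * ∫ t : ℝ, ‖k t‖ := by
    rw [← integral_const_mul]
    congr 1 with t
    rw [norm_mul, norm_exp_neg_mul, show (c + t * I : ℂ).re = c by simp]
  have hinteg (i : ι) : Integrable fun t : ℝ => exp (-(c + t * I) * ℓ i) * k t := by
    simp_rw [hk]
    exact (integral_rampKernel_div_sq hh hc _).1
  have hsum := hasSum_integral_of_summable_integral_norm hinteg (by
    simp_rw [hnorm]
    exact hℓ.mul_right _)
  simp_rw [hk, (integral_rampKernel_div_sq hh hc _).2] at hsum
  convert! hsum using 1
  congr 1 with t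
  simp_rw [← hk]
  exact ((hZ (c + t * I) (by simp)).mul_right (k t)).tsum_eq.symm

end Ramp

/-! ### Estimates for the Perron integral -/

lemma exp_le_add_exp (a b : ℝ) {Λ : ℝ} (hΛ : 1 ≤ Λ) :
    Real.exp a ≤ Real.exp b + Real.exp (Λ * a - (Λ - 1) * b) := by
  rcases le_or_gt a b with h | h
  · linarith [Real.exp_le_exp.2 h, Real.exp_pos (Λ * a - (Λ - 1) * b)]
  · have : Real.exp a ≤ Real.exp (Λ * a - (Λ - 1) * b) := Real.exp_le_exp.2 (by nlinarith)
    linarith [Real.exp_pos b]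

lemma exp_mul_rpow_le {x u η Λ : ℝ} (hx : 1 ≤ x) (hη : 0 < η) (hΛ : η * (Λ - 1) = 1) :
    Real.exp u * x ^ (-(1 + 2 * η) / 2) ≤ x ^ (-(1 + η) / 2) + x⁻¹ * Real.exp (Λ * u) := by
  have hx0 : 0 < x := by linarith
  set L := Real.log x
  have hL0 : 0 ≤ L := Real.log_nonneg hx
  have hpow (a : ℝ) : x ^ a = Real.exp (L * a) := Real.rpow_def_of_pos hx0 a
  rw [← Real.rpow_neg_one, hpow, hpow, hpow]
  calc Real.exp u * Real.exp (L * (-(1 + 2 * η) / 2))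
      ≤ (Real.exp (η * L / 2) + Real.exp (Λ * u - (Λ - 1) * (η * L / 2))) *
          Real.exp (L * (-(1 + 2 * η) / 2)) := by
        gcongr
        exact exp_le_add_exp _ _ (by nlinarith)
    _ = Real.exp (L * (-(1 + η) / 2)) + Real.exp (Λ * u - (1 + η) * L) := by
        rw [show (Λ - 1) * (η * L / 2) = η * (Λ - 1) * (L / 2) by ring, hΛ, add_mul,
          ← Real.exp_add, ← Real.exp_add]
        ring_nf
    _ ≤ Real.exp (L * (-(1 + η) / 2)) + Real.exp (L * -1) * Real.exp (Λ * u) := by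
        rw [← Real.exp_add]
        gcongr
        nlinarith

lemma norm_exp_mul_sub_one_le_mul {s : ℂ} {h : ℝ} (hs0 : 0 ≤ s.re) (hs1 : s.re ≤ 1) (hh : 0 ≤ h)
    (hh1 : h ≤ 1) : ‖exp (s * h) - 1‖ ≤ 3 * (h * ‖s‖) := by
  rcases eq_or_ne s 0 with rfl | hs
  · simp
  have hrepr : exp (s * h) - 1 = s * ∫ u in (0 : ℝ)..h, exp (s * u) := by
    rw [integral_exp_mul_complex hs, ofReal_zero, mul_zero, exp_zero, mul_div_cancel₀ _ hs]
  have hinteg : ‖∫ u in (0 : ℝ)..h, exp (s * u)‖ ≤ 3 * |h - 0| := by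
    refine intervalIntegral.norm_integral_le_of_norm_le_const fun u hu => ?_
    rw [Set.uIoc_of_le hh] at hu
    rw [Complex.norm_exp, re_mul_ofReal]
    calc Real.exp (s.re * u) ≤ Real.exp 1 := Real.exp_le_exp.2 (by nlinarith [hu.1, hu.2])
      _ ≤ 3 := Real.exp_one_lt_three.le
  rw [sub_zero, abs_of_nonneg hh] at hinteg
  calc ‖exp (s * h) - 1‖ = ‖s‖ * ‖∫ u in (0 : ℝ)..h, exp (s * u)‖ := by rw [hrepr, norm_mul]
    _ ≤ ‖s‖ * (3 * h) := by gcongr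
    _ = 3 * (h * ‖s‖) := by ring

lemma norm_exp_mul_sub_one_le_rpow {s : ℂ} {h θ : ℝ} (hs0 : 0 ≤ s.re) (hs1 : s.re ≤ 1) (hh : 0 ≤ h)
    (hh1 : h ≤ 1) (hθ0 : 0 < θ) (hθ1 : θ ≤ 1) : ‖exp (s * h) - 1‖ ≤ 4 * (h * ‖s‖) ^ θ := by
  have hnonneg : 0 ≤ h * ‖s‖ := by positivity
  rcases le_total (h * ‖s‖) 1 with hle | hge
  · have hpow : h * ‖s‖ ≤ (h * ‖s‖) ^ θ := by
      conv_lhs => rw [← Real.rpow_one (h * ‖s‖)]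
      exact Real.rpow_le_rpow_of_exponent_ge' hnonneg hle hθ0.le hθ1
    linarith [norm_exp_mul_sub_one_le_mul hs0 hs1 hh hh1]
  · have hpow : 1 ≤ (h * ‖s‖) ^ θ := Real.one_le_rpow hge hθ0.le
    have hexp : ‖exp (s * h)‖ ≤ 3 := by
      rw [Complex.norm_exp, re_mul_ofReal]
      exact (Real.exp_le_exp.2 (by nlinarith)).trans Real.exp_one_lt_three.le
    have := norm_sub_le (exp (s * h)) 1
    rw [norm_one] at this
    linarith

lemma norm_rampKernel_le_rpow {s : ℂ} {h θ : ℝ} (hs0 : 0 ≤ s.re) (hs1 : s.re ≤ 1) (hh : 0 < h)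
    (hh1 : h ≤ 1) (hθ0 : 0 < θ) (hθ1 : θ ≤ 1) (Y : ℝ) :
    ‖rampKernel h Y s‖ ≤ 4 * (Real.exp (s.re * Y) * h ^ (θ - 1)) * ‖s‖ ^ θ := by
  calc ‖rampKernel h Y s‖ = Real.exp (s.re * Y) * (‖exp (s * h) - 1‖ / h) := by
        rw [rampKernel, norm_mul, norm_div, Complex.norm_real, Real.norm_of_nonneg hh.le,
          Complex.norm_exp, re_mul_ofReal]
    _ ≤ Real.exp (s.re * Y) * (4 * (h * ‖s‖) ^ θ / h) := by
        gcongr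
        exact norm_exp_mul_sub_one_le_rpow hs0 hs1 hh.le hh1 hθ0 hθ1
    _ = _ := by
        rw [Real.mul_rpow hh.le (norm_nonneg s), Real.rpow_sub_one hh.ne']
        ring

lemma norm_rampKernel_le {s : ℂ} {h b : ℝ} (hs0 : 0 ≤ s.re) (hb : s.re ≤ b) (hh : 0 < h)
    (hh1 : h ≤ 1) (Y : ℝ) :
    ‖rampKernel h Y s‖ ≤ Real.exp (b * |Y|) * ((Real.exp b + 1) / h) := by
  have hY : s.re * Y ≤ b * |Y| := by
    calc s.re * Y ≤ s.re * |Y| := by gcongr; exact le_abs_self Y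
      _ ≤ b * |Y| := by gcongr
  have hsub : ‖exp (s * h) - 1‖ ≤ Real.exp b + 1 := by
    refine (norm_sub_le _ _).trans ?_
    rw [norm_one, Complex.norm_exp, re_mul_ofReal]
    gcongr
    nlinarith
  rw [rampKernel, norm_mul, norm_div, Complex.norm_real, Real.norm_of_nonneg hh.le,
    Complex.norm_exp, re_mul_ofReal]
  gcongr

lemma min_one_abs_re_mul_sqrt_le_norm (z : ℂ) : min 1 |z.re| * √(1 + z.im ^ 2) ≤ ‖z‖ := by
  refine (sq_le_sq₀ (by positivity) (norm_nonneg z)).1 ?_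
  rw [mul_pow, Real.sq_sqrt (by positivity), Complex.sq_norm, Complex.normSq_apply]
  have hle_one : min 1 |z.re| ^ 2 ≤ 1 := pow_le_one₀ (by positivity) (min_le_left _ _)
  have hle_sq : min 1 |z.re| ^ 2 ≤ z.re ^ 2 := by
    rw [← sq_abs z.re]
    gcongr
    exact min_le_right _ _
  nlinarith [sq_nonneg z.im]

lemma exists_pos_mul_one_add_sq_le_norm_mul_sub {σ a a' : ℝ} (ha : σ ≠ a) (ha' : σ ≠ a') :
    ∃ c > 0, ∀ t : ℝ, c * (1 + t ^ 2) ≤ ‖(σ + t * I - a) * (σ + t * I - a')‖ := by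
  have hpos (b : ℝ) (hb : σ ≠ b) : 0 < min 1 |σ - b| :=
    lt_min one_pos (abs_pos.2 (sub_ne_zero.2 hb))
  have hle (b t : ℝ) : min 1 |σ - b| * √(1 + t ^ 2) ≤ ‖(σ + t * I - b : ℂ)‖ := by
    simpa using min_one_abs_re_mul_sqrt_le_norm (σ + t * I - b)
  refine ⟨min 1 |σ - a| * min 1 |σ - a'|, mul_pos (hpos a ha) (hpos a' ha'), fun t => ?_⟩
  calc min 1 |σ - a| * min 1 |σ - a'| * (1 + t ^ 2)
      = min 1 |σ - a| * √(1 + t ^ 2) * (min 1 |σ - a'| * √(1 + t ^ 2)) := by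
        rw [mul_mul_mul_comm, Real.mul_self_sqrt (by positivity)]
    _ ≤ ‖(σ + t * I - a : ℂ)‖ * ‖(σ + t * I - a' : ℂ)‖ := by
        gcongr
        exacts [hle a t, hle a' t]
    _ = _ := (norm_mul _ _).symm

lemma norm_le_sqrt_one_add_im_sq {s : ℂ} (hs : |s.re| ≤ 1) : ‖s‖ ≤ √(1 + s.im ^ 2) := by
  refine Real.le_sqrt_of_sq_le ?_
  rw [Complex.sq_norm, Complex.normSq_apply]
  nlinarith [(sq_le_one_iff_abs_le_one s.re).2 hs]

/-- The factor `h ^ (-2 η)` is the price of a numerator of size `‖s‖ ^ (1 - 2 η)`; the saved power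
of `1 + t ^ 2` then absorbs `exp f` through its `Λ`-th moment. -/
lemma norm_perron_integrand_le {σ η Λ BW c h t : ℝ} {w f D : ℂ} (hσ : 0 ≤ σ) (hσ1 : σ ≤ 1)
    (hη : 0 < η) (hη1 : 2 * η < 1) (hΛ : η * (Λ - 1) = 1) (hh : 0 < h) (hh1 : h ≤ 1)
    (hw : ‖w‖ ≤ BW) (hc : 0 < c) (hD : c * (1 + t ^ 2) ≤ ‖D‖) (Y : ℝ) :
    ‖w * exp f * rampKernel h Y (σ + t * I) / D‖ ≤
      BW * 4 / c * (Real.exp (σ * Y) * h ^ (-(2 * η))) *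
        ((1 + t ^ 2) ^ (-(1 + η) / 2) + (1 + t ^ 2)⁻¹ * Real.exp (Λ * f.re)) := by
  set s : ℂ := σ + t * I with hs
  have hre : s.re = σ := by simp [hs]
  have him : s.im = t := by simp [hs]
  set M := Real.exp (σ * Y) * h ^ (-(2 * η))
  set x := 1 + t ^ 2
  have hx : 0 < x := by positivity
  have hBW : 0 ≤ BW := (norm_nonneg _).trans hw
  have hsx : ‖s‖ ^ (1 - 2 * η) ≤ x ^ ((1 - 2 * η) / 2) := by
    rw [div_eq_inv_mul, Real.rpow_mul hx.le, ← one_div, ← Real.sqrt_eq_rpow]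
    refine Real.rpow_le_rpow (norm_nonneg _) ?_ (by linarith)
    simp only [x, ← him]
    exact norm_le_sqrt_one_add_im_sq (by rwa [hre, abs_of_nonneg hσ])
  have hker : ‖rampKernel h Y s‖ ≤ 4 * M * x ^ ((1 - 2 * η) / 2) := by
    have := norm_rampKernel_le_rpow (s := s) (θ := 1 - 2 * η) (by linarith) (by linarith) hh hh1
      (by linarith) (by linarith) Y
    rw [hre, sub_right_comm, sub_self, zero_sub] at this
    exact this.trans (by gcongr)
  calc ‖w * exp f * rampKernel h Y s / D‖
      ≤ BW * Real.exp f.re * (4 * M * x ^ ((1 - 2 * η) / 2)) / (c * x) := by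
        rw [norm_div, norm_mul, norm_mul, Complex.norm_exp]
        gcongr
    _ = BW * 4 / c * M * (Real.exp f.re * x ^ (-(1 + 2 * η) / 2)) := by
        rw [show -(1 + 2 * η) / 2 = (1 - 2 * η) / 2 - 1 by ring, Real.rpow_sub_one hx.ne']
        field_simp
    _ ≤ _ := by
        gcongr
        exact exp_mul_rpow_le (by simp [x, sq_nonneg]) hη hΛ

lemma exists_norm_perron_integral_le {σ a a' η Λ B BW : ℝ} (hσ : 0 ≤ σ) (hσ1 : σ ≤ 1)
    (ha : σ ≠ a) (ha' : σ ≠ a') (hη : 0 < η) (hη1 : 2 * η < 1) (hΛ : η * (Λ - 1) = 1)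
    (hB : 0 ≤ B) :
    ∃ K : ℝ, ∀ (W F : ℂ → ℂ) (h Y : ℝ), 0 < h → h ≤ 1 → (∀ s : ℂ, s.re = σ → ‖W s‖ ≤ BW) →
      Measurable (fun t : ℝ => F (σ + t * I)) →
      ∫⁻ t : ℝ, ENNReal.ofReal ((1 + t ^ 2)⁻¹ * Real.exp (Λ * (F (σ + t * I)).re)) ≤
        ENNReal.ofReal B →
      ‖∫ t : ℝ, W (σ + t * I) * exp (F (σ + t * I)) * rampKernel h Y (σ + t * I) /
        ((σ + t * I - a) * (σ + t * I - a'))‖ ≤ K * (Real.exp (σ * Y) * h ^ (-(2 * η))) := by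
  obtain ⟨c, hc, hD⟩ := exists_pos_mul_one_add_sq_le_norm_mul_sub ha ha'
  have hinteg : Integrable fun t : ℝ => (1 + t ^ 2) ^ (-(1 + η) / 2) := by
    have := integrable_rpow_neg_one_add_norm_sq (E := ℝ) (μ := volume) (r := 1 + η) (by simp [hη])
    simpa only [Real.norm_eq_abs, sq_abs] using this
  refine ⟨BW * 4 / c * ((∫ t : ℝ, (1 + t ^ 2) ^ (-(1 + η) / 2)) + B),
    fun W F h Y hh hh1 hW hF hmom => ?_⟩
  set M := Real.exp (σ * Y) * h ^ (-(2 * η))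
  have hBW : 0 ≤ BW := (norm_nonneg _).trans (hW σ (by simp))
  set E : ℝ → ℝ := fun t => (1 + t ^ 2)⁻¹ * Real.exp (Λ * (F (σ + t * I)).re)
  have hE0 : ∀ t, 0 ≤ E t := fun t => by positivity
  have hEm : AEStronglyMeasurable E volume := by
    have : Measurable fun t : ℝ => (F (σ + t * I)).re := Complex.measurable_re.comp hF
    refine Measurable.aestronglyMeasurable ?_
    dsimp only [E]
    fun_prop
  have hEint : Integrable E := by
    refine ⟨hEm, ?_⟩
    rw [hasFiniteIntegral_iff_ofReal (Eventually.of_forall hE0)]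
    exact hmom.trans_lt ENNReal.ofReal_lt_top
  have hEB : ∫ t, E t ≤ B := by
    rw [integral_eq_lintegral_of_nonneg_ae (Eventually.of_forall hE0) hEm]
    exact ENNReal.toReal_le_of_le_ofReal hB hmom
  calc _ ≤ ∫ t, BW * 4 / c * M * ((1 + t ^ 2) ^ (-(1 + η) / 2) + E t) :=
        norm_integral_le_of_norm_le ((hinteg.add hEint).const_mul _) (Eventually.of_forall fun t =>
          norm_perron_integrand_le hσ hσ1 hη hη1 hΛ hh hh1 (hW _ (by simp)) hc (hD t) Y)
    _ = BW * 4 / c * M * ((∫ t : ℝ, (1 + t ^ 2) ^ (-(1 + η) / 2)) + ∫ t, E t) := by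
        rw [integral_const_mul, integral_add hinteg hEint]
    _ ≤ BW * 4 / c * M * ((∫ t : ℝ, (1 + t ^ 2) ^ (-(1 + η) / 2)) + B) := by gcongr
    _ = _ := by ring

/-! ### The smoothed counting function -/

lemma tendsto_integral_div_mul_sub {b a a' M : ℝ} (ha : b ≠ a) (ha' : b ≠ a')
    {G : ℕ → ℂ → ℂ} {Glim : ℂ → ℂ} (hG : ∀ J, Measurable fun t : ℝ => G J (b + t * I))
    (hM : ∀ J (t : ℝ), ‖G J (b + t * I)‖ ≤ M)
    (hlim : ∀ t : ℝ, Tendsto (fun J => G J (b + t * I)) atTop (𝓝 (Glim (b + t * I)))) :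
    Tendsto (fun J => ∫ t : ℝ, G J (b + t * I) / ((b + t * I - a') * (b + t * I - a))) atTop
      (𝓝 (∫ t : ℝ, Glim (b + t * I) / ((b + t * I - a') * (b + t * I - a)))) := by
  obtain ⟨c, hc, hD⟩ := exists_pos_mul_one_add_sq_le_norm_mul_sub ha' ha
  have hM0 : 0 ≤ M := (norm_nonneg _).trans (hM 0 0)
  refine tendsto_integral_of_dominated_convergence (fun t => M / c * (1 + t ^ 2)⁻¹)
    (fun J => ((hG J).div (by fun_prop)).aestronglyMeasurable)
    (integrable_inv_one_add_sq.const_mul _) (fun J => Eventually.of_forall fun t => ?_)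
    (Eventually.of_forall fun t => (hlim t).div_const _)
  calc ‖G J (b + t * I) / ((b + t * I - a') * (b + t * I - a))‖
      ≤ M / (c * (1 + t ^ 2)) := by
        rw [norm_div]
        exact div_le_div₀ hM0 (hM J t) (by positivity) (hD t)
    _ = M / c * (1 + t ^ 2)⁻¹ := by rw [← div_div, div_eq_mul_inv]

/-- The function `W` is the regular part of the zeta function of the density `q`: the exponential
of the Laplace transform of `q`, split along the partition `y`, is `s ^ 2 / ((s - 1) (s - r)) W s`,
with `W` holomorphic and bounded by `BW` in the half-plane `1 / 2 < Re s`. -/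
structure RegularPart (q : ℝ → ℝ) (y : ℕ → ℝ) (r BW : ℝ) (W : ℂ → ℂ) : Prop where
  differentiableOn : DifferentiableOn ℂ W {s | 1 / 2 < s.re}
  norm_le : ∀ s : ℂ, 1 / 2 < s.re → ‖W s‖ ≤ BW
  exp_tsum_block : ∀ s : ℂ, 1 < s.re →
    exp (∑' j, block q y j s) = s ^ 2 / ((s - 1) * (s - r)) * W s

lemma RegularPart.norm_mul_exp_mul_rampKernel_le {q : ℝ → ℝ} {y : ℕ → ℝ} {r BW M b h : ℝ}
    {W : ℂ → ℂ} (hW : RegularPart q y r BW W) {s f : ℂ} (hs : 1 / 2 < s.re) (hb : s.re ≤ b)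
    (hf : ‖f‖ ≤ M) (hh : 0 < h) (hh1 : h ≤ 1) (Y : ℝ) :
    ‖W s * exp f * rampKernel h Y s‖ ≤
      BW * Real.exp M * (Real.exp (b * |Y|) * ((Real.exp b + 1) / h)) := by
  have hBW : 0 ≤ BW := (norm_nonneg _).trans (hW.norm_le s hs)
  rw [norm_mul, norm_mul]
  gcongr
  · exact hW.norm_le s hs
  · exact (norm_exp_le_exp_norm _).trans (Real.exp_le_exp.2 hf)
  · exact norm_rampKernel_le (by linarith) hb hh hh1 Y

namespace UnitPartition

variable {q : ℝ → ℝ} {y : ℕ → ℝ} {C : ℝ} (hq : UnitPartition q y C)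

include hq

lemma norm_localLog_le_three_mul (j : ℕ) {l : ℝ} (hl : y j ≤ l) {s : ℂ} (hs : 1 / 2 ≤ s.re) :
    ‖localLog q y j l s‖ ≤ 3 * Real.exp (-s.re * y j) := by
  have hsplit : localLog q y j l s = exp (-s * l) - block q y j s +
      (-log (1 - exp (-s * l)) - exp (-s * l)) := by
    rw [localLog]
    ring
  have hexp : Real.exp (-2 * s.re * y j) ≤ Real.exp (-s.re * y j) :=
    Real.exp_le_exp.2 (by nlinarith [hq.y_pos j])
  calc ‖localLog q y j l s‖
      ≤ 2 * Real.exp (-s.re * y j) + Real.exp (-2 * s.re * y j) := by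
        rw [hsplit]
        exact norm_add_le_of_le (hq.norm_exp_sub_block_le_two_mul j hl (by linarith))
          (hq.norm_log_sub_le j hl hs)
    _ ≤ 3 * Real.exp (-s.re * y j) := by linarith

lemma summable_block {s : ℂ} (hs : 1 < s.re) : Summable fun j => block q y j s :=
  Summable.of_norm_bounded (hq.summable_exp hs) fun j => hq.norm_block_le j (by linarith)

variable {lam : ℕ → ℝ} (hlam : ∀ j, lam j ∈ Set.Icc (y j) (y (j + 1)))

include hlam

lemma exp_tsum_log {s : ℂ} (hs : 1 < s.re) : exp (∑' j, -log (1 - exp (-s * lam j))) =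
    exp (∑' j, localLog q y j (lam j) s) * exp (∑' j, block q y j s) := by
  rw [← exp_add, ← (hq.summable_localLog hlam (by linarith)).tsum_add (hq.summable_block hs)]
  simp only [localLog, sub_add_cancel]

lemma norm_sum_localLog_le (J : ℕ) {s : ℂ} (hs : 1 / 2 ≤ s.re) :
    ‖∑ j ∈ Finset.range J, localLog q y j (lam j) s‖ ≤ 3 * J := by
  have hterm (j : ℕ) : ‖localLog q y j (lam j) s‖ ≤ 3 := by
    linarith [hq.norm_localLog_le_three_mul j (hlam j).1 hs, hq.exp_neg_mul_le_half j le_rfl hs]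
  simpa [mul_comm] using norm_sum_le_of_le (Finset.range J) fun j _ => hterm j

lemma norm_sum_localLog_le_tsum (J : ℕ) {s : ℂ} (hs : 1 < s.re) :
    ‖∑ j ∈ Finset.range J, localLog q y j (lam j) s‖ ≤ ∑' j, 3 * Real.exp (-s.re * y j) :=
  (norm_sum_le_of_le _ fun j _ =>
    hq.norm_localLog_le_three_mul j (hlam j).1 (by linarith)).trans
    (((hq.summable_exp hs).mul_left 3).sum_le_tsum _ fun j _ => by positivity)

lemma differentiableOn_sum_localLog (J : ℕ) :
    DifferentiableOn ℂ (fun s => ∑ j ∈ Finset.range J, localLog q y j (lam j) s)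
      {s | 1 / 2 < s.re} :=
  DifferentiableOn.fun_sum fun j _ => hq.differentiableOn_localLog j (hlam j).1

lemma tendsto_mul_exp_sum_mul_rampKernel (W : ℂ → ℂ) {s : ℂ} (hs : 1 / 2 < s.re) (h Y : ℝ) :
    Tendsto (fun J => W s * exp (∑ j ∈ Finset.range J, localLog q y j (lam j) s) *
      rampKernel h Y s) atTop
      (𝓝 (W s * exp (∑' j, localLog q y j (lam j) s) * rampKernel h Y s)) :=
  (((continuous_exp.tendsto _).comp
    (hq.summable_localLog hlam hs).hasSum.tendsto_sum_nat).const_mul _).mul_const _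

variable {r BW : ℝ} {W : ℂ → ℂ} (hW : RegularPart q y r BW W)

include hW

lemma tendsto_perron_integral {ι : Type*} [Countable ι] {ℓ : ι → ℝ} {b : ℝ} (hb : 1 < b)
    (hr1 : r < 1) (hℓ : Summable fun i => Real.exp (-b * ℓ i))
    (hZ : ∀ s : ℂ, s.re = b →
      HasSum (fun i => exp (-s * ℓ i)) (exp (∑' j, -log (1 - exp (-s * lam j)))))
    {h : ℝ} (hh : 0 < h) (hh1 : h ≤ 1) (Y : ℝ) :
    Tendsto (fun J => ∫ t : ℝ, W (b + t * I) *
        exp (∑ j ∈ Finset.range J, localLog q y j (lam j) (b + t * I)) *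
          rampKernel h Y (b + t * I) / ((b + t * I - (1 : ℝ)) * (b + t * I - r))) atTop
      (𝓝 (2 * Real.pi * (∑' i, ramp h (Y - ℓ i) : ℝ))) := by
  have hre (t : ℝ) : (b + t * I : ℂ).re = b := by simp
  have hlim := tendsto_integral_div_mul_sub (b := b) (a := r) (a' := 1)
    (M := BW * Real.exp (∑' j, 3 * Real.exp (-b * y j)) *
      (Real.exp (b * |Y|) * ((Real.exp b + 1) / h))) (by linarith) hb.ne'
    (G := fun J s => W s * exp (∑ j ∈ Finset.range J, localLog q y j (lam j) s) *
      rampKernel h Y s)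
    (Glim := fun s => W s * exp (∑' j, localLog q y j (lam j) s) * rampKernel h Y s)
    (fun J => by
      have hG := (hW.differentiableOn.mul (hq.differentiableOn_sum_localLog hlam J).cexp).mul
        (differentiable_rampKernel h Y).differentiableOn
      exact (hG.continuousOn.comp_continuous (by fun_prop) fun t : ℝ =>
        show 1 / 2 < (b + t * I : ℂ).re by rw [hre]; linarith).measurable)
    (fun J t => hW.norm_mul_exp_mul_rampKernel_le (by rw [hre]; linarith) (hre t).le
      (by
        have := hq.norm_sum_localLog_le_tsum hlam J (hb.trans_eq (hre t).symm)
        rwa [hre] at this) hh hh1 Y)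
    fun t => hq.tendsto_mul_exp_sum_mul_rampKernel hlam W (by rw [hre]; linarith) h Y
  convert! hlim using 2
  have hperron := (hasSum_ramp (by linarith) hℓ hZ hh Y).tsum_eq
  rw [← ofReal_tsum, tsum_mul_left] at hperron
  rw [← ofReal_ofNat, ← ofReal_mul, ← ofReal_mul, hperron]
  congr 1 with t
  have hs : 1 < (b + t * I : ℂ).re := by rw [hre]; exact hb
  have hs0 : (b + t * I : ℂ) ≠ 0 := fun h0 => by simp [h0] at hs; linarith
  rw [hq.exp_tsum_log hlam hs, hW.exp_tsum_block _ hs, ofReal_one]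
  field_simp

/-- Shift the Perron integral of the smoothed counting function from `Re s = b` to `Re s = σ`; the
poles at `1` and `r` give the main terms. The shift is done for the finite sums over `j < J`, for
which the integrand is bounded in the strip. -/
lemma exists_norm_tsum_ramp_sub_le {ι : Type*} [Countable ι] {ℓ : ι → ℝ} {b : ℝ} (hb : 1 < b)
    (hℓ : Summable fun i => Real.exp (-b * ℓ i))
    (hZ : ∀ s : ℂ, s.re = b →
      HasSum (fun i => exp (-s * ℓ i)) (exp (∑' j, -log (1 - exp (-s * lam j)))))
    {σ η Λ B : ℝ} (hσ : 1 / 2 < σ) (hσr : σ < r) (hr : r < 1)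
    (hη : 0 < η) (hη1 : 2 * η < 1) (hΛ : η * (Λ - 1) = 1) (hB : 0 ≤ B)
    (hmom : ∀ J : ℕ, ∫⁻ t : ℝ, ENNReal.ofReal ((1 + t ^ 2)⁻¹ *
        Real.exp (Λ * (∑ j ∈ Finset.range J, localLog q y j (lam j) (σ + t * I)).re)) ≤
          ENNReal.ofReal B) :
    ∃ K : ℝ, ∀ h Y : ℝ, 0 < h → h ≤ 1 →
      ‖((∑' i, ramp h (Y - ℓ i) : ℝ) : ℂ) -
        (W (1 : ℝ) * exp (∑' j, localLog q y j (lam j) (1 : ℝ)) * rampKernel h Y (1 : ℝ) -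
          W r * exp (∑' j, localLog q y j (lam j) r) * rampKernel h Y r) / ((1 : ℝ) - r)‖ ≤
        K * (Real.exp (σ * Y) * h ^ (-(2 * η))) := by
  obtain ⟨K, hK⟩ := exists_norm_perron_integral_le (BW := BW) (σ := σ) (a := 1) (a' := r)
    (by linarith) (by linarith) (by linarith) hσr.ne hη hη1 hΛ hB
  refine ⟨(2 * Real.pi)⁻¹ * K, fun h Y hh hh1 => ?_⟩
  set S : ℕ → ℂ → ℂ := fun J s => ∑ j ∈ Finset.range J, localLog q y j (lam j) s
  set G : ℕ → ℂ → ℂ := fun J s => W s * exp (S J s) * rampKernel h Y s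
  have hSd (J : ℕ) := hq.differentiableOn_sum_localLog hlam J
  have hGd (J : ℕ) : DifferentiableOn ℂ (G J) {s | 1 / 2 < s.re} :=
    (hW.differentiableOn.mul (hSd J).cexp).mul (differentiable_rampKernel h Y).differentiableOn
  have hshift (J : ℕ) := integral_div_mul_sub_eq_add_residues hσ (by linarith) hσr hr hb (hGd J)
    fun s hs hsb => hW.norm_mul_exp_mul_rampKernel_le (hσ.trans_le hs) hsb
      (hq.norm_sum_localLog_le hlam J (by linarith)) hh hh1 Y
  have hσbound (J : ℕ) := hK W (S J) h Y hh hh1 (fun s hs => hW.norm_le s (hσ.trans_eq hs.symm))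
    ((hSd J).continuousOn.comp_continuous (by fun_prop) fun t => by simpa using hσ).measurable
    (hmom J)
  have hGlim (a : ℝ) (ha : 1 / 2 < a) :=
    hq.tendsto_mul_exp_sum_mul_rampKernel hlam W (s := a) ha h Y
  have hlim := (hq.tendsto_perron_integral hlam hW hb hr hℓ hZ hh hh1 Y).sub
    ((((hGlim 1 (by norm_num)).sub (hGlim r (by linarith))).div_const
      (((1 : ℝ) : ℂ) - r)).const_mul (2 * Real.pi : ℂ))
  have hle := le_of_tendsto hlim.norm (Eventually.of_forall fun J => by
    rw [hshift J, add_sub_cancel_right]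
    exact hσbound J)
  have hpi : ‖(2 * Real.pi : ℂ)‖ = 2 * Real.pi := by
    rw [← ofReal_ofNat, ← ofReal_mul, Complex.norm_real, Real.norm_of_nonneg (by positivity)]
  rw [← mul_sub, norm_mul, hpi] at hle
  rwa [mul_assoc _ K, ← div_eq_inv_mul, le_div_iff₀' (by positivity)]

end UnitPartition

/-! ### Counting integers and primes -/

section Count

variable {w : Nat.Primes → ℝ} (hw : ∀ p, 0 < w p) (hfin : ∀ y, {p | w p ≤ y}.Finite)

include hw hfin in
lemma ramp_sub_logSize_eq_zero {h : ℝ} (hh : 0 < h) (Y : ℝ) {n : ℕ+}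
    (hn : n ∉ (finite_logSize_le hw hfin (Y + h)).toFinset) : ramp h (Y - logSize w n) = 0 := by
  simp only [Set.Finite.mem_toFinset, Set.mem_ofPred_eq, not_le] at hn
  exact ramp_of_le hh (by linarith)

lemma count_weightedSemigroup {x : ℝ} (hx : 0 < x) : (weightedSemigroup w hw hfin).count x =
    (finite_logSize_le hw hfin (Real.log x)).toFinset.card := by
  rw [ArithmeticalSemigroup.count,
    ← Set.ncard_eq_toFinset_card _ (finite_logSize_le hw hfin (Real.log x))]
  simp only [weightedSemigroup_norm_le_iff hw hfin hx]

lemma count_le_tsum_ramp {x h : ℝ} (hx : 0 < x) (hh : 0 < h) :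
    ((weightedSemigroup w hw hfin).count x : ℝ) ≤ ∑' n, ramp h (Real.log x - logSize w n) := by
  set s := (finite_logSize_le hw hfin (Real.log x)).toFinset
  have hone : ∀ n ∈ s, ramp h (Real.log x - logSize w n) = 1 := fun n hn =>
    ramp_of_nonneg hh (sub_nonneg.2 ((finite_logSize_le hw hfin (Real.log x)).mem_toFinset.1 hn))
  have hsum : Summable fun n => ramp h (Real.log x - logSize w n) :=
    summable_of_ne_finset_zero fun n hn => ramp_sub_logSize_eq_zero hw hfin hh (Real.log x) hn
  calc ((weightedSemigroup w hw hfin).count x : ℝ)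
      = ∑ n ∈ s, ramp h (Real.log x - logSize w n) := by
        rw [count_weightedSemigroup hw hfin hx, Finset.sum_congr rfl hone, Finset.sum_const,
          nsmul_one]
    _ ≤ _ := hsum.sum_le_tsum s fun n _ => ramp_nonneg hh _

lemma tsum_ramp_le_count {x h : ℝ} (hx : 0 < x) (hh : 0 < h) :
    ∑' n, ramp h (Real.log x - h - logSize w n) ≤ ((weightedSemigroup w hw hfin).count x : ℝ) := by
  rw [count_weightedSemigroup hw hfin hx,
    tsum_eq_sum fun n hn => ramp_sub_logSize_eq_zero hw hfin hh (Real.log x - h) hn]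
  simpa only [sub_add_cancel, nsmul_one] using
    Finset.sum_le_card_nsmul _ _ 1 fun n _ => ramp_le_one hh _

end Count

namespace UnitPartition

variable {q : ℝ → ℝ} {y : ℕ → ℝ} {C : ℝ} (hq : UnitPartition q y C)

include hq

lemma tendsto_y : Tendsto y atTop atTop := by
  refine Real.tendsto_exp_comp_atTop.1 ?_
  refine tendsto_atTop_mono (fun j => ?_) (tendsto_natCast_atTop_atTop.atTop_div_const hq.C_pos)
  rw [div_le_iff₀' hq.C_pos]
  exact hq.natCast_le_mul_exp j

lemma exists_mem_Ico {Y : ℝ} (hY : y 0 ≤ Y) : ∃ J, Y ∈ Set.Ico (y J) (y (J + 1)) := by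
  have : Y ∈ ⋃ j, Set.Ico (y j) (y (Order.succ j)) := by
    rw [iUnion_Ico_map_succ_eq_Ici fun j => hq.y_zero_le j]
    · exact hY
    · exact not_bddAbove_of_tendsto_atTop hq.tendsto_y
  simpa only [Set.mem_iUnion, Nat.succ_eq_succ, Nat.succ_eq_add_one] using this

lemma intervalIntegrable_id_mul {a b : ℝ} (ha : y 0 ≤ a) (hb : y 0 ≤ b) :
    IntervalIntegrable (fun τ => τ * q τ) volume a b :=
  (hq.intervalIntegrable ha hb).continuousOn_mul continuousOn_id

lemma integral_id_mul_block_mem_Icc (j : ℕ) :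
    ∫ τ in (y j)..(y (j + 1)), τ * q τ ∈ Set.Icc (y j) (y (j + 1)) := by
  have hi := hq.intervalIntegrable_block j
  have hm := hq.intervalIntegrable_id_mul (hq.y_zero_le j) (hq.y_zero_le (j + 1))
  have hq0 : ∀ τ ∈ Set.Icc (y j) (y (j + 1)), 0 ≤ q τ := fun τ hτ =>
    hq.nonneg τ ((hq.y_zero_le j).trans hτ.1)
  have hconst (a : ℝ) : ∫ τ in (y j)..(y (j + 1)), a * q τ = a := by
    rw [intervalIntegral.integral_const_mul, hq.integral_eq_one, mul_one]
  constructor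
  · refine (hconst (y j)).symm.trans_le ?_
    exact intervalIntegral.integral_mono_on (hq.y_le_succ j) (hi.const_mul _) hm fun τ hτ =>
      mul_le_mul_of_nonneg_right hτ.1 (hq0 τ hτ)
  · refine le_of_le_of_eq ?_ (hconst (y (j + 1)))
    exact intervalIntegral.integral_mono_on (hq.y_le_succ j) hm (hi.const_mul _) fun τ hτ =>
      mul_le_mul_of_nonneg_right hτ.2 (hq0 τ hτ)

lemma integral_id_mul_mem_Icc {J : ℕ} {Y : ℝ} (hY : Y ∈ Set.Ico (y J) (y (J + 1))) :
    ∫ τ in (y J)..Y, τ * q τ ∈ Set.Icc 0 Y := by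
  have hJ := hq.y_zero_le J
  have hY0 : 0 ≤ Y := (hq.y_pos J).le.trans hY.1
  have hi := hq.intervalIntegrable hJ (hJ.trans hY.1)
  have hq0 : ∀ τ, y J ≤ τ → 0 ≤ q τ := fun τ hτ => hq.nonneg τ (hJ.trans hτ)
  constructor
  · exact intervalIntegral.integral_nonneg hY.1 fun τ hτ =>
      mul_nonneg ((hq.y_pos J).le.trans hτ.1) (hq0 τ hτ.1)
  · calc ∫ τ in (y J)..Y, τ * q τ ≤ ∫ τ in (y J)..Y, Y * q τ :=
          intervalIntegral.integral_mono_on hY.1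
            (hq.intervalIntegrable_id_mul hJ (hJ.trans hY.1)) (hi.const_mul _)
            fun τ hτ => mul_le_mul_of_nonneg_right hτ.2 (hq0 τ hτ.1)
      _ = Y * ∫ τ in (y J)..Y, q τ := intervalIntegral.integral_const_mul _ _
      _ ≤ Y * ∫ τ in (y J)..(y (J + 1)), q τ :=
          mul_le_mul_of_nonneg_left (intervalIntegral.integral_mono_interval le_rfl hY.1 hY.2.le
            ((ae_restrict_mem measurableSet_Ioc).mono fun τ hτ => hq0 τ hτ.1.le)
            (hq.intervalIntegrable_block J)) hY0
      _ = Y := by rw [hq.integral_eq_one, mul_one]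

variable {lam : ℕ → ℝ} (hlam : ∀ j, lam j ∈ Set.Icc (y j) (y (j + 1)))

include hlam

lemma exp_tsum_localLog_ofReal {x : ℝ} (hx : 1 / 2 ≤ x) :
    ∃ b : ℝ, 0 < b ∧ exp (∑' j, localLog q y j (lam j) x) = b := by
  have hreal (j : ℕ) : ∃ b : ℝ, localLog q y j (lam j) x = b := by
    have hexp : exp (-(x : ℂ) * lam j) = (Real.exp (-x * lam j) : ℝ) := by push_cast; rfl
    have hblock : block q y j x =
        ((∫ τ in (y j)..(y (j + 1)), Real.exp (-x * τ) * q τ : ℝ) : ℂ) := by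
      rw [block, ← intervalIntegral.integral_ofReal]
      push_cast
      rfl
    have := hq.exp_neg_mul_le_half j (hlam j).1 hx
    exact ⟨_, by rw [localLog, hexp, hblock, ← ofReal_one, ← ofReal_sub,
      ← Complex.ofReal_log (by linarith), ← ofReal_neg, ← ofReal_sub]⟩
  choose b hb using hreal
  exact ⟨Real.exp (∑' j, b j), Real.exp_pos _, by simp only [hb, ofReal_exp, ofReal_tsum]⟩

lemma finite_lam_le (Y : ℝ) : {j | lam j ≤ Y}.Finite := by
  obtain ⟨n, hn⟩ := ((tendsto_atTop.1 hq.tendsto_y) (Y + 1)).exists_forall_of_atTop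
  refine (Set.finite_lt_nat n).subset fun j hj => ?_
  by_contra h
  have hj : lam j ≤ Y := hj
  linarith [hn j (not_lt.1 h), (hlam j).1]

lemma card_lam_le (Y : ℝ) :
    ((hq.finite_lam_le hlam Y).toFinset.card : ℝ) ≤ C * Real.exp Y + 1 := by
  have hC := hq.C_pos
  have hsub : (hq.finite_lam_le hlam Y).toFinset ⊆ Finset.range (⌊C * Real.exp Y⌋₊ + 1) := by
    intro j hj
    have hj : lam j ≤ Y := (hq.finite_lam_le hlam Y).mem_toFinset.1 hj
    refine Finset.mem_range_succ_iff.2 (Nat.le_floor ((hq.natCast_le_mul_exp j).trans ?_))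
    gcongr
    exact (hlam j).1.trans hj
  calc ((hq.finite_lam_le hlam Y).toFinset.card : ℝ)
      ≤ (⌊C * Real.exp Y⌋₊ + 1 : ℕ) := by
        exact_mod_cast (Finset.card_le_card hsub).trans_eq (Finset.card_range _)
    _ ≤ C * Real.exp Y + 1 := by
        push_cast
        gcongr
        exact Nat.floor_le (by positivity)

lemma sum_lam_le_eq {J : ℕ} {Y : ℝ} (hY : Y ∈ Set.Ico (y J) (y (J + 1))) :
    ∑ j ∈ (hq.finite_lam_le hlam Y).toFinset, lam j =
      ∑ j ∈ Finset.range J, lam j + if lam J ≤ Y then lam J else 0 := by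
  have hfilter : (hq.finite_lam_le hlam Y).toFinset =
      (Finset.range (J + 1)).filter fun j => lam j ≤ Y := by
    ext j
    simp only [Set.Finite.mem_toFinset, Set.mem_ofPred_eq, Finset.mem_filter, Finset.mem_range,
      iff_and_self]
    exact fun hj => hq.strictMono.lt_iff_lt.1 (((hlam j).1.trans hj).trans_lt hY.2)
  rw [hfilter, Finset.sum_filter, Finset.sum_range_succ]
  congr 1
  refine Finset.sum_congr rfl fun j hj => if_pos ?_
  exact (hlam j).2.trans ((hq.strictMono.monotone (Finset.mem_range.1 hj)).trans hY.1)

lemma abs_sum_range_lam_sub_integral_le (J : ℕ) :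
    |∑ j ∈ Finset.range J, lam j - ∫ τ in (y 0)..(y J), τ * q τ| ≤ y J - y 0 := by
  rw [← intervalIntegral.sum_integral_adjacent_intervals fun k _ =>
      hq.intervalIntegrable_id_mul (hq.y_zero_le k) (hq.y_zero_le (k + 1)),
    ← Finset.sum_sub_distrib, ← Finset.sum_range_sub y J]
  refine (Finset.abs_sum_le_sum_abs _ _).trans (Finset.sum_le_sum fun j _ => ?_)
  have hinteg := hq.integral_id_mul_block_mem_Icc j
  rw [abs_le]
  constructor <;> linarith [(hlam j).1, (hlam j).2, hinteg.1, hinteg.2]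

lemma abs_sum_lam_sub_integral_le {Y : ℝ} (hY : y 0 ≤ Y) :
    |∑ j ∈ (hq.finite_lam_le hlam Y).toFinset, lam j - ∫ τ in (y 0)..Y, τ * q τ| ≤ 3 * Y := by
  obtain ⟨J, hJ⟩ := hq.exists_mem_Ico hY
  have hsplit := intervalIntegral.integral_add_adjacent_intervals
    (hq.intervalIntegrable_id_mul le_rfl (hq.y_zero_le J))
    (hq.intervalIntegrable_id_mul (hq.y_zero_le J) hY)
  have hlast := hq.integral_id_mul_mem_Icc hJ
  have hJ0 : 0 ≤ lam J := (hq.y_pos J).le.trans (hlam J).1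
  have hif : (if lam J ≤ Y then lam J else 0) ∈ Set.Icc 0 Y := by
    split_ifs with h
    · exact ⟨hJ0, h⟩
    · exact ⟨le_rfl, (hq.y_pos J).le.trans hJ.1⟩
  have hrange := abs_le.1 (hq.abs_sum_range_lam_sub_integral_le hlam J)
  rw [hq.sum_lam_le_eq hlam hJ, ← hsplit, abs_le]
  constructor <;> linarith [hrange.1, hrange.2, hlast.1, hlast.2, hif.1, hif.2, hJ.1, hq.y_pos 0]

end UnitPartition

/-! ### Unsmoothing and Axiom A -/

/-- The average of `u ↦ exp (a * u)` over the interval `[v, v + h]`: this is how a term `x ^ a` of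
the counting function enters the smoothed counting function. -/
noncomputable def expAverage (a h v : ℝ) : ℝ :=
  Real.exp (a * v) * ((Real.exp (a * h) - 1) / (a * h))

lemma rampKernel_ofReal {a : ℝ} (ha : a ≠ 0) (h v : ℝ) :
    rampKernel h v a = (a * expAverage a h v : ℝ) := by
  have hcancel : a * ((Real.exp (a * h) - 1) / (a * h)) = (Real.exp (a * h) - 1) / h := by
    rw [← mul_div_assoc, mul_div_mul_left _ _ ha]
  rw [rampKernel, expAverage, mul_left_comm, hcancel]
  push_cast
  rfl

lemma expAverage_mem_Icc {a h : ℝ} (hah : 0 < a * h) (v : ℝ) :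
    expAverage a h v ∈ Set.Icc (Real.exp (a * v)) (Real.exp (a * (v + h))) := by
  rw [expAverage, mul_add, Real.exp_add]
  refine ⟨le_mul_of_one_le_right (Real.exp_pos _).le ?_,
    mul_le_mul_of_nonneg_left ?_ (Real.exp_pos _).le⟩
  · rw [le_div_iff₀ hah]
    linarith [Real.add_one_le_exp (a * h)]
  · rw [div_le_iff₀ hah]
    have := mul_le_mul_of_nonneg_left (Real.one_sub_le_exp_neg (a * h)) (Real.exp_pos (a * h)).le
    rw [← Real.exp_add, add_neg_cancel, Real.exp_zero] at this
    linarith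

lemma abs_expAverage_sub_exp_le {a h v Y : ℝ} (ha : 0 < a) (ha1 : a ≤ 1) (hh : 0 < h)
    (hh1 : h ≤ 1) (hY : 0 ≤ Y) (hvY : v ≤ Y) (hYv : Y ≤ v + h) :
    |expAverage a h v - Real.exp (a * Y)| ≤ 2 * (Real.exp Y * h) := by
  have hah : 0 < a * h := mul_pos ha hh
  have hahh : a * h ≤ h := mul_le_of_le_one_left hh.le ha1
  have hgap : Real.exp (a * h) - 1 ≤ 2 * h := by
    have := Real.abs_exp_sub_one_le (x := a * h) (by rw [abs_of_pos hah]; linarith)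
    rw [abs_of_pos hah] at this
    linarith [le_abs_self (Real.exp (a * h) - 1)]
  have hv : Real.exp (a * v) ≤ Real.exp Y := Real.exp_le_exp.2
    ((mul_le_mul_of_nonneg_left hvY ha.le).trans (mul_le_of_le_one_left hY ha1))
  have havg := expAverage_mem_Icc hah v
  have hexp : Real.exp (a * Y) ∈ Set.Icc (Real.exp (a * v)) (Real.exp (a * (v + h))) :=
    ⟨Real.exp_le_exp.2 (by gcongr), Real.exp_le_exp.2 (by gcongr)⟩
  calc |expAverage a h v - Real.exp (a * Y)|
      ≤ Real.exp (a * (v + h)) - Real.exp (a * v) := by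
        rw [abs_le]
        constructor <;> linarith [havg.1, havg.2, hexp.1, hexp.2]
    _ = Real.exp (a * v) * (Real.exp (a * h) - 1) := by
        rw [mul_add, Real.exp_add]
        ring
    _ ≤ Real.exp Y * (2 * h) := by
        gcongr
        linarith [Real.add_one_le_exp (a * h)]
    _ = 2 * (Real.exp Y * h) := by ring

lemma abs_mul_expAverage_sub_rpow_le (κ c : ℝ) {r x h v : ℝ} (hr0 : 0 < r) (hr : r ≤ 1)
    (hx : 1 ≤ x) (hh : 0 < h) (hh1 : h ≤ 1) (hv : v ≤ Real.log x) (hv' : Real.log x ≤ v + h) :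
    |κ * expAverage 1 h v + c * expAverage r h v - (κ * x + c * x ^ r)| ≤
      2 * (|κ| + |c|) * (x * h) := by
  have hx0 : 0 < x := one_pos.trans_le hx
  have hlog : 0 ≤ Real.log x := Real.log_nonneg hx
  have hone := abs_expAverage_sub_exp_le one_pos le_rfl hh hh1 hlog hv hv'
  have hr := abs_expAverage_sub_exp_le hr0 hr hh hh1 hlog hv hv'
  rw [one_mul, Real.exp_log hx0] at hone
  rw [mul_comm r, ← Real.rpow_def_of_pos hx0, Real.exp_log hx0] at hr
  calc |κ * expAverage 1 h v + c * expAverage r h v - (κ * x + c * x ^ r)|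
      = |κ * (expAverage 1 h v - x) + c * (expAverage r h v - x ^ r)| := by
        congr 1
        ring
    _ ≤ |κ| * (2 * (x * h)) + |c| * (2 * (x * h)) := by
        refine (abs_add_le _ _).trans ?_
        rw [abs_mul, abs_mul]
        gcongr
    _ = 2 * (|κ| + |c|) * (x * h) := by ring

/-- Since `F h (log x - h) ≤ N x ≤ F h (log x)`, an asymptotic formula for the smoothed sums `F`
with a mild loss as `h → 0` transfers to `N`, on taking `h = x ^ (-1 / 2)`. -/
lemma exists_abs_sub_le_of_smoothed {F : ℝ → ℝ → ℝ} {N : ℝ → ℝ} {κ c K σ η r : ℝ}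
    (hσ : 1 / 2 ≤ σ) (hr0 : 0 < r) (hr : r ≤ 1) (hη : 0 ≤ η)
    (hF : ∀ h v : ℝ, 0 < h → h ≤ 1 → |F h v - (κ * expAverage 1 h v + c * expAverage r h v)| ≤
      K * (Real.exp (σ * v) * h ^ (-(2 * η))))
    (hup : ∀ x h : ℝ, 0 < x → 0 < h → N x ≤ F h (Real.log x))
    (hlow : ∀ x h : ℝ, 0 < x → 0 < h → F h (Real.log x - h) ≤ N x) :
    ∃ K' : ℝ, ∀ x : ℝ, 1 ≤ x → |N x - κ * x - c * x ^ r| ≤ K' * x ^ (σ + η) := by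
  have hK : 0 ≤ K := by simpa using (abs_nonneg _).trans (hF 1 0 one_pos le_rfl)
  refine ⟨K + 2 * (|κ| + |c|), fun x hx => ?_⟩
  have hx0 : 0 < x := one_pos.trans_le hx
  set h : ℝ := x ^ (-(1 / 2) : ℝ)
  have hh : 0 < h := Real.rpow_pos_of_pos hx0 _
  have hh1 : h ≤ 1 := Real.rpow_le_one_of_one_le_of_nonpos hx (by norm_num)
  have hxh : x * h ≤ x ^ (σ + η) := by
    rw [← Real.rpow_one_add' hx0.le (by norm_num)]
    exact Real.rpow_le_rpow_of_exponent_le hx (by linarith)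
  have hclose (v : ℝ) (hv : v ≤ Real.log x) (hv' : Real.log x ≤ v + h) :
      |F h v - (κ * x + c * x ^ r)| ≤ (K + 2 * (|κ| + |c|)) * x ^ (σ + η) := by
    have herr : Real.exp (σ * v) * h ^ (-(2 * η)) ≤ x ^ (σ + η) := by
      rw [← Real.rpow_mul hx0.le, Real.rpow_add hx0, Real.rpow_def_of_pos hx0 σ, mul_comm σ,
        show -(1 / 2) * -(2 * η) = η by ring]
      gcongr
    calc |F h v - (κ * x + c * x ^ r)|
        = |(F h v - (κ * expAverage 1 h v + c * expAverage r h v)) +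
            (κ * expAverage 1 h v + c * expAverage r h v - (κ * x + c * x ^ r))| := by
          rw [sub_add_sub_cancel]
      _ ≤ K * x ^ (σ + η) + 2 * (|κ| + |c|) * x ^ (σ + η) := by
          refine (abs_add_le _ _).trans (add_le_add ((hF h v hh hh1).trans (by gcongr)) ?_)
          refine (abs_mul_expAverage_sub_rpow_le κ c hr0 hr hx hh hh1 hv hv').trans ?_
          gcongr
      _ = (K + 2 * (|κ| + |c|)) * x ^ (σ + η) := by ring
  have hupper := abs_le.1 (hclose (Real.log x) le_rfl (by linarith))
  have hlower := abs_le.1 (hclose (Real.log x - h) (by linarith) (by linarith))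
  rw [abs_le]
  constructor <;> linarith [hupper.2, hlower.1, hup x h hx0 hh, hlow x h hx0 hh]

lemma isLittleO_rpow_rpow {a b : ℝ} (hab : a < b) :
    (fun x : ℝ => x ^ a) =o[atTop] fun x => x ^ b := by
  refine (isLittleO_iff_tendsto' ?_).2 ?_
  · filter_upwards [eventually_gt_atTop 0] with x hx h
    exact absurd h (Real.rpow_pos_of_pos hx b).ne'
  · refine (tendsto_rpow_neg_atTop (sub_pos.2 hab)).congr' ?_
    filter_upwards [eventually_gt_atTop 0] with x hx
    rw [← Real.rpow_sub hx, neg_sub]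

lemma eq_zero_of_isBigO_rpow {a b c : ℝ} (hab : a < b)
    (h : (fun x : ℝ => c * x ^ b) =O[atTop] fun x => x ^ a) : c = 0 := by
  by_contra hc
  have hself : (fun x : ℝ => x ^ b) =o[atTop] fun x => x ^ b :=
    ((isBigO_const_mul_left_iff hc).1 h).trans_isLittleO (isLittleO_rpow_rpow hab)
  refine isLittleO_irrefl (Eventually.frequently ?_) hself
  filter_upwards [eventually_gt_atTop 0] with x hx
  exact (Real.rpow_pos_of_pos hx b).ne'

section AxiomA

variable {G : Type*} [CommMonoid G] (S : ArithmeticalSemigroup G) {κ c K r θ₀ : ℝ}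

lemma axiomA_of_abs_count_sub_le (hκ : 0 < κ) (hr0 : 0 < r) (hr1 : r < 1) (hθ₀ : θ₀ ≤ r)
    (hN : ∀ x : ℝ, 1 ≤ x → |(S.count x : ℝ) - κ * x - c * x ^ r| ≤ K * x ^ θ₀) :
    S.AxiomA κ r := by
  have hK : 0 ≤ K := by simpa using (abs_nonneg _).trans (hN 1 le_rfl)
  refine ⟨hκ, hr0, hr1, K + κ + |c|, fun x hx => ?_⟩
  calc |(S.count x : ℝ) - κ * (x - 1)|
      = |(S.count x - κ * x - c * x ^ r) + (κ + c * x ^ r)| := by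
        congr 1
        ring
    _ ≤ K * x ^ θ₀ + (κ + |c| * x ^ r) := by
        refine (abs_add_le _ _).trans (add_le_add (hN x hx) ((abs_add_le _ _).trans_eq ?_))
        rw [abs_of_pos hκ, abs_mul, abs_of_pos (Real.rpow_pos_of_pos (one_pos.trans_le hx) r)]
    _ ≤ K * x ^ r + (κ * x ^ r + |c| * x ^ r) := by
        gcongr
        exact le_mul_of_one_le_right hκ.le (Real.one_le_rpow hx hr0.le)
    _ = (K + κ + |c|) * x ^ r := by ring

lemma le_of_axiomA (hc : c ≠ 0) (hr1 : r < 1) (hθ₀ : θ₀ < r)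
    (hN : ∀ x : ℝ, 1 ≤ x → |(S.count x : ℝ) - κ * x - c * x ^ r| ≤ K * x ^ θ₀) {κ' θ : ℝ}
    (hA : S.AxiomA κ' θ) : r ≤ θ := by
  obtain ⟨-, hθ0, -, A, hA⟩ := hA
  by_contra! hθ
  set ρ := max θ₀ θ
  have hρr : ρ < r := max_lt hθ₀ hθ
  have hρ {f : ℝ → ℝ} {L t : ℝ} (ht : t ≤ ρ) (hf : ∀ x, 1 ≤ x → |f x| ≤ L * x ^ t) :
      f =O[atTop] fun x : ℝ => x ^ ρ := by
    refine .trans (.of_bound L ?_) (.of_bound 1 ?_) (g := fun x : ℝ => x ^ t)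
    · filter_upwards [eventually_ge_atTop 1] with x hx
      rw [Real.norm_of_nonneg (Real.rpow_nonneg (by linarith) t)]
      exact hf x hx
    · filter_upwards [eventually_ge_atTop 1] with x hx
      rw [Real.norm_of_nonneg (by positivity), Real.norm_of_nonneg (by positivity), one_mul]
      exact Real.rpow_le_rpow_of_exponent_le hx ht
  have hsum : (fun x => (κ - κ') * x + c * x ^ r) =O[atTop] fun x : ℝ => x ^ ρ := by
    have hconst : (fun _ : ℝ => κ') =O[atTop] fun x : ℝ => x ^ ρ :=
      hρ (le_max_of_le_right hθ0.le) fun x _ => by rw [Real.rpow_zero, mul_one]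
    refine (((hρ (le_max_right _ _) hA).sub (hρ (le_max_left _ _) hN)).sub hconst).congr_left ?_
    exact fun x => by ring
  have hκ : κ - κ' = 0 := by
    refine eq_zero_of_isBigO_rpow hr1 ?_
    have hr : (fun x : ℝ => c * x ^ r) =O[atTop] fun x => x ^ r :=
      (isBigO_refl _ _).const_mul_left c
    refine ((hsum.trans (isLittleO_rpow_rpow hρr).isBigO).sub hr).congr_left fun x => ?_
    rw [Real.rpow_one, add_sub_cancel_right]
  refine hc (eq_zero_of_isBigO_rpow hρr (hsum.congr_left fun x => ?_))
  rw [hκ, zero_mul, zero_add]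

end AxiomA

/-! ### The semigroup with one prime in each block -/

namespace UnitPartition

variable {q : ℝ → ℝ} {y : ℕ → ℝ} {C : ℝ} (hq : UnitPartition q y C) {lam : ℕ → ℝ}
  (hlam : ∀ j, lam j ∈ Set.Icc (y j) (y (j + 1))) (e : Nat.Primes ≃ ℕ)

include hq hlam

lemma lam_pos (j : ℕ) : 0 < lam j := (hq.y_pos j).trans_le (hlam j).1

lemma finite_lam_apply_le (Y : ℝ) : {p | lam (e p) ≤ Y}.Finite :=
  (hq.finite_lam_le hlam Y).preimage e.injective.injOn

/-- The semigroup whose primes have the norms `exp (lam j)`. Its elements are indexed by `ℕ+`, the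
`j`-th prime being the rational prime that `e` sends to `j`. -/
noncomputable def semigroup : ArithmeticalSemigroup ℕ+ :=
  weightedSemigroup (fun p => lam (e p)) (fun p => hq.lam_pos hlam (e p))
    (hq.finite_lam_apply_le hlam e)

lemma summable_exp_lam {a : ℝ} (ha : 1 < a) : Summable fun j => Real.exp (-a * lam j) := by
  refine (hq.summable_exp ha).of_nonneg_of_le (fun _ => (Real.exp_pos _).le) fun j => ?_
  exact Real.exp_le_exp.2 (mul_le_mul_of_nonpos_left (hlam j).1 (by linarith))

lemma hasSum_exp_logSize_lam {s : ℂ} (hs : 1 < s.re) :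
    HasSum (fun n => exp (-s * logSize (fun p => lam (e p)) n))
      (exp (∑' j, -log (1 - exp (-s * lam j)))) := by
  have := hasSum_exp_logSize (fun p => hq.lam_pos hlam (e p)) (one_pos.trans hs)
    (e.summable_iff.2 (hq.summable_exp_lam hlam hs))
  rwa [e.tsum_eq fun j => -log (1 - exp (-s * lam j))] at this

lemma abs_psi_semigroup_sub_le {x : ℝ} (hx1 : 1 ≤ x) (hx : y 0 ≤ Real.log x) :
    |(hq.semigroup hlam e).psi x - ∫ τ in (y 0)..(Real.log x), τ * q τ| ≤
      (4 + C * Real.exp (Real.log x / 2)) * Real.log x := by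
  have hfin := hq.finite_lam_apply_le hlam e
  have hsum : ∑ p ∈ (hfin (Real.log x)).toFinset, lam (e p) =
      ∑ j ∈ (hq.finite_lam_le hlam (Real.log x)).toFinset, lam j :=
    Finset.sum_equiv e (fun p => by simp) fun p _ => rfl
  have hcard : (hfin (Real.log x / 2)).toFinset.card =
      (hq.finite_lam_le hlam (Real.log x / 2)).toFinset.card :=
    Finset.card_equiv e fun p => by simp
  have hprimes := (abs_psi_sub_sum_prime_le (fun p => hq.lam_pos hlam (e p)) hfin hx1).trans
    (mul_le_mul_of_nonneg_right (hcard ▸ hq.card_lam_le hlam (Real.log x / 2))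
      (Real.log_nonneg hx1))
  calc |(hq.semigroup hlam e).psi x - ∫ τ in (y 0)..(Real.log x), τ * q τ|
      ≤ (C * Real.exp (Real.log x / 2) + 1) * Real.log x + 3 * Real.log x :=
        (abs_sub_le _ _ _).trans
          (add_le_add hprimes (hsum ▸ hq.abs_sum_lam_sub_integral_le hlam hx))
    _ = (4 + C * Real.exp (Real.log x / 2)) * Real.log x := by ring

variable {r BW : ℝ} {W : ℂ → ℂ} (hW : RegularPart q y r BW W)

include hW

lemma isZeta_semigroup (hr : 1 / 2 < r) : (hq.semigroup hlam e).IsZeta r fun s =>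
    s ^ 2 / ((s - 1) * (s - r)) * W s * exp (∑' j, localLog q y j (lam j) s) := by
  constructor
  · have hsub : {s : ℂ | r < s.re ∧ s ≠ 1} ⊆ {s : ℂ | 1 / 2 < s.re} :=
      fun s (hs : r < s.re ∧ s ≠ 1) => hr.trans hs.1
    refine .mul (.mul (.div (by fun_prop) (by fun_prop) fun s hs => mul_ne_zero ?_ ?_)
      (hW.differentiableOn.mono hsub)) ((hq.differentiableOn_tsum_localLog hlam).mono hsub).cexp
    · exact sub_ne_zero.2 hs.2
    · exact sub_ne_zero.2 fun h => hs.1.ne' (by rw [h, ofReal_re])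
  · intro s hs
    have hsum := hq.hasSum_exp_logSize_lam hlam e hs
    rw [hq.exp_tsum_log hlam hs, hW.exp_tsum_block s hs, mul_comm] at hsum
    refine hsum.congr_fun fun n => ?_
    rw [semigroup, weightedSemigroup_norm, ofReal_exp, cpow_def_of_ne_zero (exp_ne_zero _),
      ← ofReal_exp, ← ofReal_log (Real.exp_pos _).le, Real.log_exp, mul_comm]

/-- The constants `κ` and `c` are the residues of the zeta function at `1` and at `r`, the latter
divided by `r`. -/
lemma exists_count_semigroup_asymptotic {w₁ wr : ℝ} (hw₁ : W (1 : ℝ) = w₁) (hwr : W r = wr)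
    (hw₁0 : 0 < w₁) (hwr0 : wr ≠ 0) {σ η Λ B : ℝ} (hσ : 1 / 2 < σ) (hσr : σ < r) (hr : r < 1)
    (hη : 0 < η) (hη1 : 2 * η < 1) (hΛ : η * (Λ - 1) = 1) (hB : 0 ≤ B)
    (hmom : ∀ J : ℕ, ∫⁻ t : ℝ, ENNReal.ofReal ((1 + t ^ 2)⁻¹ *
        Real.exp (Λ * (∑ j ∈ Finset.range J, localLog q y j (lam j) (σ + t * I)).re)) ≤
          ENNReal.ofReal B) :
    ∃ κ c K : ℝ, 0 < κ ∧ c ≠ 0 ∧ ∀ x : ℝ, 1 ≤ x →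
      |((hq.semigroup hlam e).count x : ℝ) - κ * x - c * x ^ r| ≤ K * x ^ (σ + η) := by
  have hr0 : 0 < r := by linarith
  have h1r : 0 < 1 - r := sub_pos.2 hr
  obtain ⟨b₁, hb₁0, hb₁⟩ := hq.exp_tsum_localLog_ofReal hlam (x := 1) (by norm_num)
  obtain ⟨br, hbr0, hbr⟩ := hq.exp_tsum_localLog_ofReal hlam (x := r) (by linarith)
  have hsummable : Summable fun n => Real.exp (-2 * logSize (fun p => lam (e p)) n) := by
    have := (hq.hasSum_exp_logSize_lam hlam e (s := 2) (by norm_num)).summable.norm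
    simpa only [norm_exp_neg_mul, re_ofNat] using this
  obtain ⟨K, hK⟩ := hq.exists_norm_tsum_ramp_sub_le hlam hW one_lt_two hsummable
    (fun s hs => hq.hasSum_exp_logSize_lam hlam e (hs ▸ one_lt_two)) hσ hσr hr hη hη1 hΛ hB hmom
  have hsmooth (h v : ℝ) (hh : 0 < h) (hh1 : h ≤ 1) :
      |∑' n, ramp h (v - logSize (fun p => lam (e p)) n) -
        (w₁ * b₁ / (1 - r) * expAverage 1 h v + -(r * (wr * br / (1 - r))) * expAverage r h v)| ≤
        K * (Real.exp (σ * v) * h ^ (-(2 * η))) := by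
    refine le_of_eq_of_le ?_ (hK h v hh hh1)
    rw [hw₁, hwr, hb₁, hbr, rampKernel_ofReal one_ne_zero, rampKernel_ofReal hr0.ne',
      ← Real.norm_eq_abs, ← Complex.norm_real]
    congr 1
    push_cast
    ring
  obtain ⟨K', hK'⟩ := exists_abs_sub_le_of_smoothed hσ.le hr0 hr.le hη.le hsmooth
    (fun x h hx hh => count_le_tsum_ramp (fun p => hq.lam_pos hlam (e p))
      (hq.finite_lam_apply_le hlam e) hx hh)
    (fun x h hx hh => tsum_ramp_le_count _ _ hx hh)
  have hc : wr * br / (1 - r) ≠ 0 := div_ne_zero (mul_ne_zero hwr0 hbr0.ne') h1r.ne'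
  exact ⟨_, _, K', by positivity, neg_ne_zero.2 (mul_ne_zero hr0.ne' hc), hK'⟩

omit hlam in
lemma exists_arithmeticalSemigroup {w₁ wr : ℝ} (hw₁ : W (1 : ℝ) = w₁) (hwr : W r = wr)
    (hw₁0 : 0 < w₁) (hwr0 : wr ≠ 0) (hr : 1 / 2 < r) (hr1 : r < 1) :
    ∃ S : ArithmeticalSemigroup ℕ+, (∃ κ : ℝ, S.AxiomA κ r) ∧
      (∀ κ θ : ℝ, S.AxiomA κ θ → r ≤ θ) ∧
      (∃ Q : ℂ → ℂ, S.IsZeta r fun s => s ^ 2 / ((s - 1) * (s - r)) * W s * Q s) ∧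
      ∀ x : ℝ, 1 ≤ x → y 0 ≤ Real.log x → |S.psi x - ∫ τ in (y 0)..(Real.log x), τ * q τ| ≤
        (4 + C * Real.exp (Real.log x / 2)) * Real.log x := by
  obtain ⟨σ, hσ, hσr⟩ := exists_between hr
  set η := (r - σ) / 2 with hη
  have hη0 : 0 < η := by linarith
  have hΛ : η * ((1 + η⁻¹) - 1) = 1 := by rw [add_sub_cancel_left, mul_inv_cancel₀ hη0.ne']
  obtain ⟨lam, hlam, B, hB, hmom⟩ :=
    hq.exists_forall_lintegral_exp_sum_localLog_le (Λ := 1 + η⁻¹) (by positivity) hσ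
  obtain ⟨e⟩ : Nonempty (Nat.Primes ≃ ℕ) := nonempty_equiv_of_countable
  obtain ⟨κ, c, K, hκ, hc, hN⟩ := hq.exists_count_semigroup_asymptotic hlam e hW hw₁ hwr hw₁0 hwr0
    hσ hσr hr1 hη0 (by linarith) hΛ hB hmom
  exact ⟨hq.semigroup hlam e,
    ⟨κ, axiomA_of_abs_count_sub_le _ hκ (by linarith) hr1 (by linarith) hN⟩,
    fun κ' θ hA => le_of_axiomA _ hc hr1 (by linarith) hN hA,
    ⟨_, hq.isZeta_semigroup hlam e hW hr⟩,
    fun x hx1 hx => hq.abs_psi_semigroup_sub_le hlam e hx1 hx⟩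

end UnitPartition

/-! ### Frullani's integral -/

/-- The logarithmic-scale density of a system of primes with zeta function `s / (s - a)`. -/
noncomputable def poleDensity (a : ℂ) (τ : ℝ) : ℂ := (exp (a * τ) - 1) / τ

lemma poleDensity_eq_integral (a : ℂ) {τ : ℝ} (hτ : τ ≠ 0) :
    poleDensity a τ = ∫ θ in Set.Ioc (0 : ℝ) 1, a * exp (a * τ * θ) := by
  have hτ' : (τ : ℂ) ≠ 0 := ofReal_ne_zero.2 hτ
  rw [← intervalIntegral.integral_of_le zero_le_one, intervalIntegral.integral_const_mul]
  rcases eq_or_ne a 0 with rfl | ha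
  · simp [poleDensity]
  · rw [integral_exp_mul_complex (mul_ne_zero ha hτ'), poleDensity, ofReal_one, ofReal_zero,
      mul_one, mul_zero, exp_zero, ← mul_div_assoc, mul_div_mul_left _ _ ha]

lemma integral_div_sub_mul {a s : ℂ} (hs : 0 < s.re) (hsa : a.re < s.re) :
    ∫ θ in Set.Ioc (0 : ℝ) 1, a / (s - a * θ) = log s - log (s - a) := by
  rw [← intervalIntegral.integral_of_le zero_le_one]
  have hre : ∀ θ ∈ Set.uIcc (0 : ℝ) 1, 0 < (s - a * θ).re := by
    intro θ hθ
    rw [Set.uIcc_of_le zero_le_one] at hθ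
    rw [sub_re, re_mul_ofReal]
    rcases hθ.1.eq_or_lt with rfl | hθ0
    · simpa using hs
    · linarith [mul_pos hθ0 (sub_pos.2 hsa), mul_nonneg (sub_nonneg.2 hθ.2) hs.le]
  have hderiv : ∀ θ ∈ Set.uIcc (0 : ℝ) 1,
      HasDerivAt (fun θ : ℝ => -log (s - a * θ)) (a / (s - a * θ)) θ := by
    intro θ hθ
    have hlin : HasDerivAt (fun θ : ℝ => s - a * θ) (-(a * 1)) θ :=
      ((hasDerivAt_id θ).ofReal_comp.const_mul a).const_sub s
    refine (hlin.clog_real (Or.inl (hre θ hθ))).neg.congr_deriv ?_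
    ring
  rw [intervalIntegral.integral_eq_sub_of_hasDerivAt hderiv]
  · simp only [ofReal_one, ofReal_zero, mul_one, mul_zero, sub_zero]
    ring
  · refine (ContinuousOn.div (by fun_prop) (by fun_prop) fun θ hθ h0 => ?_).intervalIntegrable
    simpa [h0] using hre θ hθ

lemma min_le_re_sub_mul (a s : ℂ) {θ : ℝ} (hθ : θ ∈ Set.Ioc (0 : ℝ) 1) :
    min s.re (s.re - a.re) ≤ (s - a * θ).re := by
  rw [sub_re, re_mul_ofReal]
  nlinarith [hθ.1, hθ.2, min_le_left s.re (s.re - a.re), min_le_right s.re (s.re - a.re)]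

section Frullani

variable {a s : ℂ} (hs : 0 < s.re) (hsa : a.re < s.re)

include hs hsa

lemma integrable_exp_neg_sub_mul :
    Integrable (Function.uncurry fun τ θ : ℝ => a * exp (-(s - a * θ) * τ))
      ((volume.restrict (Set.Ioi (0 : ℝ))).prod (volume.restrict (Set.Ioc (0 : ℝ) 1))) := by
  set c := min s.re (s.re - a.re)
  have hc : 0 < c := lt_min hs (sub_pos.2 hsa)
  have hdom : Integrable (fun z : ℝ × ℝ => (‖a‖ * Real.exp (-c * z.1)) * (1 : ℝ))
      ((volume.restrict (Set.Ioi (0 : ℝ))).prod (volume.restrict (Set.Ioc (0 : ℝ) 1))) :=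
    .mul_prod ((integrableOn_exp_mul_Ioi (neg_neg_of_pos hc) 0).const_mul _) (integrable_const _)
  refine hdom.mono' (Continuous.aestronglyMeasurable (by fun_prop)) ?_
  rw [Measure.prod_restrict]
  refine (ae_restrict_iff' (measurableSet_Ioi.prod measurableSet_Ioc)).2 (ae_of_all _ ?_)
  rintro ⟨τ, θ⟩ ⟨hτ, hθ⟩
  have hτ : 0 < τ := hτ
  have := min_le_re_sub_mul a s hθ
  rw [Function.uncurry_apply_pair, norm_mul, norm_exp_neg_mul, mul_one]
  gcongr

omit hs hsa in
lemma integral_exp_neg_sub_mul (a s : ℂ) {τ : ℝ} (hτ : τ ∈ Set.Ioi 0) :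
    ∫ θ in Set.Ioc (0 : ℝ) 1, a * exp (-(s - a * θ) * τ) = exp (-s * τ) * poleDensity a τ := by
  rw [poleDensity_eq_integral a (ne_of_gt hτ), ← integral_const_mul]
  congr 1 with θ
  rw [mul_left_comm, ← exp_add]
  ring_nf

lemma integrableOn_exp_neg_mul_poleDensity :
    IntegrableOn (fun τ : ℝ => exp (-s * τ) * poleDensity a τ) (Set.Ioi 0) :=
  (integrable_exp_neg_sub_mul hs hsa).integral_prod_left.congr
    ((ae_restrict_iff' measurableSet_Ioi).2 (ae_of_all _ fun _ => integral_exp_neg_sub_mul a s))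

lemma exp_integral_exp_neg_mul_poleDensity :
    exp (∫ τ in Set.Ioi (0 : ℝ), exp (-s * τ) * poleDensity a τ) = s / (s - a) := by
  have hinner : ∀ θ ∈ Set.Ioc (0 : ℝ) 1,
      ∫ τ in Set.Ioi (0 : ℝ), a * exp (-(s - a * θ) * τ) = a / (s - a * θ) := by
    intro θ hθ
    have hre : 0 < (s - a * θ).re :=
      (lt_min hs (sub_pos.2 hsa)).trans_le (min_le_re_sub_mul a s hθ)
    rw [integral_const_mul, integral_exp_mul_complex_Ioi (by rwa [neg_re, neg_lt_zero]),
      ofReal_zero, mul_zero, exp_zero, neg_div_neg_eq, mul_one_div]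
  have hs0 : s ≠ 0 := by
    rintro rfl
    exact hs.false
  have hsa0 : s - a ≠ 0 := sub_ne_zero.2 fun h => hsa.ne (congrArg re h.symm)
  rw [← setIntegral_congr_fun measurableSet_Ioi fun _ => integral_exp_neg_sub_mul a s,
    integral_integral_swap (integrable_exp_neg_sub_mul hs hsa),
    setIntegral_congr_fun measurableSet_Ioc hinner, integral_div_sub_mul hs hsa, exp_sub,
    exp_log hs0, exp_log hsa0]

end Frullani

lemma intervalIntegrable_poleDensity (a : ℂ) {L : ℝ} (hL : 0 ≤ L) :
    IntervalIntegrable (poleDensity a) volume 0 L := by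
  set s : ℂ := ((|a.re| + 1 : ℝ) : ℂ)
  have hs : s.re = |a.re| + 1 := ofReal_re _
  have hinteg := integrableOn_exp_neg_mul_poleDensity (a := a) (s := s)
    (by rw [hs]; positivity) (by rw [hs]; linarith [le_abs_self a.re])
  have hweighted : IntervalIntegrable (fun τ : ℝ => exp (-s * τ) * poleDensity a τ) volume 0 L :=
    (intervalIntegrable_iff_integrableOn_Ioc_of_le hL).2 (hinteg.mono_set Set.Ioc_subset_Ioi_self)
  refine (hweighted.continuousOn_mul (g := fun τ : ℝ => exp (s * τ)) (by fun_prop)).congr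
    fun τ _ => ?_
  rw [← mul_assoc, ← exp_add, neg_mul, add_neg_cancel, exp_zero, one_mul]

/-! ### Intervals of mass one -/

lemma exists_integral_eq_one {q : ℝ → ℝ} {a c : ℝ} (hq : ContinuousOn q (Set.Ici a)) (hc : 0 < c)
    (hlow : ∀ τ, a ≤ τ → c ≤ q τ) : ∃ b, a < b ∧ ∫ τ in a..b, q τ = 1 := by
  have hle : a ≤ a + c⁻¹ := le_add_of_nonneg_right (inv_nonneg.2 hc.le)
  have hinteg : IntervalIntegrable q volume a (a + c⁻¹) :=
    (hq.mono (by rw [Set.uIcc_of_le hle]; exact Set.Icc_subset_Ici_self)).intervalIntegrable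
  have hcont : ContinuousOn (fun b => ∫ τ in a..b, q τ) (Set.Icc a (a + c⁻¹)) := by
    simpa only [Set.uIcc_of_le hle] using
      intervalIntegral.continuousOn_primitive_interval' hinteg Set.left_mem_uIcc
  have hbig : 1 ≤ ∫ τ in a..(a + c⁻¹), q τ := by
    have := intervalIntegral.integral_mono_on hle intervalIntegrable_const hinteg
      fun τ hτ => hlow τ hτ.1
    rwa [intervalIntegral.integral_const, smul_eq_mul, add_sub_cancel_left,
      inv_mul_cancel₀ hc.ne'] at this
  obtain ⟨b, hb, hb1⟩ := intermediate_value_Icc hle hcont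
    (show (1 : ℝ) ∈ Set.Icc _ _ from ⟨by simp only [intervalIntegral.integral_same, zero_le_one],
      hbig⟩)
  refine ⟨b, lt_of_le_of_ne hb.1 ?_, hb1⟩
  rintro rfl
  exact zero_ne_one (intervalIntegral.integral_same.symm.trans hb1)

lemma exists_unitPartition {q : ℝ → ℝ} {L C c : ℝ} (hL : 2 ≤ L) (hqm : Measurable q)
    (hqc : ContinuousOn q (Set.Ici L)) (hc : 0 < c) (hlow : ∀ τ, L ≤ τ → c ≤ q τ)
    (hup : ∀ τ, L ≤ τ → q τ ≤ C * Real.exp τ) :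
    ∃ y : ℕ → ℝ, y 0 = L ∧ UnitPartition q y C := by
  have hnext : ∀ a : Set.Ici L, ∃ b : Set.Ici L, a.1 < b.1 ∧ ∫ τ in a.1..b.1, q τ = 1 := by
    rintro ⟨a, ha⟩
    have ha : L ≤ a := ha
    obtain ⟨b, hab, hb⟩ := exists_integral_eq_one (hqc.mono (Set.Ici_subset_Ici.2 ha)) hc
      fun τ hτ => hlow τ (ha.trans hτ)
    exact ⟨⟨b, ha.trans hab.le⟩, hab, hb⟩
  choose f hlt hinteg using hnext
  set z : ℕ → Set.Ici L := fun n => f^[n] ⟨L, Set.self_mem_Ici⟩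
  have hsucc (n : ℕ) : z (n + 1) = f (z n) := Function.iterate_succ_apply' f n _
  exact ⟨fun n => z n, rfl, hL, strictMono_nat_of_lt_succ fun n => by rw [hsucc]; exact hlt _, hqm,
    hqc, fun τ hτ => hc.le.trans (hlow τ hτ), hup, fun n => by rw [hsucc]; exact hinteg _⟩

lemma UnitPartition.tsum_block {q : ℝ → ℝ} {y : ℕ → ℝ} {C : ℝ} (hq : UnitPartition q y C) {s : ℂ}
    (hs : 1 < s.re) (hinteg : IntegrableOn (fun τ : ℝ => exp (-s * τ) * q τ) (Set.Ioi (y 0))) :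
    ∑' j, block q y j s = ∫ τ in Set.Ioi (y 0), exp (-s * τ) * q τ := by
  refine tendsto_nhds_unique (hq.summable_block hs).hasSum.tendsto_sum_nat
    ((intervalIntegral_tendsto_integral_Ioi (y 0) hinteg hq.tendsto_y).congr fun n => ?_)
  refine (intervalIntegral.sum_integral_adjacent_intervals fun k _ => ?_).symm
  exact (intervalIntegrable_iff_integrableOn_Ioc_of_le (hq.y_le_succ k)).2
    (hinteg.mono_set fun x hx => (hq.y_zero_le k).trans_lt hx.1)

/-! ### A density with prescribed poles and zeros -/

/-- The density of the von Mangoldt weights on the logarithmic scale for a zeta function with simple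
poles at `1` and `r`, and simple zeros at `ρ` and `conj ρ` for `ρ ∈ T`. -/
noncomputable def psiDensity (r : ℝ) (T : Finset ℂ) (τ : ℝ) : ℝ :=
  (Real.exp τ - 1) + (Real.exp (r * τ) - 1) - ∑ ρ ∈ T, 2 * ((exp (ρ * τ)).re - 1)

/-- The density of primes on the logarithmic scale corresponding to `psiDensity`. -/
noncomputable def primeDensity (r : ℝ) (T : Finset ℂ) (τ : ℝ) : ℝ := psiDensity r T τ / τ

/-- What remains of the zeta function with prime density `primeDensity r T` on `(L, ∞)` after
`s ^ 2 / ((s - 1) * (s - r))` is split off. -/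
noncomputable def regularFactor (r : ℝ) (T : Finset ℂ) (L : ℝ) (s : ℂ) : ℂ :=
  (∏ ρ ∈ T, ((s - ρ) / s) * ((s - conj ρ) / s)) *
    exp (-∫ τ in (0 : ℝ)..L, exp (-s * τ) * primeDensity r T τ)

section PrimeDensity

variable {r b L : ℝ} {T : Finset ℂ}

lemma continuous_psiDensity : Continuous (psiDensity r T) := by
  have hterm : ∀ ρ ∈ T, Continuous fun τ : ℝ => 2 * ((exp (ρ * τ)).re - 1) := fun ρ _ =>
    continuous_const.mul ((continuous_re.comp (by fun_prop)).sub continuous_const)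
  exact Continuous.sub (by fun_prop) (continuous_finsetSum _ hterm)

lemma measurable_primeDensity : Measurable (primeDensity r T) :=
  continuous_psiDensity.measurable.div measurable_id

lemma poleDensity_add_poleDensity_conj (ρ : ℂ) (τ : ℝ) :
    poleDensity ρ τ + poleDensity (conj ρ) τ = (2 * ((exp (ρ * τ)).re - 1) : ℝ) / (τ : ℂ) := by
  have hconj : exp (conj ρ * τ) = conj (exp (ρ * τ)) := by rw [← exp_conj, map_mul, conj_ofReal]
  rw [poleDensity, poleDensity, hconj, ← add_div, ofReal_mul, ofReal_sub, re_eq_add_conj]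
  congr 1
  push_cast
  ring

lemma primeDensity_eq_poleDensity (r : ℝ) (T : Finset ℂ) (τ : ℝ) :
    (primeDensity r T τ : ℂ) = poleDensity 1 τ + poleDensity r τ -
      ∑ ρ ∈ T, (poleDensity ρ τ + poleDensity (conj ρ) τ) := by
  rw [Finset.sum_congr rfl fun ρ _ => poleDensity_add_poleDensity_conj ρ τ, ← Finset.sum_div,
    primeDensity, psiDensity, poleDensity, poleDensity]
  push_cast
  rw [one_mul]
  ring

lemma intervalIntegrable_primeDensity (hL : 0 ≤ L) :
    IntervalIntegrable (fun τ => (primeDensity r T τ : ℂ)) volume 0 L := by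
  have hzeros := IntervalIntegrable.sum T (μ := volume) (a := 0) (b := L)
    (f := fun ρ τ => poleDensity ρ τ + poleDensity (conj ρ) τ) fun ρ _ =>
      (intervalIntegrable_poleDensity ρ hL).add (intervalIntegrable_poleDensity (conj ρ) hL)
  rw [Finset.sum_fn] at hzeros
  simp_rw [primeDensity_eq_poleDensity]
  exact ((intervalIntegrable_poleDensity 1 hL).add (intervalIntegrable_poleDensity r hL)).sub hzeros

section Laplace

variable (hr1 : r < 1) (hT : ∀ ρ ∈ T, ρ.re < 1) {s : ℂ} (hs : 1 < s.re)

lemma exp_neg_mul_primeDensity (r : ℝ) (T : Finset ℂ) (s : ℂ) (τ : ℝ) :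
    exp (-s * τ) * primeDensity r T τ =
      (exp (-s * τ) * poleDensity 1 τ + exp (-s * τ) * poleDensity r τ) -
        ∑ ρ ∈ T, (exp (-s * τ) * poleDensity ρ τ + exp (-s * τ) * poleDensity (conj ρ) τ) := by
  rw [primeDensity_eq_poleDensity, mul_sub, mul_add, Finset.mul_sum]
  simp only [mul_add]

include hs

lemma integrableOn_poleDensity_of_re_le_one {a : ℂ} (ha : a.re ≤ 1) :
    IntegrableOn (fun τ : ℝ => exp (-s * τ) * poleDensity a τ) (Set.Ioi 0) :=
  integrableOn_exp_neg_mul_poleDensity (one_pos.trans hs) (ha.trans_lt hs)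

lemma exp_integral_poleDensity_of_re_le_one {a : ℂ} (ha : a.re ≤ 1) :
    exp (∫ τ in Set.Ioi (0 : ℝ), exp (-s * τ) * poleDensity a τ) = s / (s - a) :=
  exp_integral_exp_neg_mul_poleDensity (one_pos.trans hs) (ha.trans_lt hs)

include hT

lemma integrableOn_zeroDensity {ρ : ℂ} (hρ : ρ ∈ T) : IntegrableOn (fun τ : ℝ =>
    exp (-s * τ) * poleDensity ρ τ + exp (-s * τ) * poleDensity (conj ρ) τ) (Set.Ioi 0) :=
  (integrableOn_poleDensity_of_re_le_one hs (hT ρ hρ).le).add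
    (integrableOn_poleDensity_of_re_le_one hs (by rw [conj_re]; exact (hT ρ hρ).le))

lemma exp_integral_zeroDensity {ρ : ℂ} (hρ : ρ ∈ T) :
    exp (∫ τ in Set.Ioi (0 : ℝ),
      (exp (-s * τ) * poleDensity ρ τ + exp (-s * τ) * poleDensity (conj ρ) τ)) =
      (((s - ρ) / s) * ((s - conj ρ) / s))⁻¹ := by
  have hre : ρ.re ≤ 1 := (hT ρ hρ).le
  have hre' : (conj ρ).re ≤ 1 := by rwa [conj_re]
  rw [integral_add (integrableOn_poleDensity_of_re_le_one hs hre)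
    (integrableOn_poleDensity_of_re_le_one hs hre'), exp_add,
    exp_integral_poleDensity_of_re_le_one hs hre, exp_integral_poleDensity_of_re_le_one hs hre',
    mul_inv, inv_div, inv_div]

include hr1

lemma integrableOn_exp_neg_mul_primeDensity :
    IntegrableOn (fun τ : ℝ => exp (-s * τ) * primeDensity r T τ) (Set.Ioi 0) := by
  simp_rw [exp_neg_mul_primeDensity]
  exact ((integrableOn_poleDensity_of_re_le_one hs one_re.le).add
    (integrableOn_poleDensity_of_re_le_one hs (by rw [ofReal_re]; exact hr1.le))).sub
    (integrable_finsetSum T fun _ => integrableOn_zeroDensity hT hs)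

lemma exp_integral_exp_neg_mul_primeDensity :
    exp (∫ τ in Set.Ioi (0 : ℝ), exp (-s * τ) * primeDensity r T τ) =
      s / (s - 1) * (s / (s - r)) * ∏ ρ ∈ T, ((s - ρ) / s) * ((s - conj ρ) / s) := by
  have hr : (r : ℂ).re ≤ 1 := hr1.le
  have hint1 := integrableOn_poleDensity_of_re_le_one hs one_re.le
  have hintr := integrableOn_poleDensity_of_re_le_one hs hr
  have hzeros : ∀ ρ ∈ T, _ := fun ρ hρ => integrableOn_zeroDensity hT hs hρ
  simp_rw [exp_neg_mul_primeDensity]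
  rw [integral_sub (hint1.fun_add hintr) (integrable_finsetSum T hzeros), integral_add hint1 hintr,
    integral_finsetSum T hzeros, exp_sub, exp_add,
    exp_integral_poleDensity_of_re_le_one hs one_re.le,
    exp_integral_poleDensity_of_re_le_one hs hr, exp_sum,
    Finset.prod_congr rfl fun _ hρ => exp_integral_zeroDensity hT hs hρ, Finset.prod_inv_distrib,
    div_inv_eq_mul]

lemma exp_integral_Ioi_primeDensity (hL : 0 ≤ L) :
    exp (∫ τ in Set.Ioi L, exp (-s * τ) * primeDensity r T τ) =
      s ^ 2 / ((s - 1) * (s - r)) * regularFactor r T L s := by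
  have hsplit := intervalIntegral.integral_Ioi_sub_Ioi
    (integrableOn_exp_neg_mul_primeDensity hr1 hT hs) hL
  rw [sub_eq_iff_eq_add', ← sub_eq_iff_eq_add] at hsplit
  rw [← hsplit, sub_eq_add_neg, exp_add, exp_integral_exp_neg_mul_primeDensity hr1 hT hs,
    regularFactor, ← mul_assoc, div_mul_div_comm, sq]

end Laplace

lemma differentiableOn_regularFactor (hL : 0 ≤ L) :
    DifferentiableOn ℂ (regularFactor r T L) {s | 1 / 2 < s.re} := by
  have hne : ∀ s ∈ {s : ℂ | 1 / 2 < s.re}, s ≠ 0 := by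
    rintro s (hs : 1 / 2 < s.re) rfl
    exact lt_asymm one_half_pos hs
  have hdiv (a : ℂ) : DifferentiableOn ℂ (fun s => (s - a) / s) {s : ℂ | 1 / 2 < s.re} :=
    .div (by fun_prop) (by fun_prop) hne
  exact (DifferentiableOn.fun_finsetProd fun ρ _ => (hdiv ρ).mul (hdiv (conj ρ))).mul
    (differentiable_integral_exp_mul
      (intervalIntegrable_primeDensity hL)).neg.cexp.differentiableOn

lemma norm_integral_exp_neg_mul_le {g : ℝ → ℂ} (hL : 0 ≤ L)
    (hg : IntervalIntegrable g volume 0 L) {s : ℂ} (hs : 0 ≤ s.re) :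
    ‖∫ τ in (0 : ℝ)..L, exp (-s * τ) * g τ‖ ≤ ∫ τ in (0 : ℝ)..L, ‖g τ‖ := by
  refine (intervalIntegral.norm_integral_le_integral_norm hL).trans ?_
  refine intervalIntegral.integral_mono_on hL
    (hg.continuousOn_mul (g := fun τ : ℝ => exp (-s * τ)) (by fun_prop)).norm hg.norm fun τ hτ => ?_
  rw [norm_mul, norm_exp_neg_mul]
  refine mul_le_of_le_one_left (norm_nonneg _) (Real.exp_le_one_iff.2 ?_)
  nlinarith [hτ.1]

lemma norm_sub_div_le {s : ℂ} (hs : 1 / 2 < s.re) (a : ℂ) : ‖(s - a) / s‖ ≤ 1 + 2 * ‖a‖ := by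
  have hnorm : 1 / 2 ≤ ‖s‖ := hs.le.trans (re_le_norm s)
  rw [norm_div, div_le_iff₀ (one_half_pos.trans_le hnorm)]
  nlinarith [norm_sub_le s a, norm_nonneg a]

lemma exists_norm_regularFactor_le (hL : 0 ≤ L) :
    ∃ B : ℝ, ∀ s : ℂ, 1 / 2 < s.re → ‖regularFactor r T L s‖ ≤ B := by
  refine ⟨(∏ ρ ∈ T, (1 + 2 * ‖ρ‖) * (1 + 2 * ‖conj ρ‖)) *
    Real.exp (∫ τ in (0 : ℝ)..L, ‖(primeDensity r T τ : ℂ)‖), fun s hs => ?_⟩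
  rw [regularFactor, norm_mul, norm_prod]
  gcongr with ρ
  · rw [norm_mul]
    gcongr
    exacts [norm_sub_div_le hs ρ, norm_sub_div_le hs (conj ρ)]
  · refine (norm_exp_le_exp_norm _).trans (Real.exp_le_exp.2 ?_)
    rw [norm_neg]
    exact norm_integral_exp_neg_mul_le hL (intervalIntegrable_primeDensity hL)
      (one_half_pos.trans hs).le

lemma exists_regularFactor_ofReal (hT : ∀ ρ ∈ T, ρ.im ≠ 0) {x : ℝ} (hx : 0 < x) :
    ∃ w : ℝ, 0 < w ∧ regularFactor r T L x = w := by
  refine ⟨(∏ ρ ∈ T, normSq ((x - ρ) / x)) *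
    Real.exp (-∫ τ in (0 : ℝ)..L, Real.exp (-x * τ) * primeDensity r T τ), ?_, ?_⟩
  · refine mul_pos (Finset.prod_pos fun ρ hρ => normSq_pos.2 (div_ne_zero ?_ ?_)) (Real.exp_pos _)
    · rintro h
      exact hT ρ hρ (sub_eq_zero.1 h ▸ ofReal_im x)
    · exact ofReal_ne_zero.2 hx.ne'
  · rw [regularFactor, ofReal_mul, ofReal_prod, ofReal_exp, ofReal_neg,
      ← intervalIntegral.integral_ofReal]
    congr 1
    · refine Finset.prod_congr rfl fun ρ _ => ?_
      rw [normSq_eq_conj_mul_self, map_div₀, map_sub, conj_ofReal, mul_comm]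
    · push_cast
      rfl

lemma regularFactor_eq_zero {ρ : ℂ} (hρ : ρ ∈ T) : regularFactor r T L ρ = 0 := by
  rw [regularFactor, Finset.prod_eq_zero hρ (by rw [sub_self, zero_div, zero_mul]), zero_mul]

lemma abs_re_exp_mul_le {ρ : ℂ} (hρ : ρ.re ≤ b) {τ : ℝ} (hτ : 0 ≤ τ) :
    |(exp (ρ * τ)).re| ≤ Real.exp (b * τ) := by
  refine (abs_re_le_norm _).trans ?_
  rw [norm_exp, re_mul_ofReal]
  gcongr

lemma eventually_half_le_primeDensity (hr : 0 ≤ r) (hb : b < 1) (hT : ∀ ρ ∈ T, ρ.re ≤ b) :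
    ∀ᶠ τ : ℝ in atTop, 1 / 2 ≤ primeDensity r T τ := by
  have hdecay : Tendsto (fun τ : ℝ => 2 * T.card * Real.exp (-(1 - b) * τ)) atTop (𝓝 0) := by
    simpa only [mul_zero, Function.comp_def, id] using (Real.tendsto_exp_atBot.comp
      (tendsto_id.const_mul_atTop_of_neg (neg_neg_of_pos (sub_pos.2 hb)))).const_mul
        (2 * T.card : ℝ)
  filter_upwards [hdecay.eventually_le_const (show (0 : ℝ) < 1 / 4 by norm_num),
    eventually_ge_atTop 4] with τ hτb hτ
  have hτ0 : 0 < τ := by linarith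
  have hsum : ∑ ρ ∈ T, 2 * ((exp (ρ * τ)).re - 1) ≤ T.card * (2 * Real.exp (b * τ)) := by
    refine Finset.sum_le_card_nsmul _ _ _ (fun ρ hρ => ?_) |>.trans_eq (nsmul_eq_mul _ _)
    linarith [(abs_le.1 (abs_re_exp_mul_le (hT ρ hρ) hτ0.le)).2]
  have hsmall : T.card * (2 * Real.exp (b * τ)) ≤ 1 / 4 * Real.exp τ := by
    have hsplit : Real.exp (b * τ) = Real.exp (-(1 - b) * τ) * Real.exp τ := by
      rw [← Real.exp_add]
      ring_nf
    rw [hsplit]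
    nlinarith [Real.exp_pos τ]
  have hexpr : 1 ≤ Real.exp (r * τ) := Real.one_le_exp (by positivity)
  rw [primeDensity, le_div_iff₀ hτ0, psiDensity]
  linarith [Real.add_one_le_exp τ]

lemma primeDensity_le (hr1 : r ≤ 1) (hT : ∀ ρ ∈ T, ρ.re ≤ 1) {τ : ℝ} (hτ : 1 ≤ τ) :
    primeDensity r T τ ≤ (2 + 4 * T.card) * Real.exp τ := by
  have hτ0 : 0 < τ := by linarith
  have hexp : 1 ≤ Real.exp τ := Real.one_le_exp hτ0.le
  have hexpr : Real.exp (r * τ) ≤ Real.exp τ := Real.exp_le_exp.2 (by nlinarith)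
  have hsum : T.card * -(4 * Real.exp τ) ≤ ∑ ρ ∈ T, 2 * ((exp (ρ * τ)).re - 1) := by
    refine (nsmul_eq_mul _ _).symm.trans_le (Finset.card_nsmul_le_sum _ _ _ fun ρ hρ => ?_)
    have hre := (abs_le.1 (abs_re_exp_mul_le (hT ρ hρ) hτ0.le)).1
    rw [one_mul] at hre
    linarith
  rw [primeDensity, div_le_iff₀ hτ0, psiDensity]
  refine le_trans ?_ (le_mul_of_one_le_right (by positivity) hτ)
  linarith

end PrimeDensity

/-! ### Semigroups with prescribed zeros -/

section PrescribedZeros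

variable {r b : ℝ} {T : Finset ℂ}

lemma hasDerivAt_exp_mul_div {ρ : ℂ} (hρ : ρ ≠ 0) (t : ℝ) :
    HasDerivAt (fun t : ℝ => (exp (ρ * t) / ρ).re) (exp (ρ * t)).re t := by
  have hderiv : HasDerivAt (fun z : ℂ => exp (ρ * z) / ρ) (exp (ρ * t)) (t : ℂ) := by
    refine (((hasDerivAt_id (t : ℂ)).const_mul ρ).cexp.div_const ρ).congr_deriv ?_
    rw [mul_one, id, mul_div_cancel_right₀ _ hρ]
  exact hderiv.real_of_complex

lemma exists_integral_psiDensity_eq (hr : r ≠ 0) (hT : ∀ ρ ∈ T, ρ ≠ 0) (a : ℝ) :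
    ∃ c : ℝ, ∀ t : ℝ, ∫ τ in a..t, psiDensity r T τ = Real.exp t + Real.exp (r * t) / r -
      ∑ ρ ∈ T, 2 * (exp (ρ * t) / ρ).re + (2 * T.card - 2) * t - c := by
  refine ⟨_, fun t => intervalIntegral.integral_eq_sub_of_hasDerivAt (f := fun t : ℝ =>
    Real.exp t + Real.exp (r * t) / r - ∑ ρ ∈ T, 2 * (exp (ρ * t) / ρ).re + (2 * T.card - 2) * t)
    (fun t _ => ?_) (continuous_psiDensity.intervalIntegrable _ _)⟩
  have hzeros : HasDerivAt (fun t : ℝ => ∑ ρ ∈ T, 2 * (exp (ρ * t) / ρ).re)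
      (∑ ρ ∈ T, 2 * (exp (ρ * t)).re) t :=
    .fun_sum fun ρ hρ => (hasDerivAt_exp_mul_div (hT ρ hρ) t).const_mul 2
  have hpole : HasDerivAt (fun t : ℝ => Real.exp (r * t) / r) (Real.exp (r * t)) t := by
    refine (((hasDerivAt_id t).const_mul r).exp.div_const r).congr_deriv ?_
    rw [mul_one, id, mul_div_cancel_right₀ _ hr]
  refine ((((Real.hasDerivAt_exp t).add hpole).sub hzeros).add
    ((hasDerivAt_id t).const_mul (2 * (T.card : ℝ) - 2))).congr_deriv ?_
  simp only [psiDensity, mul_sub, Finset.sum_sub_distrib, Finset.sum_const, nsmul_eq_mul]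
  ring

lemma exists_unitPartition_primeDensity (hr : 0 ≤ r) (hr1 : r < 1) (hb : b < 1)
    (hT : ∀ ρ ∈ T, ρ.re ≤ b) :
    ∃ y : ℕ → ℝ, UnitPartition (primeDensity r T) y (2 + 4 * T.card) := by
  obtain ⟨L, hlow⟩ := eventually_atTop.1
    ((eventually_half_le_primeDensity hr hb hT).and (eventually_ge_atTop 2))
  have hL : 2 ≤ L := (hlow L le_rfl).2
  have hcont : ContinuousOn (primeDensity r T) (Set.Ici L) :=
    continuous_psiDensity.continuousOn.div continuousOn_id fun τ (hτ : L ≤ τ) =>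
      (two_pos.trans_le (hL.trans hτ)).ne'
  obtain ⟨y, -, hy⟩ := exists_unitPartition hL measurable_primeDensity hcont one_half_pos
    (fun τ hτ => (hlow τ hτ).1) fun τ hτ =>
      primeDensity_le hr1.le (fun ρ hρ => (hT ρ hρ).trans hb.le) (by linarith)
  exact ⟨y, hy⟩

lemma UnitPartition.exists_regularPart_regularFactor {y : ℕ → ℝ} {C : ℝ}
    (hq : UnitPartition (primeDensity r T) y C) (hr1 : r < 1) (hT : ∀ ρ ∈ T, ρ.re < 1) :
    ∃ B, RegularPart (primeDensity r T) y r B (regularFactor r T (y 0)) := by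
  have hy : 0 ≤ y 0 := two_pos.le.trans hq.two_le
  obtain ⟨B, hB⟩ := exists_norm_regularFactor_le (r := r) (T := T) hy
  refine ⟨B, differentiableOn_regularFactor hy, hB, fun s hs => ?_⟩
  rw [hq.tsum_block hs ((integrableOn_exp_neg_mul_primeDensity hr1 hT hs).mono_set
    (Set.Ioi_subset_Ioi hy)), exp_integral_Ioi_primeDensity hr1 hT hs hy]

lemma isBigO_log_rpow (hr : 0 < r) : Real.log =O[atTop] fun x : ℝ => x ^ r :=
  (isLittleO_log_rpow_atTop hr).isBigO

lemma isBigO_one_rpow (hr : 0 < r) : (fun _ : ℝ => (1 : ℝ)) =O[atTop] fun x : ℝ => x ^ r := by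
  simpa only [Real.rpow_zero] using (isLittleO_rpow_rpow hr).isBigO

lemma isBigO_exp_half_log_mul_log (hr : 1 / 2 < r) :
    (fun x : ℝ => Real.exp (Real.log x / 2) * Real.log x) =O[atTop] fun x : ℝ => x ^ r := by
  have hsqrt : (fun x : ℝ => x ^ (1 / 2 : ℝ) * Real.log x) =O[atTop]
      fun x : ℝ => x ^ (1 / 2 : ℝ) * x ^ (r - 1 / 2) :=
    (isBigO_refl _ _).mul (isBigO_log_rpow (sub_pos.2 hr))
  refine hsqrt.congr' ?_ ?_ <;> filter_upwards [eventually_gt_atTop 0] with x hx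
  · rw [Real.rpow_def_of_pos hx, mul_one_div]
  · rw [← Real.rpow_add hx, add_sub_cancel]

lemma isBigO_rpow_of_abs_le {f : ℝ → ℝ} {L C : ℝ} (hr : 1 / 2 < r)
    (hf : ∀ x, 1 ≤ x → L ≤ Real.log x →
      |f x| ≤ (4 + C * Real.exp (Real.log x / 2)) * Real.log x) :
    f =O[atTop] fun x : ℝ => x ^ r := by
  have hbound : (fun x => (4 + C * Real.exp (Real.log x / 2)) * Real.log x) =O[atTop]
      fun x : ℝ => x ^ r := by
    refine (((isBigO_log_rpow (by linarith)).const_mul_left 4).add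
      ((isBigO_exp_half_log_mul_log hr).const_mul_left C)).congr_left fun x => ?_
    ring
  refine IsBigO.trans (.of_norm_eventuallyLE ?_) hbound
  filter_upwards [eventually_ge_atTop 1, Real.tendsto_log_atTop.eventually_ge_atTop L]
    with x hx hxL using hf x hx hxL

lemma integral_mul_primeDensity {L t : ℝ} (hL : 0 < L) (ht : L ≤ t) :
    ∫ τ in L..t, τ * primeDensity r T τ = ∫ τ in L..t, psiDensity r T τ := by
  refine intervalIntegral.integral_congr fun τ hτ => mul_div_cancel₀ _ (hL.trans_le ?_).ne'
  rw [Set.uIcc_of_le ht] at hτ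
  exact hτ.1

lemma isBigO_integral_mul_primeDensity_sub (hr : 0 < r) (hT : ∀ ρ ∈ T, ρ ≠ 0) {L : ℝ}
    (hL : 0 < L) :
    (fun x : ℝ => (∫ τ in L..(Real.log x), τ * primeDensity r T τ) -
      (x - ∑ ρ ∈ T, 2 * (exp (ρ * Real.log x) / ρ).re)) =O[atTop] fun x : ℝ => x ^ r := by
  obtain ⟨c, hc⟩ := exists_integral_psiDensity_eq hr.ne' hT L
  refine ((((isBigO_refl (fun x : ℝ => x ^ r) atTop).const_mul_left r⁻¹).add
    ((isBigO_log_rpow hr).const_mul_left (2 * T.card - 2 : ℝ))).sub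
      ((isBigO_one_rpow hr).const_mul_left c)).congr' ?_ .rfl
  filter_upwards [eventually_gt_atTop 0, Real.tendsto_log_atTop.eventually_ge_atTop L]
    with x hx hxL
  rw [integral_mul_primeDensity hL hxL, hc, Real.exp_log hx, Real.rpow_def_of_pos hx,
    mul_comm (Real.log x) r]
  ring

end PrescribedZeros

theorem exists_arithmeticalSemigroup_of_zeros {r b : ℝ} (hr : 1 / 2 < r) (hr1 : r < 1) (hb : b < 1)
    (T : Finset ℂ) (hT : ∀ ρ ∈ T, ρ.re ≤ b) (hT0 : ∀ ρ ∈ T, ρ.im ≠ 0) :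
    ∃ S : ArithmeticalSemigroup ℕ+, (∃ κ, S.AxiomA κ r) ∧ (∀ κ θ, S.AxiomA κ θ → r ≤ θ) ∧
      (∀ ρ ∈ T, r < ρ.re → S.IsZetaZero r ρ) ∧
      (fun x : ℝ => S.Delta x + ∑ ρ ∈ T, 2 * (exp (ρ * Real.log x) / ρ).re) =O[atTop]
        fun x : ℝ => x ^ r := by
  have hr0 : 0 < r := one_half_pos.trans hr
  have hne (z : ℂ) (hz : z.im = 0) : ∀ ρ ∈ T, ρ ≠ z := fun ρ hρ h => hT0 ρ hρ (h ▸ hz)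
  obtain ⟨y, hq⟩ := exists_unitPartition_primeDensity hr0.le hr1 hb hT
  obtain ⟨B, hW⟩ := hq.exists_regularPart_regularFactor hr1 fun ρ hρ => (hT ρ hρ).trans_lt hb
  obtain ⟨w₁, hw₁0, hw₁⟩ := exists_regularFactor_ofReal (r := r) (L := y 0) hT0 one_pos
  obtain ⟨wr, hwr0, hwr⟩ := exists_regularFactor_ofReal (r := r) (L := y 0) hT0 hr0
  obtain ⟨S, hA, hopt, ⟨Q, hZ⟩, hψ⟩ :=
    hq.exists_arithmeticalSemigroup hW hw₁ hwr hw₁0 hwr0.ne' hr hr1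
  refine ⟨S, hA, hopt, fun ρ hρ hrρ => ⟨hrρ, hne 1 one_im ρ hρ, _, hZ, ?_⟩, ?_⟩
  · simp only [regularFactor_eq_zero hρ, mul_zero, zero_mul]
  have herror := isBigO_rpow_of_abs_le hr fun x hx hxL => hψ x hx hxL
  have hmain := isBigO_integral_mul_primeDensity_sub hr0 (hne 0 zero_im)
    (two_pos.trans_le hq.two_le)
  refine (herror.add hmain).congr_left fun x => ?_
  rw [ArithmeticalSemigroup.Delta]
  ring

/-! ### Rounding weights to a subset -/

/-- The error made in `∑ n ∈ s, p n * f n` by rounding the weights `p n` to `1` on `B` and to `0` on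
the rest of `s`. -/
noncomputable def roundingError {α : Type*} (p f : α → ℝ) (B s : Finset α) : ℝ :=
  ∑ n ∈ B, f n - ∑ n ∈ s, p n * f n

section Rounding

variable {α ι : Type*} {p f : α → ℝ} {B s : Finset α}

lemma roundingError_const_mul (l : ℝ) :
    roundingError p (fun n => l * f n) B s = l * roundingError p f B s := by
  simp only [roundingError, mul_left_comm _ l, ← Finset.mul_sum, mul_sub]

lemma roundingError_sub (g : α → ℝ) :
    roundingError p f B s - roundingError p g B s = roundingError p (fun n => f n - g n) B s := by
  simp only [roundingError, mul_sub, Finset.sum_sub_distrib]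
  ring

lemma roundingError_insert_insert [DecidableEq α] {m : α} (hB : m ∉ B) (hs : m ∉ s) :
    roundingError p f (insert m B) (insert m s) = roundingError p f B s + (1 - p m) * f m := by
  rw [roundingError, roundingError, Finset.sum_insert hB, Finset.sum_insert hs]
  ring

lemma roundingError_insert_right [DecidableEq α] {m : α} (hs : m ∉ s) :
    roundingError p f B (insert m s) = roundingError p f B s + -p m * f m := by
  rw [roundingError, roundingError, Finset.sum_insert hs]
  ring

lemma abs_roundingError_le (hp : ∀ n, p n ∈ Set.Icc (0 : ℝ) 1) (hB : B ⊆ s) {δ : ℝ}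
    (hf : ∀ n, |f n| ≤ δ) : |roundingError p f B s| ≤ s.card * δ := by
  classical
  have hterm (n : α) : |(if n ∈ B then f n else 0) - p n * f n| ≤ δ := by
    refine le_trans ?_ (hf n)
    have hfac : (if n ∈ B then f n else 0) - p n * f n =
        ((if n ∈ B then 1 else 0) - p n) * f n := by
      rw [sub_mul, ite_mul, one_mul, zero_mul]
    rw [hfac, abs_mul]
    refine mul_le_of_le_one_left (abs_nonneg _) (abs_le.2 ?_)
    have := hp n
    constructor <;> split_ifs <;> linarith [this.1, this.2]
  rw [roundingError, ← Finset.inter_eq_right.2 hB, ← Finset.sum_ite_mem, ← Finset.sum_sub_distrib,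
    ← nsmul_eq_mul]
  exact (Finset.abs_sum_le_sum_abs _ _).trans (Finset.sum_le_card_nsmul _ _ _ fun n _ => hterm n)

end Rounding

lemma exp_le_add_exp_sq (x : ℝ) : Real.exp x ≤ x + Real.exp (x ^ 2) := by
  have hsq := Real.add_one_le_exp (x ^ 2)
  rcases le_or_gt |x| 1 with h | h
  · linarith [(abs_le.1 (Real.abs_exp_sub_one_sub_id_le h)).2]
  · rcases lt_abs.1 h with h | h
    · linarith [Real.exp_le_exp.2 (show x ≤ x ^ 2 by nlinarith)]
    · nlinarith [Real.exp_le_one_iff.2 (show x ≤ 0 by linarith)]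

section Bernoulli

variable {p : ℝ} (hp : p ∈ Set.Icc (0 : ℝ) 1)

include hp

lemma bernoulli_exp_le (t : ℝ) :
    p * Real.exp ((1 - p) * t) + (1 - p) * Real.exp (-p * t) ≤ Real.exp (t ^ 2) := by
  have hexp {u : ℝ} (hu : u ^ 2 ≤ 1) : Real.exp (u * t) ≤ u * t + Real.exp (t ^ 2) := by
    refine (exp_le_add_exp_sq _).trans (add_le_add_right (Real.exp_le_exp.2 ?_) _)
    rw [mul_pow]
    exact mul_le_of_le_one_left (sq_nonneg t) hu
  obtain ⟨hp0, hp1⟩ := hp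
  have hsuccess := mul_le_mul_of_nonneg_left (hexp (u := 1 - p) (by nlinarith)) hp0
  have hfailure := mul_le_mul_of_nonneg_left (hexp (u := -p) (by nlinarith)) (sub_nonneg.2 hp1)
  linarith

lemma bernoulli_cosh_le (x t : ℝ) :
    p * Real.cosh (x + (1 - p) * t) + (1 - p) * Real.cosh (x + -p * t) ≤
      Real.cosh x * Real.exp (t ^ 2) := by
  have hpos := mul_le_mul_of_nonneg_left (bernoulli_exp_le hp t) (Real.exp_pos x).le
  have hneg := mul_le_mul_of_nonneg_left (bernoulli_exp_le hp (-t)) (Real.exp_pos (-x)).le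
  rw [neg_sq] at hneg
  simp only [mul_neg] at hneg
  simp only [Real.cosh_eq, neg_add, Real.exp_add]
  linarith

lemma bernoulli_sum_cosh_le {ι : Type*} [Fintype ι] (x : ι → ℝ) {w : ι → ℝ} {c : ℝ}
    (hw : ∀ i, |w i| ≤ c) :
    p * ∑ i, Real.cosh (x i + (1 - p) * w i) + (1 - p) * ∑ i, Real.cosh (x i + -p * w i) ≤
      (∑ i, Real.cosh (x i)) * Real.exp (c ^ 2) := by
  rw [Finset.mul_sum, Finset.mul_sum, ← Finset.sum_add_distrib, Finset.sum_mul]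
  refine Finset.sum_le_sum fun i _ => (bernoulli_cosh_le hp _ _).trans ?_
  gcongr ?_ * Real.exp ?_
  exact sq_le_sq' (neg_le_of_abs_le (hw i)) (le_of_abs_le (hw i))

end Bernoulli

section Rounding

variable {α ι : Type*} [Fintype ι] {p : α → ℝ} (hp : ∀ n, p n ∈ Set.Icc (0 : ℝ) 1)
  {v : α → ι → ℝ} {c : α → ℝ} (hv : ∀ n i, |v n i| ≤ c n) (s : Finset α)

include hp hv

/-- The method of conditional expectations: for a random rounding the expectation of the left-hand
side satisfies the bound, and deciding the elements of `s` one by one need not increase it. -/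
lemma exists_subset_sum_cosh_roundingError_le :
    ∃ B ⊆ s, ∑ i, Real.cosh (roundingError p (v · i) B s) ≤
      Fintype.card ι * Real.exp (∑ n ∈ s, c n ^ 2) := by
  classical
  induction s using Finset.induction_on with
  | empty => exact ⟨∅, subset_rfl, by simp [roundingError]⟩
  | insert m s hm ih =>
    obtain ⟨B, hB, hle⟩ := ih
    set x : ι → ℝ := fun i => roundingError p (v · i) B s
    set F : ℝ := ∑ i, Real.cosh (x i + (1 - p m) * v m i)
    set G : ℝ := ∑ i, Real.cosh (x i + -p m * v m i)
    have hmean : p m * F + (1 - p m) * G ≤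
        Fintype.card ι * Real.exp (∑ n ∈ insert m s, c n ^ 2) := by
      refine (bernoulli_sum_cosh_le (hp m) x (hv m)).trans ?_
      rw [Finset.sum_insert hm, add_comm, Real.exp_add, ← mul_assoc]
      gcongr
    obtain ⟨hp0, hp1⟩ := hp m
    rcases le_total F G with h | h
    · refine ⟨insert m B, Finset.insert_subset_insert m hB, ?_⟩
      simp only [roundingError_insert_insert (fun h => hm (hB h)) hm]
      exact le_trans (by nlinarith) hmean
    · refine ⟨B, hB.trans (Finset.subset_insert m s), ?_⟩
      simp only [roundingError_insert_right hm]
      exact le_trans (by nlinarith) hmean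

lemma exists_subset_abs_roundingError_le {l : ℝ} (hl : 0 < l) (hc : l ^ 2 * ∑ n ∈ s, c n ^ 2 ≤ 1) :
    ∃ B ⊆ s, ∀ i, |roundingError p (v · i) B s| ≤ (Real.log (2 * Fintype.card ι) + 1) / l := by
  obtain ⟨B, hB, hle⟩ := exists_subset_sum_cosh_roundingError_le hp
    (v := fun n i => l * v n i) (c := fun n => l * c n)
    (fun n i => by rw [abs_mul, abs_of_pos hl]; gcongr; exact hv n i) s
  refine ⟨B, hB, fun i => ?_⟩
  have hcard : (0 : ℝ) < Fintype.card ι := Nat.cast_pos.2 (Fintype.card_pos_iff.2 ⟨i⟩)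
  have hcosh : Real.cosh (l * roundingError p (v · i) B s) ≤ Fintype.card ι * Real.exp 1 := by
    simp only [roundingError_const_mul, mul_pow, ← Finset.mul_sum] at hle
    refine (Finset.single_le_sum (f := fun i => Real.cosh (l * roundingError p (v · i) B s))
      (fun i _ => (Real.cosh_pos _).le) (Finset.mem_univ i)).trans
      (hle.trans ?_)
    gcongr
  rw [← Real.cosh_abs, abs_mul, abs_of_pos hl, Real.cosh_eq] at hcosh
  rw [le_div_iff₀' hl, ← Real.log_exp 1, ← Real.log_mul (by positivity) (Real.exp_pos 1).ne',
    Real.le_log_iff_exp_le (by positivity)]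
  linarith [Real.exp_pos (-(l * |roundingError p (v · i) B s|))]

end Rounding

/-! ### Odd sine polynomials of small sup norm -/

/-- The terms of the Fourier series of the square wave of height `π / 4`. -/
noncomputable def oddSine (u : ℝ) (n : ℕ) : ℝ := Real.sin ((2 * n + 1) * u) / (2 * n + 1)

/-- The Poisson mean at radius `Q` of the square wave of height `π / 4`. -/
noncomputable def squareWave (Q u : ℝ) : ℝ :=
  (log ((1 + Q * exp (u * I)) / (1 - Q * exp (u * I))) / 2).im

lemma abs_oddSine_sub_le (u u' : ℝ) (n : ℕ) : |oddSine u n - oddSine u' n| ≤ |u - u'| := by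
  have hn : (0 : ℝ) < 2 * n + 1 := by positivity
  rw [oddSine, oddSine, ← sub_div, abs_div, abs_of_pos hn, div_le_iff₀' hn]
  refine (Real.abs_sin_sub_sin_le _ _).trans_eq ?_
  rw [← mul_sub, abs_mul, abs_of_pos hn]

lemma abs_oddSine_le (u : ℝ) (n : ℕ) : |oddSine u n| ≤ 1 / (2 * n + 1) := by
  have hn : (0 : ℝ) < 2 * n + 1 := by positivity
  rw [oddSine, abs_div, abs_of_pos hn]
  exact div_le_div_of_nonneg_right (Real.abs_sin_le_one _) hn.le

lemma abs_arg_one_add_div_one_sub_le {z : ℂ} (hz : ‖z‖ < 1) :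
    |arg ((1 + z) / (1 - z))| ≤ Real.pi / 2 := by
  rw [abs_arg_le_pi_div_two_iff, div_re, ← add_div]
  have hsq : normSq z < 1 := by
    rw [normSq_eq_norm_sq]
    nlinarith [norm_nonneg z]
  rw [normSq_apply] at hsq
  refine div_nonneg ?_ (normSq_nonneg _)
  simp only [add_re, one_re, sub_re, add_im, one_im, sub_im]
  nlinarith

lemma hasSum_pow_odd_div {z : ℂ} (hz : ‖z‖ < 1) :
    HasSum (fun n : ℕ => z ^ (2 * n + 1) / (2 * n + 1)) (log ((1 + z) / (1 - z)) / 2) := by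
  have harctan : I * arctan (-I * z) = log ((1 + z) / (1 - z)) / 2 := by
    have hmul : -I * z * I = z := by linear_combination (-z) * I_mul_I
    rw [arctan, hmul]
    linear_combination (-(1 / 2 : ℂ) * log ((1 + z) / (1 - z))) * I_mul_I
  rw [← harctan]
  refine ((hasSum_arctan (z := -I * z) (by simpa using hz)).mul_left I).congr_fun fun n => ?_
  have hsign : ((-1 : ℂ) ^ n) * (-1) ^ n = 1 := by rw [← mul_pow, neg_one_mul, neg_neg, one_pow]
  rw [mul_pow, pow_succ (-I), pow_mul, neg_sq, I_sq]
  push_cast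
  linear_combination
    (z ^ (2 * n + 1) / (2 * n + 1)) * (I * I * hsign + I_mul_I)

section SquareWave

variable {Q : ℝ} (hQ0 : 0 ≤ Q)

include hQ0

lemma norm_ofReal_mul_exp_mul_I (u : ℝ) : ‖(Q : ℂ) * exp (u * I)‖ = Q := by
  rw [norm_mul, norm_exp_ofReal_mul_I, mul_one, norm_real, Real.norm_of_nonneg hQ0]

lemma abs_squareWave_le (hQ1 : Q < 1) (u : ℝ) : |squareWave Q u| ≤ Real.pi / 4 := by
  have harg := abs_arg_one_add_div_one_sub_le ((norm_ofReal_mul_exp_mul_I hQ0 u).trans_lt hQ1)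
  rw [squareWave, div_ofNat_im, log_im, abs_div, abs_two]
  linarith

lemma hasSum_squareWave (hQ1 : Q < 1) (u : ℝ) :
    HasSum (fun n : ℕ => Q ^ (2 * n + 1) * oddSine u n) (squareWave Q u) := by
  refine (hasSum_im (hasSum_pow_odd_div ((norm_ofReal_mul_exp_mul_I hQ0 u).trans_lt hQ1))).congr_fun
    fun n => ?_
  have hterm : ((Q : ℂ) * exp (u * I)) ^ (2 * n + 1) / (2 * n + 1) =
      ((Q ^ (2 * n + 1) / (2 * n + 1) : ℝ) : ℂ) * exp (((2 * n + 1) * u : ℝ) * I) := by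
    rw [mul_pow, ← exp_nat_mul]
    push_cast
    ring_nf
  rw [hterm, im_ofReal_mul, exp_ofReal_mul_I_im, oddSine]
  ring

lemma abs_sum_range_mul_oddSine_le (hQ1 : Q ≤ 1) (K : ℕ) (u : ℝ) :
    |∑ n ∈ Finset.range K, (1 - Q ^ (2 * n + 1)) * oddSine u n| ≤ K * (1 - Q) := by
  have hterm (n : ℕ) : |(1 - Q ^ (2 * n + 1)) * oddSine u n| ≤ 1 - Q := by
    have hbernoulli := one_add_mul_sub_le_pow (show (-1 : ℝ) ≤ Q by linarith) (2 * n + 1)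
    push_cast at hbernoulli
    have : (0 : ℝ) < 2 * n + 1 := by positivity
    rw [abs_mul, abs_of_nonneg (sub_nonneg.2 (pow_le_one₀ hQ0 hQ1))]
    calc (1 - Q ^ (2 * n + 1)) * |oddSine u n|
        ≤ ((2 * n + 1) * (1 - Q)) * (1 / (2 * n + 1)) := by
          gcongr
          · linarith
          · exact abs_oddSine_le u n
      _ = 1 - Q := by field_simp
  refine (Finset.abs_sum_le_sum_abs _ _).trans
    ((Finset.sum_le_card_nsmul _ _ _ fun n _ => hterm n).trans_eq ?_)
  rw [Finset.card_range, nsmul_eq_mul]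

lemma abs_squareWave_sub_sum_le (hQ1 : Q < 1) {N : ℕ} (hN : 0 < N) (u : ℝ) :
    |squareWave Q u - ∑ n ∈ Finset.range N, Q ^ (2 * n + 1) * oddSine u n| ≤
      (1 - Q)⁻¹ * (1 / N) := by
  have hterm (n : ℕ) : ‖Q ^ (2 * (n + N) + 1) * oddSine u (n + N)‖ ≤ Q ^ n * (1 / N) := by
    rw [norm_mul, Real.norm_of_nonneg (by positivity)]
    refine mul_le_mul (pow_le_pow_of_le_one hQ0 hQ1.le (by lia)) ((abs_oddSine_le _ _).trans ?_)
      (norm_nonneg _) (by positivity)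
    gcongr
    push_cast
    linarith [Nat.cast_nonneg (α := ℝ) n, Nat.cast_nonneg (α := ℝ) N]
  rw [← ((hasSum_nat_add_iff' N).2 (hasSum_squareWave hQ0 hQ1 u)).tsum_eq]
  exact tsum_of_norm_bounded ((hasSum_geometric_of_lt_one hQ0 hQ1).mul_right (1 / (N : ℝ))) hterm

lemma abs_sum_oddSine_le (hQ1 : Q < 1) {K N : ℕ} (hN : 0 < N) (hKN : K ≤ N) {B : Finset ℕ}
    (hB : B ⊆ Finset.Ico K N) (u : ℝ) :
    |∑ n ∈ Finset.range K ∪ B, oddSine u n| ≤ Real.pi / 4 + K * (1 - Q) + (1 - Q)⁻¹ * (1 / N) +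
      |roundingError (fun n => Q ^ (2 * n + 1)) (oddSine u) B (Finset.Ico K N)| := by
  have hdisj : Disjoint (Finset.range K) B := by
    refine Finset.disjoint_left.2 fun n hn hnB => ?_
    exact (Finset.mem_range.1 hn).not_ge (Finset.mem_Ico.1 (hB hnB)).1
  have hsplit : ∑ n ∈ Finset.range K ∪ B, oddSine u n =
      squareWave Q u + ∑ n ∈ Finset.range K, (1 - Q ^ (2 * n + 1)) * oddSine u n -
        (squareWave Q u - ∑ n ∈ Finset.range N, Q ^ (2 * n + 1) * oddSine u n) +
        roundingError (fun n => Q ^ (2 * n + 1)) (oddSine u) B (Finset.Ico K N) := by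
    rw [Finset.sum_union hdisj, ← Finset.sum_range_add_sum_Ico _ hKN, roundingError]
    simp only [sub_mul, one_mul, Finset.sum_sub_distrib]
    ring
  rw [hsplit]
  refine (abs_add_le _ _).trans (add_le_add_left ((abs_sub _ _).trans (add_le_add
    ((abs_add_le _ _).trans (add_le_add ?_ ?_)) ?_)) _)
  exacts [abs_squareWave_le hQ0 hQ1 u, abs_sum_range_mul_oddSine_le hQ0 hQ1.le K u,
    abs_squareWave_sub_sum_le hQ0 hQ1 hN u]

end SquareWave

lemma sum_Ico_one_div_sq_le {K : ℕ} (hK : 0 < K) (N : ℕ) :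
    ∑ n ∈ Finset.Ico K N, (1 / (2 * n + 1 : ℝ)) ^ 2 ≤ 1 / (K : ℝ) := by
  obtain ⟨k, rfl⟩ := Nat.exists_eq_add_of_lt hK
  rw [zero_add, Finset.Ico_add_one_left_eq_Ioo]
  calc ∑ n ∈ Finset.Ioo k N, (1 / (2 * n + 1 : ℝ)) ^ 2
      ≤ ∑ n ∈ Finset.Ioo k N, 1 / 2 * ((n : ℝ) ^ 2)⁻¹ := by
        refine Finset.sum_le_sum fun n hn => ?_
        have hn0 : (0 : ℝ) < n := Nat.cast_pos.2 (Nat.zero_lt_of_lt (Finset.mem_Ioo.1 hn).1)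
        rw [div_pow, one_pow, ← one_div ((n : ℝ) ^ 2), one_div_mul_one_div,
          div_le_div_iff_of_pos_left one_pos (by positivity) (by positivity)]
        nlinarith
    _ ≤ 1 / 2 * (2 / (k + 1)) := by
        rw [← Finset.mul_sum]
        gcongr
        exact sum_Ioo_inv_sq_le k N
    _ = 1 / ((k + 1 : ℕ) : ℝ) := by
        push_cast
        ring

lemma exists_grid_point {M : ℕ} (hM : 0 < M) (u : ℝ) :
    ∃ (i : Fin M) (t : ℝ), oddSine u = oddSine t ∧ |t - 2 * Real.pi * i / M| ≤ 2 * Real.pi / M := by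
  have hM0 : (0 : ℝ) < M := Nat.cast_pos.2 hM
  set f := Int.fract (u / (2 * Real.pi)) with hf
  have : 0 ≤ f := Int.fract_nonneg _
  have hlt : ⌊M * f⌋₊ < M := by
    rw [Nat.floor_lt (by positivity)]
    exact mul_lt_of_lt_one_right hM0 (Int.fract_lt_one _)
  refine ⟨⟨⌊M * f⌋₊, hlt⟩, 2 * Real.pi * f, funext fun n => ?_, ?_⟩
  · have hperiod : (2 * n + 1) * u = (2 * n + 1) * (2 * Real.pi * f) +
        (((2 * n + 1) * ⌊u / (2 * Real.pi)⌋ : ℤ) : ℝ) * (2 * Real.pi) := by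
      have := Real.pi_ne_zero
      rw [hf, Int.fract]
      push_cast
      field_simp
      ring
    rw [oddSine, hperiod, Real.sin_add_int_mul_two_pi, oddSine]
  · have hfactor : 2 * Real.pi * f - 2 * Real.pi * ⌊M * f⌋₊ / M =
        2 * Real.pi / M * (M * f - ⌊M * f⌋₊) := by
      field_simp
    rw [hfactor, abs_mul, abs_of_pos (div_pos Real.two_pi_pos hM0)]
    refine mul_le_of_le_one_right (by positivity) (abs_le.2 ⟨?_, ?_⟩)
    · linarith [Nat.floor_le (show 0 ≤ M * f by positivity)]
    · linarith [Nat.lt_floor_add_one (M * f)]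

/-- On the grid of `M` angles this is the rounding of finitely many linear forms; between grid
points it is a Lipschitz estimate. -/
lemma exists_subset_abs_roundingError_oddSine_le {K N M : ℕ} (hK : 0 < K) (hM : 0 < M) {p : ℕ → ℝ}
    (hp : ∀ n, p n ∈ Set.Icc (0 : ℝ) 1) :
    ∃ B ⊆ Finset.Ico K N, ∀ u, |roundingError p (oddSine u) B (Finset.Ico K N)| ≤
      (Real.log (2 * M) + 1) / √K + N * (2 * Real.pi / M) := by
  have hK0 : (0 : ℝ) < K := Nat.cast_pos.2 hK
  obtain ⟨B, hB, hgrid⟩ := exists_subset_abs_roundingError_le hp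
    (v := fun n (i : Fin M) => oddSine (2 * Real.pi * i / M) n) (fun n i => abs_oddSine_le _ n)
    (Finset.Ico K N) (Real.sqrt_pos.2 hK0) (by
      rw [Real.sq_sqrt hK0.le, ← le_div_iff₀' hK0]
      exact sum_Ico_one_div_sq_le hK N)
  refine ⟨B, hB, fun u => ?_⟩
  obtain ⟨i, t, ht, hti⟩ := exists_grid_point hM u
  have hlip : |roundingError p (oddSine t) B (Finset.Ico K N) -
      roundingError p (oddSine (2 * Real.pi * i / M)) B (Finset.Ico K N)| ≤
        N * (2 * Real.pi / M) := by
    rw [roundingError_sub]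
    refine (abs_roundingError_le hp hB fun n => (abs_oddSine_sub_le t _ n).trans hti).trans ?_
    gcongr
    rw [Nat.card_Ico]
    exact Nat.sub_le N K
  have hgridi := hgrid i
  rw [Fintype.card_fin] at hgridi
  rw [ht, ← add_sub_cancel (roundingError p (oddSine (2 * Real.pi * i / M)) B (Finset.Ico K N))
    (roundingError p (oddSine t) B (Finset.Ico K N))]
  exact (abs_add_le _ _).trans (add_le_add hgridi hlip)

/-- The weights of the Poisson mean of radius `1 - K⁻²` are rounded on `[K, K³)`. -/
lemma exists_abs_sum_oddSine_le {K : ℕ} (hK : 0 < K) : ∃ A : Finset ℕ, 0 ∈ A ∧ ∀ u,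
    |∑ n ∈ A, oddSine u n| ≤
      Real.pi / 4 + (3 / K + (Real.log (16 * K ^ 4) + 1) / √K) := by
  have : (0 : ℝ) < K := Nat.cast_pos.2 hK
  set Q : ℝ := 1 - 1 / (K : ℝ) ^ 2 with hQ
  have hQ0 : 0 ≤ Q := sub_nonneg.2 ((div_le_one (by positivity)).2
    (one_le_pow₀ (Nat.one_le_cast.2 hK)))
  have hQ1 : Q < 1 := sub_lt_self _ (by positivity)
  obtain ⟨B, hB, hround⟩ := exists_subset_abs_roundingError_oddSine_le (N := K ^ 3)
    (M := 8 * K ^ 4) hK (by positivity) (p := fun n => Q ^ (2 * n + 1))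
    fun n => ⟨by positivity, pow_le_one₀ hQ0 hQ1.le⟩
  refine ⟨Finset.range K ∪ B, Finset.mem_union_left _ (Finset.mem_range.2 hK), fun u => ?_⟩
  have hmesh : ((K ^ 3 : ℕ) : ℝ) * (2 * Real.pi / (8 * K ^ 4 : ℕ)) ≤ 1 / K := by
    have hpi : ((K ^ 3 : ℕ) : ℝ) * (2 * Real.pi / (8 * K ^ 4 : ℕ)) = Real.pi / 4 * (1 / K) := by
      push_cast
      field_simp
      ring
    rw [hpi]
    exact mul_le_of_le_one_left (by positivity) (by linarith [Real.pi_le_four])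
  have hlow : (K : ℝ) * (1 - Q) = 1 / K := by
    rw [hQ]
    field_simp
    ring
  have htail : (1 - Q)⁻¹ * (1 / (K ^ 3 : ℕ)) = 1 / (K : ℝ) := by
    rw [hQ, sub_sub_cancel]
    push_cast
    field_simp
  have hlog : 2 * ((8 * K ^ 4 : ℕ) : ℝ) = 16 * K ^ 4 := by
    push_cast
    ring
  have hsum := abs_sum_oddSine_le hQ0 hQ1 (by positivity) (Nat.le_self_pow three_ne_zero K) hB u
  have hroundu := hround u
  rw [hlow, htail] at hsum
  rw [hlog] at hroundu
  have hthree : 3 / (K : ℝ) = 1 / K + 1 / K + 1 / K := by ring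
  linarith

lemma tendsto_three_div_add_log_div_sqrt :
    Tendsto (fun x : ℝ => 3 / x + (Real.log (16 * x ^ 4) + 1) / √x) atTop (𝓝 0) := by
  have hlog :=
    ((isLittleO_log_rpow_atTop (one_half_pos (α := ℝ))).tendsto_div_nhds_zero).const_mul 4
  have hlim := (tendsto_const_nhds (x := (3 : ℝ)).div_atTop tendsto_id).add
    ((tendsto_const_nhds (x := Real.log 16 + 1).div_atTop Real.tendsto_sqrt_atTop).add hlog)
  rw [mul_zero, add_zero, add_zero] at hlim
  refine hlim.congr' ?_
  filter_upwards [eventually_gt_atTop 0] with x hx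
  rw [← Real.sqrt_eq_rpow, Real.log_mul (by norm_num) (by positivity), Real.log_pow, id]
  push_cast
  ring

lemma exists_abs_sum_oddSine_le_add {ε : ℝ} (hε : 0 < ε) :
    ∃ A : Finset ℕ, 0 ∈ A ∧ ∀ u, |∑ n ∈ A, oddSine u n| ≤ Real.pi / 4 + ε := by
  have hsmall := (tendsto_three_div_add_log_div_sqrt.comp
    tendsto_natCast_atTop_atTop).eventually_le_const hε
  obtain ⟨K, hK, hKε⟩ := ((eventually_gt_atTop 0).and hsmall).exists
  obtain ⟨A, hA0, hA⟩ := exists_abs_sum_oddSine_le hK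
  exact ⟨A, hA0, fun u => (hA u).trans (add_le_add_right hKε _)⟩

/-! ### Zeros at the odd multiples of one height -/

lemma re_exp_mul_div_im_mul_I (a : ℂ) (Y : ℝ) :
    (exp (a * Y) / (a.im * I)).re = Real.exp (a.re * Y) * (Real.sin (a.im * Y) / a.im) := by
  rw [div_mul_eq_div_div, div_I, neg_re, mul_I_re, neg_neg, div_ofReal_im, exp_im, re_mul_ofReal,
    im_mul_ofReal, mul_div_assoc]

lemma norm_div_sub_div_im_mul_I_le {a : ℂ} (ha : a.im ≠ 0) (w : ℂ) :
    ‖w / a - w / (a.im * I)‖ ≤ ‖w‖ * (|a.re| / a.im ^ 2) := by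
  have ha0 : a ≠ 0 := fun h => ha (by rw [h, zero_im])
  have him0 : (a.im : ℂ) * I ≠ 0 := mul_ne_zero (ofReal_ne_zero.2 ha) I_ne_zero
  have hdiff : w / a - w / (a.im * I) = w * (-a.re / (a * (a.im * I))) := by
    rw [div_sub_div _ _ ha0 him0, mul_div_assoc']
    congr 1
    linear_combination w * re_add_im a
  rw [hdiff, norm_mul, norm_div, norm_neg, norm_mul, norm_mul, norm_I, mul_one, norm_real,
    norm_real, Real.norm_eq_abs, Real.norm_eq_abs, ← sq_abs a.im, sq]
  gcongr
  exact abs_im_le_norm a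

lemma abs_re_exp_mul_div_sub_le {a : ℂ} (ha : a.im ≠ 0) (Y : ℝ) :
    |(exp (a * Y) / a).re - Real.exp (a.re * Y) * (Real.sin (a.im * Y) / a.im)| ≤
      Real.exp (a.re * Y) * (|a.re| / a.im ^ 2) := by
  rw [← re_exp_mul_div_im_mul_I, ← sub_re, ← re_mul_ofReal, ← norm_exp]
  exact (abs_re_le_norm _).trans (norm_div_sub_div_im_mul_I_le ha _)

/-- The zeros of the zeta function to be constructed, for finitely many `n`; `γ` is the height of
the lowest one. -/
noncomputable def oddZero (β γ : ℝ) (n : ℕ) : ℂ := β + ((2 * n + 1) * γ : ℝ) * I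

lemma oddZero_re (β γ : ℝ) (n : ℕ) : (oddZero β γ n).re = β := by
  simp [oddZero]

lemma oddZero_im (β γ : ℝ) (n : ℕ) : (oddZero β γ n).im = (2 * n + 1) * γ := by
  simp [oddZero]

section Oscillation

variable {β γ : ℝ} (hγ : 0 < γ)

include hγ

lemma oddZero_im_ne_zero (n : ℕ) : (oddZero β γ n).im ≠ 0 := by
  rw [oddZero_im]
  positivity

lemma oddZero_injective : Function.Injective (oddZero β γ) := fun m n hmn => by
  have him := congrArg im hmn
  rw [oddZero_im, oddZero_im] at him
  exact Nat.cast_injective (R := ℝ) (by linarith [mul_right_cancel₀ hγ.ne' him])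

lemma abs_re_exp_oddZero_sub_le (n : ℕ) (Y : ℝ) :
    |(exp (oddZero β γ n * Y) / oddZero β γ n).re -
      Real.exp (β * Y) / γ * oddSine (γ * Y) n| ≤ Real.exp (β * Y) * (|β| / γ ^ 2) := by
  have hterm := abs_re_exp_mul_div_sub_le (oddZero_im_ne_zero (β := β) hγ n) Y
  rw [oddZero_re, oddZero_im] at hterm
  have hsine : Real.exp (β * Y) / γ * oddSine (γ * Y) n =
      Real.exp (β * Y) * (Real.sin ((2 * n + 1) * γ * Y) / ((2 * n + 1) * γ)) := by
    rw [oddSine, mul_assoc _ γ Y]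
    field_simp
  rw [hsine]
  refine hterm.trans ?_
  gcongr
  exact le_mul_of_one_le_left hγ.le (by linarith [Nat.cast_nonneg (α := ℝ) n])

lemma abs_sum_oddZero_le {A : Finset ℕ} {δ : ℝ} (hA : ∀ u, |∑ n ∈ A, oddSine u n| ≤ δ) (Y : ℝ) :
    |∑ n ∈ A, 2 * (exp (oddZero β γ n * Y) / oddZero β γ n).re| ≤
      (2 * δ / γ + 2 * A.card * |β| / γ ^ 2) * Real.exp (β * Y) := by
  set E := Real.exp (β * Y)
  set a := fun n => (exp (oddZero β γ n * Y) / oddZero β γ n).re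
  have herror : |∑ n ∈ A, (a n - E / γ * oddSine (γ * Y) n)| ≤ A.card * (E * (|β| / γ ^ 2)) := by
    rw [← nsmul_eq_mul]
    exact (Finset.abs_sum_le_sum_abs _ _).trans
      (Finset.sum_le_card_nsmul _ _ _ fun n _ => abs_re_exp_oddZero_sub_le hγ n Y)
  have hmain : |E / γ * ∑ n ∈ A, oddSine (γ * Y) n| ≤ E / γ * δ := by
    rw [abs_mul, abs_of_pos (div_pos (Real.exp_pos _) hγ)]
    gcongr
    exact hA _
  have hsplit : ∑ n ∈ A, 2 * a n = 2 * (∑ n ∈ A, (a n - E / γ * oddSine (γ * Y) n) +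
      E / γ * ∑ n ∈ A, oddSine (γ * Y) n) := by
    rw [Finset.sum_sub_distrib, ← Finset.mul_sum, ← Finset.mul_sum, sub_add_cancel]
  calc |∑ n ∈ A, 2 * a n| ≤ 2 * (A.card * (E * (|β| / γ ^ 2)) + E / γ * δ) := by
        rw [hsplit, abs_mul, abs_two]
        gcongr
        exact (abs_add_le _ _).trans (add_le_add herror hmain)
    _ = (2 * δ / γ + 2 * A.card * |β| / γ ^ 2) * E := by ring

end Oscillation

lemma tendsto_norm_oddZero_mul (β c d : ℝ) :
    Tendsto (fun γ => ‖oddZero β γ 0‖ * (c / γ + d / γ ^ 2)) atTop (𝓝 c) := by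
  have hnorm : Tendsto (fun γ : ℝ => ‖((β / γ : ℝ) : ℂ) + I‖) atTop (𝓝 1) := by
    have hdiv := (continuous_ofReal.tendsto 0).comp
      (tendsto_const_nhds (x := β).div_atTop tendsto_id)
    simpa using (hdiv.add_const I).norm
  have hlim := hnorm.mul ((tendsto_const_nhds (x := c)).add
    (tendsto_const_nhds (x := d).div_atTop tendsto_id))
  rw [add_zero, one_mul] at hlim
  refine hlim.congr' ?_
  filter_upwards [eventually_gt_atTop 0] with γ hγ
  have hzero : oddZero β γ 0 = γ * (((β / γ : ℝ) : ℂ) + I) := by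
    have : (γ : ℂ) ≠ 0 := ofReal_ne_zero.2 hγ.ne'
    rw [oddZero]
    push_cast
    field_simp
    ring
  rw [hzero, norm_mul, norm_real, Real.norm_of_nonneg hγ.le, id]
  field_simp

lemma exists_div_add_div_sq_le_div_norm_oddZero (β c d : ℝ) {ε : ℝ} (hε : 0 < ε) :
    ∃ γ > 0, c / γ + d / γ ^ 2 ≤ (c + ε) / ‖oddZero β γ 0‖ := by
  obtain ⟨γ, hγ, hle⟩ := ((eventually_gt_atTop 0).and ((tendsto_norm_oddZero_mul β c d)
    |>.eventually_le_const (lt_add_of_pos_right c hε))).exists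
  have hz : oddZero β γ 0 ≠ 0 := fun h => oddZero_im_ne_zero hγ 0 (by rw [h, zero_im])
  exact ⟨γ, hγ, (le_div_iff₀' (norm_pos_iff.2 hz)).2 hle⟩

lemma eventually_abs_le_mul_rpow {f g : ℝ → ℝ} {r b c d : ℝ} (hrb : r < b) (hcd : c < d)
    (hfg : (fun x => f x + g x) =O[atTop] fun x => x ^ r)
    (hg : ∀ᶠ x in atTop, |g x| ≤ c * x ^ b) : ∀ᶠ x in atTop, |f x| ≤ d * x ^ b := by
  filter_upwards [(hfg.trans_isLittleO (isLittleO_rpow_rpow hrb)).bound (sub_pos.2 hcd), hg,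
    eventually_ge_atTop 0] with x hfgx hgx hx
  rw [Real.norm_eq_abs, Real.norm_of_nonneg (Real.rpow_nonneg hx b)] at hfgx
  calc |f x| = |f x + g x - g x| := by rw [add_sub_cancel_right]
    _ ≤ (d - c) * x ^ b + c * x ^ b := (abs_sub _ _).trans (add_le_add hfgx hgx)
    _ = d * x ^ b := by ring

lemma exists_abs_sum_oddZero_le (β : ℝ) {ε : ℝ} (hε : 0 < ε) :
    ∃ γ > 0, ∃ A : Finset ℕ, 0 ∈ A ∧ ∀ x : ℝ, 0 < x →
      |∑ n ∈ A, 2 * (exp (oddZero β γ n * Real.log x) / oddZero β γ n).re| ≤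
        (Real.pi / 2 + ε) / ‖oddZero β γ 0‖ * x ^ β := by
  obtain ⟨A, hA0, hA⟩ := exists_abs_sum_oddSine_le_add (show 0 < ε / 4 by positivity)
  obtain ⟨γ, hγ, hle⟩ := exists_div_add_div_sq_le_div_norm_oddZero β
    (2 * (Real.pi / 4 + ε / 4)) (2 * A.card * |β|) (half_pos hε)
  refine ⟨γ, hγ, A, hA0, fun x hx => ?_⟩
  have hconst : 2 * (Real.pi / 4 + ε / 4) + ε / 2 = Real.pi / 2 + ε := by ring
  rw [hconst] at hle
  rw [Real.rpow_def_of_pos hx, mul_comm (Real.log x)]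
  exact (abs_sum_oddZero_le hγ hA _).trans (mul_le_mul_of_nonneg_right hle (Real.exp_pos _).le)

end Beurling

theorem theorem1p3 (ε β₀ r : ℝ) (hε : 0 < ε) (hβ₀ : β₀ ∈ Set.Ioo (1 / 2 : ℝ) 1)
    (hr : 1 / 2 < r) (hrβ₀ : r < β₀) :
    ∃ (G : Type) (_ : CommMonoid G) (S : ArithmeticalSemigroup G),
      (∃ κ : ℝ, S.AxiomA κ r) ∧
      (∀ κ θ : ℝ, S.AxiomA κ θ → r ≤ θ) ∧
      ∃ ρ₀ : ℂ, ρ₀.re = β₀ ∧ ρ₀.im ≠ 0 ∧ S.IsZetaZero r ρ₀ ∧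
        ∀ᶠ x : ℝ in Filter.atTop,
          |S.Delta x| ≤ (Real.pi / 2 + ε) * (x ^ β₀ / ‖ρ₀‖) := by
  obtain ⟨γ, hγ, A, hA0, hA⟩ := Beurling.exists_abs_sum_oddZero_le β₀ (half_pos hε)
  set z := Beurling.oddZero β₀ γ
  have hre : ∀ n, (z n).re = β₀ := Beurling.oddZero_re β₀ γ
  have him : ∀ n, (z n).im ≠ 0 := Beurling.oddZero_im_ne_zero hγ
  have hinj : Function.Injective z := Beurling.oddZero_injective hγ
  have hz : 0 < ‖z 0‖ := norm_pos_iff.2 fun h => him 0 (by rw [h, Complex.zero_im])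
  obtain ⟨S, haxiomA, hoptimal, hzeros, hDelta⟩ :=
    Beurling.exists_arithmeticalSemigroup_of_zeros hr (hrβ₀.trans hβ₀.2) hβ₀.2 (A.image z)
      (Finset.forall_mem_image.2 fun n _ => (hre n).le)
      (Finset.forall_mem_image.2 fun n _ => him n)
  refine ⟨ℕ+, inferInstance, S, haxiomA, hoptimal, z 0, hre 0, him 0,
    hzeros _ (Finset.mem_image_of_mem z hA0) (hrβ₀.trans_eq (hre 0).symm), ?_⟩
  simp only [Finset.sum_image hinj.injOn] at hDelta
  simp only [mul_div_assoc', mul_div_right_comm]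
  have hconst : (Real.pi / 2 + ε / 2) / ‖z 0‖ < (Real.pi / 2 + ε) / ‖z 0‖ := by gcongr; linarith
  exact Beurling.eventually_abs_le_mul_rpow hrβ₀ hconst hDelta
    ((Filter.eventually_gt_atTop 0).mono hA)
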